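/- For a vector $a$ let $\mathrm{ns}(a)=\min\{k\ge 0:\|a\|_1\le\sqrt{k}\,\|a\|_2\}$ ($k$ real). For $A\in\mathbb{R}^{m\times n}$ let $\mathrm{ns}(A)$ be the maximum of $\mathrm{ns}$ over all rows and columns of $A$, $\mathrm{nnz}(A)$ the number of nonzero entries, and $\|A\|_2$ the spectral norm. An $\epsilon$-spectral-norm sparsifier of $A$ is a matrix $\tilde A\in\mathbb{R}^{m\times n}$ with $\|\tilde A-A\|_2\le\epsilon\|A\|_2$ whose entries are nonnegative multiples of the corresponding entries of $A$. A sample of a nonzero row $A_i$ is the row vector $\frac{A_{ij}}{p_{ij}}e_j^\top$ with probability $p_{ij}=|A_{ij}|/\|A_i\|_1$; a sample of a zero row is $0$. To sample a row $s$ times means to replace it by the average of $s$ independent samples of it (by $0$ if $s=0$). **Theorem.** For every $c\in\mathbb{N}$ there are constants $C,K>0$ and a randomized algorithm, all depending only on $c$, such that the following holds for all $m,n$, all $A\in\mathbb{R}^{m\times n}$ and all $\epsilon>0$. 1. Let $s$ be any integer with $s\ge C\epsilon^{-2}\,\mathrm{ns}(A)\log(m+n)$, and let $\tilde A$ be obtained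 from $A$ by sampling every row $s$ times, independently. Then almost surely every row of $\tilde A$ has at most $s$ nonzero entries, and with probability at least $1-(m+n)^{-c}$ the matrix $\tilde A$ is an $\epsilon$-spectral-norm sparsifier of $A$. 2. There is an integer $0\le s\le C\epsilon^{-2}\,\mathrm{ns}(A)\log(m+n)$ such that the algorithm, given $m$, $n$, $\epsilon$ and a list of the nonzero entries of $A$ (with their positions, row by row), always halts after at most $K(\mathrm{nnz}(A)+1)$ steps and outputs, in the same format, a random matrix $\tilde A$ with the following properties. Its distribution is that of the matrix in which every row of $A$ with more than $s$ nonzero entries is sampled $s$ times, independently, and every other row of $A$ is kept. Every row of $\tilde A$ has at most $s$ nonzero entries. With probability at least $1-(m+n)^{-c}$ the matrix $\tilde A$ is an $\epsilon$-spectral-norm sparsifier of $A$. The algorithm is a single program for a real RAM with unit-cost operations: addition, truncated subtraction and comparison of natural numbers, indexed access to arrays, conversion of natural numbers to reals, $+,-,\times,/$ and comparison of reals, and drawing a uniform real in $[0,1]$ or a uniform natural number below a given one. -/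

import Mathlib

open MeasureTheory

namespace RowSampling

/-! ## Matrices: sparsity, numerical sparsity, spectral norm -/

/-- The numerical sparsity of a vector: the least real `k ≥ 0` with `‖a‖₁ ≤ √k ‖a‖₂`. -/
noncomputable def vecNs {ι : Type} [Fintype ι] (a : ι → ℝ) : ℝ :=
  sInf {k : ℝ | 0 ≤ k ∧ ∑ i, |a i| ≤ Real.sqrt k * Real.sqrt (∑ i, a i ^ 2)}

/-- The numerical sparsity of a matrix: the maximum over all its rows and columns
(and `0` for a matrix without rows and columns). -/
noncomputable def ns {m n : ℕ} (A : Matrix (Fin m) (Fin n) ℝ) : ℝ :=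
  max (⨆ i : Fin m, vecNs (fun j => A i j)) (⨆ j : Fin n, vecNs (fun i => A i j))

open scoped Matrix.Norms.L2Operator in
/-- The spectral norm: the operator norm with respect to the Euclidean norms. -/
noncomputable def specNorm {m n : ℕ} (A : Matrix (Fin m) (Fin n) ℝ) : ℝ := ‖A‖

/-- The number of nonzero entries of a matrix. -/
noncomputable def nnz {m n : ℕ} (A : Matrix (Fin m) (Fin n) ℝ) : ℕ :=
  {p : Fin m × Fin n | A p.1 p.2 ≠ 0}.ncard

/-- The sparsity (number of nonzero entries) of the `i`-th row. -/
noncomputable def rowNnz {m n : ℕ} (A : Matrix (Fin m) (Fin n) ℝ) (i : Fin m) : ℕ :=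
  {j : Fin n | A i j ≠ 0}.ncard

/-- `B` is an `ε`-spectral-norm sparsifier of `A`: its entries are nonnegative multiples of the
corresponding entries of `A` (entries that are dropped have weight `0`), and
`‖B - A‖₂ ≤ ε ‖A‖₂`. -/
def IsSparsifier {m n : ℕ} (ε : ℝ) (A B : Matrix (Fin m) (Fin n) ℝ) : Prop :=
  (∃ w : Fin m → Fin n → ℝ, ∀ i j, 0 ≤ w i j ∧ B i j = w i j * A i j) ∧
    specNorm (B - A) ≤ ε * specNorm A

/-! ## `ℓ₁` row sampling -/

/-- The `ℓ₁` sampling probabilities `|a_j| / ‖a‖₁` of a row. -/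
noncomputable def l1Prob {n : ℕ} (a : Fin n → ℝ) (j : Fin n) : ℝ := |a j| / ∑ l, |a l|

/-- The law of one sample of the row `a`: the row vector `(a_j / p_j) e_j` with probability
`p_j = |a_j| / ‖a‖₁`; for the zero row the sample is the zero vector. -/
noncomputable def rowDraw {n : ℕ} (a : Fin n → ℝ) : Measure (Fin n → ℝ) :=
  open Classical in
  if a = 0 then Measure.dirac 0
  else ∑ j, ENNReal.ofReal (l1Prob a j) •
    Measure.dirac (Pi.single j (a j / l1Prob a j) : Fin n → ℝ)

/-- The matrix assembled from the samples `q (i, t)`, `t < s`, of all rows `i`: a row in `keep` is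
copied from `A`, any other row is the average of its `s` samples. -/
noncomputable def assemble {m n : ℕ} (A : Matrix (Fin m) (Fin n) ℝ) (s : ℕ) (keep : Set (Fin m))
    (q : Fin m × Fin s → Fin n → ℝ) : Fin m → Fin n → ℝ :=
  open Classical in
  fun i j => if i ∈ keep then A i j else (1 / (s : ℝ)) * ∑ t, q (i, t) j

/-- The law of the random matrix in which the rows in `keep` are those of `A`, and every other row
is the average of `s` samples of the corresponding row of `A`; all samples are independent. -/
noncomputable def rowSampling {m n : ℕ} (A : Matrix (Fin m) (Fin n) ℝ) (s : ℕ)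
    (keep : Set (Fin m)) : Measure (Fin m → Fin n → ℝ) :=
  (Measure.pi fun it : Fin m × Fin s => rowDraw (A it.1)).map (assemble A s keep)

/-! ## A randomized real RAM

A program works on registers and arrays that hold natural numbers, and on registers and arrays that
hold real numbers. Natural numbers can be added, subtracted (truncated at `0`) and compared, real
numbers can be added, subtracted, multiplied, divided (`x / 0` is `0`) and compared, natural numbers
can be converted to reals and index arrays. There is no rounding, root or logarithm. A program can
draw a uniform real number from `[0,1]` and a uniform natural number below a given one. -/

/-- The memory. Registers, arrays and array cells are numbered by natural numbers; a given program
refers to finitely many registers and arrays. `pos` counts the random draws made so far. -/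
structure State where
  nreg : ℕ → ℕ
  rreg : ℕ → ℝ
  narr : ℕ → ℕ → ℕ
  rarr : ℕ → ℕ → ℝ
  pos : ℕ

/-- Natural number expressions; `cell a e` is the cell of array `a` with index `e`. -/
inductive NExpr where
  | const (k : ℕ)
  | reg (r : ℕ)
  | cell (a : ℕ) (e : NExpr)
  | add (e₁ e₂ : NExpr)
  | sub (e₁ e₂ : NExpr)

/-- Real number expressions. -/
inductive RExpr where
  | ofNat (e : NExpr)
  | reg (r : ℕ)
  | cell (a : ℕ) (e : NExpr)
  | add (e₁ e₂ : RExpr)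
  | sub (e₁ e₂ : RExpr)
  | mul (e₁ e₂ : RExpr)
  | div (e₁ e₂ : RExpr)

/-- Tests. -/
inductive Test where
  | nlt (e₁ e₂ : NExpr)
  | rlt (e₁ e₂ : RExpr)
  | not (b : Test)
  | and (b₁ b₂ : Test)

/-- Programs. -/
inductive Prog where
  | skip
  | nset (r : ℕ) (e : NExpr)
  | rset (r : ℕ) (e : RExpr)
  | nstore (a : ℕ) (i e : NExpr)
  | rstore (a : ℕ) (i : NExpr) (e : RExpr)
  | drawReal (r : ℕ)
  | drawNat (r : ℕ) (e : NExpr)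
  | seq (P Q : Prog)
  | cond (b : Test) (P Q : Prog)
  | loop (b : Test) (P : Prog)

/-- The value of an expression. -/
def NExpr.eval (σ : State) : NExpr → ℕ
  | .const k => k
  | .reg r => σ.nreg r
  | .cell a e => σ.narr a (e.eval σ)
  | .add e₁ e₂ => e₁.eval σ + e₂.eval σ
  | .sub e₁ e₂ => e₁.eval σ - e₂.eval σ

/-- The number of operations in an expression; every symbol counts. -/
def NExpr.cost : NExpr → ℕ
  | .const _ => 1
  | .reg _ => 1
  | .cell _ e => e.cost + 1
  | .add e₁ e₂ => e₁.cost + e₂.cost + 1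
  | .sub e₁ e₂ => e₁.cost + e₂.cost + 1

/-- The value of an expression. -/
noncomputable def RExpr.eval (σ : State) : RExpr → ℝ
  | .ofNat e => (e.eval σ : ℝ)
  | .reg r => σ.rreg r
  | .cell a e => σ.rarr a (e.eval σ)
  | .add e₁ e₂ => e₁.eval σ + e₂.eval σ
  | .sub e₁ e₂ => e₁.eval σ - e₂.eval σ
  | .mul e₁ e₂ => e₁.eval σ * e₂.eval σ
  | .div e₁ e₂ => e₁.eval σ / e₂.eval σ

/-- The number of operations; every symbol counts. -/
def RExpr.cost : RExpr → ℕ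
  | .ofNat e => e.cost + 1
  | .reg _ => 1
  | .cell _ e => e.cost + 1
  | .add e₁ e₂ => e₁.cost + e₂.cost + 1
  | .sub e₁ e₂ => e₁.cost + e₂.cost + 1
  | .mul e₁ e₂ => e₁.cost + e₂.cost + 1
  | .div e₁ e₂ => e₁.cost + e₂.cost + 1

/-- The truth value of a test. -/
def Test.Holds (σ : State) : Test → Prop
  | .nlt e₁ e₂ => e₁.eval σ < e₂.eval σ
  | .rlt e₁ e₂ => e₁.eval σ < e₂.eval σ
  | .not b => ¬ b.Holds σ
  | .and b₁ b₂ => b₁.Holds σ ∧ b₂.Holds σ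

/-- The number of operations; every symbol counts. -/
def Test.cost : Test → ℕ
  | .nlt e₁ e₂ => e₁.cost + e₂.cost + 1
  | .rlt e₁ e₂ => e₁.cost + e₂.cost + 1
  | .not b => b.cost + 1
  | .and b₁ b₂ => b₁.cost + b₂.cost + 1

/-- The source of randomness: a sequence of reals in `[0,1]`, one for every draw. -/
abbrev Tape : Type := ℕ → unitInterval

/-- The entries of the tape are independent and uniform in `[0,1]`. -/
noncomputable def tapeMeasure : Measure Tape :=
  Measure.infinitePi fun _ : ℕ => (volume : Measure unitInterval)

/-- For `u` uniform in `[0,1]`, a uniform element of `{0, …, k - 1}` (and `0` for `k = 0`); the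
minimum concerns the null event `u = 1` only. -/
noncomputable def pickNat (u : ℝ) (k : ℕ) : ℕ := min ⌊u * k⌋₊ (k - 1)

/-- `Run ω P σ t σ'`: with the tape `ω`, the program `P` started in the state `σ` halts after
exactly `t` steps in the state `σ'`. -/
inductive Run (ω : Tape) : Prog → State → ℕ → State → Prop where
  | skip (σ : State) : Run ω .skip σ 1 σ
  | nset (σ : State) (r : ℕ) (e : NExpr) :
      Run ω (.nset r e) σ (e.cost + 1)
        { σ with nreg := Function.update σ.nreg r (e.eval σ) }
  | rset (σ : State) (r : ℕ) (e : RExpr) :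
      Run ω (.rset r e) σ (e.cost + 1)
        { σ with rreg := Function.update σ.rreg r (e.eval σ) }
  | nstore (σ : State) (a : ℕ) (i e : NExpr) :
      Run ω (.nstore a i e) σ (i.cost + e.cost + 1)
        { σ with narr := Function.update σ.narr a
                  (Function.update (σ.narr a) (i.eval σ) (e.eval σ)) }
  | rstore (σ : State) (a : ℕ) (i : NExpr) (e : RExpr) :
      Run ω (.rstore a i e) σ (i.cost + e.cost + 1)
        { σ with rarr := Function.update σ.rarr a
                  (Function.update (σ.rarr a) (i.eval σ) (e.eval σ)) }
  | drawReal (σ : State) (r : ℕ) :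
      Run ω (.drawReal r) σ 1
        { σ with rreg := Function.update σ.rreg r (ω σ.pos : ℝ), pos := σ.pos + 1 }
  | drawNat (σ : State) (r : ℕ) (e : NExpr) :
      Run ω (.drawNat r e) σ (e.cost + 1)
        { σ with nreg := Function.update σ.nreg r (pickNat (ω σ.pos) (e.eval σ)),
                 pos := σ.pos + 1 }
  | seq {P Q : Prog} {σ σ₁ σ₂ : State} {t₁ t₂ : ℕ} :
      Run ω P σ t₁ σ₁ → Run ω Q σ₁ t₂ σ₂ → Run ω (.seq P Q) σ (t₁ + t₂) σ₂
  | condTrue {b : Test} {P Q : Prog} {σ σ₁ : State} {t : ℕ} :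
      b.Holds σ → Run ω P σ t σ₁ → Run ω (.cond b P Q) σ (b.cost + 1 + t) σ₁
  | condFalse {b : Test} {P Q : Prog} {σ σ₁ : State} {t : ℕ} :
      ¬ b.Holds σ → Run ω Q σ t σ₁ → Run ω (.cond b P Q) σ (b.cost + 1 + t) σ₁
  | loopStop {b : Test} {P : Prog} {σ : State} :
      ¬ b.Holds σ → Run ω (.loop b P) σ (b.cost + 1) σ
  | loopStep {b : Test} {P : Prog} {σ σ₁ σ₂ : State} {t₁ t₂ : ℕ} :
      b.Holds σ → Run ω P σ t₁ σ₁ → Run ω (.loop b P) σ₁ t₂ σ₂ →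
        Run ω (.loop b P) σ (b.cost + 1 + t₁ + t₂) σ₂

/-! ## Sparse matrices in memory -/

/-- `l` lists the positions of the nonzero entries of `A`, each once, row after row (in any order
within a row). -/
def IsListing {m n : ℕ} (A : Matrix (Fin m) (Fin n) ℝ) (l : List (Fin m × Fin n)) : Prop :=
  l.Nodup ∧ (∀ p, p ∈ l ↔ A p.1 p.2 ≠ 0) ∧ l.Pairwise fun p q => p.1 ≤ q.1

/-- The initial memory for the input `A`, `ε`. The numbers `m`, `n` and the length of the list are in
the registers `0`, `1`, `2`; the rows, the columns and the values of the listed entries are in the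
arrays `0` and `1` for natural numbers and in the array `0` for reals; `ε` is in the real register
`0`. Everything else is `0`. -/
def inputState {m n : ℕ} (A : Matrix (Fin m) (Fin n) ℝ) (l : List (Fin m × Fin n)) (ε : ℝ) :
    State where
  nreg r := if r = 0 then m else if r = 1 then n else if r = 2 then l.length else 0
  rreg r := if r = 0 then ε else 0
  narr a k :=
    if h : k < l.length then
      if a = 0 then (l[k].1 : ℕ) else if a = 1 then (l[k].2 : ℕ) else 0
    else 0
  rarr a k :=
    if h : k < l.length then
      if a = 0 then A l[k].1 l[k].2 else 0
    else 0
  pos := 0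

/-- The state `σ` holds the matrix `B` as output, in the format of the input: the number of nonzero
entries is in the register `3`, and their rows, columns and values are in the arrays `2` and `3` for
natural numbers and in the array `1` for reals. -/
def IsOutput {m n : ℕ} (σ : State) (B : Matrix (Fin m) (Fin n) ℝ) : Prop :=
  ∃ l : List (Fin m × Fin n), IsListing B l ∧ σ.nreg 3 = l.length ∧
    ∀ (k : ℕ) (h : k < l.length),
      σ.narr 2 k = l[k].1 ∧ σ.narr 3 k = l[k].2 ∧ σ.rarr 1 k = B l[k].1 l[k].2

end RowSampling

open RowSampling

/-!
The error `Ã - A` of row sampling is a sum of independent matrices, one for each sample, and the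
matrix Laplace transform method bounds its spectral norm. The symmetric dilation of the error has an
eigenvalue above `t` only if `tr exp (θ • dilation)` is large, and the Golden–Thompson inequality
(`trace_exp_add_le`) removes the samples from the exponent one at a time. For the variance it
matters that `A` is numerically sparse in both directions: the `ℓ₁` norms of the rows and of the
columns are at most `√(ns A) ‖A‖`, so that `∑ i, ‖A_i‖₁ |A_ij| ≤ ns A ‖A‖²` for every column `j`
(`sum_l1_mul_abs_le`). To avoid matrix variances in the exponent, the increment of a sample contains
a diagonal matrix that compensates its second moment (`increment_moment_le`), and the total
compensation is small by the bounds for the rows and columns. The result, `measure_lt_specNorm_le`,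
requires `s ≥ 64 log (m + n)` samples. With fewer samples the hypothesis on `s` forces `ε` to be of
order at least `√(ns A)`; it then suffices to bound `‖Ã‖` itself, by the Schur test and a scalar
Chernoff bound for every column (`specNorm_assembleIndex_le`, `measure_column_load_le`).

The algorithm has to sample rows in constant time per sample without logarithmic factors, so it
uses the alias method. For a row with `d` entries of average absolute value `μ`, the weights are cut
and distributed over `d` cells of capacity `μ`, each of which holds parts of at most two entries; a
uniform cell and a uniform real then pick an entry with probability proportional to its absolute
value (`Prepared.volume_pickEntry`). The cells are filled in a single pass over the listed entries:
the entries of every row are first partitioned into those below and those above the average, and a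
cell that starts with a small entry is filled up by the first remaining large entry, which may
thereby become small and join the end of the small ones (`AliasInv.step_small`).

All loops of the program run over the listed entries, and have loop-free bodies; this gives the
linear running time (`run_forLoop`). In particular the number of samples `s` and the logarithm
`⌈log₂ (m + n)⌉` are computed by counting up to at most `nnz A`. This cut-off is harmless: if it
takes effect then `s = nnz A`, and every row is kept. A row is sampled only if it has more than `s`
entries, so its samples can be assigned to its first `s` listed entries, and the sampling loop is
linear as well. It uses two entries of the tape for every listed entry, whether or not a sample is
needed, so that the samples of the rows are functions of disjoint blocks of the tape
(`map_tapeMeasure`, `map_outMatrix`). For `ε ≥ 1` the algorithm uses `s = 0`, since the zero matrix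
is a sparsifier.
-/

/-! ### The Golden–Thompson inequality -/

namespace RowSampling
open Matrix

section TraceInequalities
variable {ι : Type*} [Fintype ι] [DecidableEq ι]

omit [DecidableEq ι] in
lemma trace_transpose_mul_self_nonneg (X : Matrix ι ι ℝ) : 0 ≤ (Xᵀ * X).trace := by
  simp only [trace, diag_apply, mul_apply, transpose_apply]
  exact Finset.sum_nonneg fun i _ => Finset.sum_nonneg fun j _ => mul_self_nonneg _

omit [DecidableEq ι] in
lemma trace_mul_self_le (X : Matrix ι ι ℝ) : (X * X).trace ≤ (Xᵀ * X).trace := by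
  have h := trace_transpose_mul_self_nonneg (X - Xᵀ)
  have e : (X - Xᵀ)ᵀ * (X - Xᵀ) = Xᵀ * X - (X * X)ᵀ - X * X + X * Xᵀ := by
    simp [sub_mul, mul_sub, transpose_mul]; abel
  rw [e, trace_add, trace_sub, trace_sub, trace_transpose, trace_mul_comm X Xᵀ] at h
  linarith

lemma trace_mul_pow_comm (A B : Matrix ι ι ℝ) (n : ℕ) :
    ((A * B) ^ n).trace = ((B * A) ^ n).trace := by
  cases n with
  | zero => simp
  | succ n =>
    have h : (A * B) ^ n * A = A * (B * A) ^ n := by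
      induction n with
      | zero => simp
      | succ n ih => rw [pow_succ', mul_assoc, ih, pow_succ' (B * A)]; simp only [mul_assoc]
    rw [pow_succ, ← mul_assoc, h, mul_assoc, trace_mul_comm, mul_assoc, ← pow_succ]

/-- Lieb–Thirring type inequalities at powers of two. The two families are proved by a joint
induction, each being used in the other's step. -/
theorem trace_pow_two_pow_aux (k : ℕ) :
    (∀ X : Matrix ι ι ℝ, (X ^ 2 ^ (k + 1)).trace ≤ ((Xᵀ * X) ^ 2 ^ k).trace) ∧
    (∀ P Q : Matrix ι ι ℝ, Pᵀ = P → Qᵀ = Q →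
      ((P * Q) ^ 2 ^ k).trace ≤ (P ^ 2 ^ k * Q ^ 2 ^ k).trace) := by
  induction k with
  | zero =>
    refine ⟨fun X => ?_, fun P Q _ _ => by simp⟩
    simpa [pow_two] using trace_mul_self_le X
  | succ k ih =>
    obtain ⟨hL, hC⟩ := ih
    constructor
    · intro X
      have h1 : (X ^ 2 ^ (k + 1 + 1)).trace = ((X * X) ^ 2 ^ (k + 1)).trace := by
        rw [← pow_two, ← pow_mul, ← pow_succ']
      have h2 : (((X * X)ᵀ * (X * X)) ^ 2 ^ k).trace
          = (((Xᵀ * X) * (X * Xᵀ)) ^ 2 ^ k).trace := by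
        rw [transpose_mul, mul_assoc, trace_mul_pow_comm]; simp only [mul_assoc]
      have h3 := hC (Xᵀ * X) (X * Xᵀ) (by simp) (by simp)
      set G := (Xᵀ * X) ^ 2 ^ k with hG
      set H := (X * Xᵀ) ^ 2 ^ k with hH
      have hGt : Gᵀ = G := by simp [hG, transpose_pow]
      have hHt : Hᵀ = H := by simp [hH, transpose_pow]
      have h4 := trace_transpose_mul_self_nonneg (G - H)
      rw [transpose_sub, hGt, hHt, sub_mul, mul_sub, mul_sub, trace_sub, trace_sub, trace_sub,
        trace_mul_comm H G] at h4
      have h5 : (G * G).trace = ((Xᵀ * X) ^ 2 ^ (k + 1)).trace := by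
        rw [hG, ← pow_two, ← pow_mul, ← pow_succ]
      have h6 : (H * H).trace = ((Xᵀ * X) ^ 2 ^ (k + 1)).trace := by
        rw [hH, ← pow_two, ← pow_mul, ← pow_succ, trace_mul_pow_comm]
      have h7 := hL (X * X)
      linarith
    · intro P Q hP hQ
      have h1 := hL (P * Q)
      have h2 : (((P * Q)ᵀ * (P * Q)) ^ 2 ^ k).trace = (((P * P) * (Q * Q)) ^ 2 ^ k).trace := by
        rw [transpose_mul, hP, hQ, mul_assoc, trace_mul_pow_comm]; simp only [mul_assoc]
      have h3 := hC (P * P) (Q * Q) (by simp [hP]) (by simp [hQ])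
      rw [← pow_two P, ← pow_two Q, ← pow_mul, ← pow_mul, ← pow_succ'] at h3
      rw [← pow_two P, ← pow_two Q] at h2
      linarith

end TraceInequalities

section LieProduct
open Filter Topology Asymptotics
variable {𝔸 : Type*} [NormedRing 𝔸] [NormedAlgebra ℝ 𝔸] [CompleteSpace 𝔸] [NormOneClass 𝔸]

lemma norm_exp_le_exp_norm (x : 𝔸) : ‖NormedSpace.exp x‖ ≤ Real.exp ‖x‖ := by
  have h := NormedSpace.exp_series_hasSum_exp' (𝕂 := ℝ) x
  have h2 := NormedSpace.exp_series_hasSum_exp' (𝕂 := ℝ) ‖x‖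
  rw [← Real.exp_eq_exp_ℝ] at h2
  rw [← h.tsum_eq]
  refine tsum_of_norm_bounded h2 fun n => ?_
  rw [norm_smul, smul_eq_mul, Real.norm_of_nonneg (by positivity)]
  gcongr
  exact norm_pow_le x n

omit [NormedAlgebra ℝ 𝔸] [CompleteSpace 𝔸] in
lemma norm_pow_sub_pow_le {X Y : 𝔸} {M : ℝ} (hX : ‖X‖ ≤ M) (hY : ‖Y‖ ≤ M) (n : ℕ) :
    ‖X ^ (n + 1) - Y ^ (n + 1)‖ ≤ (n + 1) * M ^ n * ‖X - Y‖ := by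
  have hM : 0 ≤ M := (norm_nonneg X).trans hX
  induction n with
  | zero => simp
  | succ n ih =>
    have e : X ^ (n + 1 + 1) - Y ^ (n + 1 + 1)
        = X * (X ^ (n + 1) - Y ^ (n + 1)) + (X - Y) * Y ^ (n + 1) := by
      rw [pow_succ' X (n + 1), pow_succ' Y (n + 1)]; noncomm_ring
    rw [e]
    have hYn : ‖Y ^ (n + 1)‖ ≤ M ^ (n + 1) :=
      (norm_pow_le _ _).trans (pow_le_pow_left₀ (norm_nonneg _) hY _)
    calc _ ≤ ‖X‖ * ‖X ^ (n + 1) - Y ^ (n + 1)‖ + ‖X - Y‖ * ‖Y ^ (n + 1)‖ :=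
          (norm_add_le _ _).trans (add_le_add (norm_mul_le _ _) (norm_mul_le _ _))
      _ ≤ M * ((n + 1) * M ^ n * ‖X - Y‖) + ‖X - Y‖ * M ^ (n + 1) := by gcongr
      _ = _ := by push_cast; ring

/-- The Lie product formula. -/
theorem tendsto_exp_mul_exp_pow (A B : 𝔸) :
    Tendsto (fun n : ℕ => (NormedSpace.exp ((1 / ((n : ℝ) + 1)) • A) *
      NormedSpace.exp ((1 / ((n : ℝ) + 1)) • B)) ^ (n + 1)) atTop
      (𝓝 (NormedSpace.exp (A + B))) := by
  set f : ℝ → 𝔸 := fun t => NormedSpace.exp (t • A) * NormedSpace.exp (t • B) with hf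
  set g : ℝ → 𝔸 := fun t => NormedSpace.exp (t • (A + B)) with hg
  -- `f` and `g` agree to first order at `0`, and `exp (A + B)` is the power of `g (1 / (n + 1))`
  have hd : HasDerivAt (fun t => f t - g t) 0 0 := by
    have h1 := hasDerivAt_exp_smul_const (𝕂 := ℝ) A (0 : ℝ)
    have h2 := hasDerivAt_exp_smul_const (𝕂 := ℝ) B (0 : ℝ)
    have h3 := hasDerivAt_exp_smul_const (𝕂 := ℝ) (A + B) (0 : ℝ)
    have := (h1.mul h2).sub h3
    simp only [zero_smul, NormedSpace.exp_zero, one_mul, mul_one] at this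
    rw [sub_self] at this
    exact this
  have ho : (fun t : ℝ => f t - g t) =o[𝓝 0] fun t => t := by
    have := hd.isLittleO
    simpa [hf, hg] using this
  have hseq : Tendsto (fun n : ℕ => 1 / ((n : ℝ) + 1)) atTop (𝓝 0) :=
    tendsto_one_div_add_atTop_nhds_zero_nat
  have ho2 := ho.comp_tendsto hseq
  set c := ‖A‖ + ‖B‖ with hc
  have hc0 : 0 ≤ c := by positivity
  rw [tendsto_iff_norm_sub_tendsto_zero, Metric.tendsto_atTop]
  intro ε hε
  have hev := ho2.def (show 0 < ε / (2 * Real.exp c) by positivity)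
  obtain ⟨N, hN⟩ := eventually_atTop.1 hev
  refine ⟨N, fun n hn => ?_⟩
  have hb := hN n hn
  simp only [Function.comp] at hb
  set t : ℝ := 1 / ((n : ℝ) + 1) with ht
  have ht0 : 0 < t := by positivity
  have hnt : ((n : ℝ) + 1) * t = 1 := by rw [ht]; field_simp
  have hfn : ‖f t‖ ≤ Real.exp (t * c) := by
    calc ‖f t‖ ≤ ‖NormedSpace.exp (t • A)‖ * ‖NormedSpace.exp (t • B)‖ := norm_mul_le _ _
      _ ≤ Real.exp ‖t • A‖ * Real.exp ‖t • B‖ := by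
          gcongr <;> exact norm_exp_le_exp_norm _
      _ = Real.exp (t * c) := by
          rw [← Real.exp_add, norm_smul, norm_smul, Real.norm_of_nonneg ht0.le, hc, mul_add]
  have hgn : ‖g t‖ ≤ Real.exp (t * c) := by
    refine (norm_exp_le_exp_norm _).trans (Real.exp_le_exp.2 ?_)
    rw [norm_smul, Real.norm_of_nonneg ht0.le]
    exact mul_le_mul_of_nonneg_left (norm_add_le _ _) ht0.le
  have hgpow : NormedSpace.exp (A + B) = g t ^ (n + 1) := by
    let : NormedAlgebra ℚ 𝔸 := NormedAlgebra.restrictScalars ℚ ℝ 𝔸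
    rw [hg]
    simp only
    rw [← NormedSpace.exp_nsmul, ← Nat.cast_smul_eq_nsmul ℝ, smul_smul]
    push_cast
    rw [hnt, one_smul]
  have hfin := norm_pow_sub_pow_le hfn hgn n
  rw [Real.norm_of_nonneg ht0.le] at hb
  have hexp : Real.exp (t * c) ^ n ≤ Real.exp c := by
    rw [← Real.exp_nat_mul]
    apply Real.exp_le_exp.2
    have : (n : ℝ) * t ≤ 1 := by nlinarith
    nlinarith
  have : ‖f t ^ (n + 1) - NormedSpace.exp (A + B)‖ < ε := by
    rw [hgpow]
    calc _ ≤ _ := hfin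
      _ ≤ (n + 1) * Real.exp c * (ε / (2 * Real.exp c) * t) := by gcongr
      _ = ε / 2 * (((n : ℝ) + 1) * t) := by field_simp
      _ < ε := by rw [hnt]; linarith
  rw [Real.dist_eq, sub_zero, abs_of_nonneg (norm_nonneg _)]
  exact this

end LieProduct

section GoldenThompson
open Filter Topology
open scoped Matrix.Norms.Operator
variable {ι : Type*} [Fintype ι] [DecidableEq ι]

/-- The Golden–Thompson inequality for real symmetric matrices. -/
theorem trace_exp_add_le [Nonempty ι] {A B : Matrix ι ι ℝ} (hA : Aᵀ = A) (hB : Bᵀ = B) :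
    (NormedSpace.exp (A + B)).trace ≤ (NormedSpace.exp A * NormedSpace.exp B).trace := by
  have h := (tendsto_exp_mul_exp_pow A B)
  have hsub : Tendsto (fun k : ℕ => 2 ^ k - 1) atTop atTop := by
    refine tendsto_atTop_mono (fun k => ?_) tendsto_id
    have := Nat.lt_two_pow_self (n := k)
    simp only [id]; omega
  have h2 := ((Continuous.matrix_trace continuous_id).tendsto _).comp (h.comp hsub)
  -- the inequality holds along the exponents `2 ^ k` of the Lie product formula
  refine le_of_tendsto h2 (Eventually.of_forall fun k => ?_)
  simp only [Function.comp, id]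
  have hk : 2 ^ k - 1 + 1 = 2 ^ k := Nat.sub_add_cancel Nat.one_le_two_pow
  have hk' : ((2 ^ k - 1 : ℕ) : ℝ) + 1 = 2 ^ k := by exact_mod_cast hk
  rw [hk, hk']
  have hs : ∀ X : Matrix ι ι ℝ,
      NormedSpace.exp ((1 / (2 : ℝ) ^ k) • X) ^ 2 ^ k = NormedSpace.exp X := by
    intro X
    rw [← Matrix.exp_nsmul, ← Nat.cast_smul_eq_nsmul ℝ, smul_smul]
    have : ((2 ^ k : ℕ) : ℝ) * (1 / 2 ^ k) = 1 := by push_cast; field_simp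
    rw [this, one_smul]
  have := (trace_pow_two_pow_aux k).2 (NormedSpace.exp ((1 / (2 : ℝ) ^ k) • A))
    (NormedSpace.exp ((1 / (2 : ℝ) ^ k) • B))
    (by rw [← Matrix.exp_transpose, transpose_smul, hA])
    (by rw [← Matrix.exp_transpose, transpose_smul, hB])
  rwa [hs, hs] at this

end GoldenThompson

section Spectral
variable {ι : Type*} [Fintype ι] [DecidableEq ι]

/-- A real symmetric matrix is orthogonally diagonalizable. -/
lemma exists_orthogonal_diagonal {Y : Matrix ι ι ℝ} (hY : Yᵀ = Y) :
    ∃ (U : Matrix ι ι ℝ) (e : ι → ℝ), U * Uᵀ = 1 ∧ Uᵀ * U = 1 ∧ Y = U * diagonal e * Uᵀ := by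
  have hH : Y.IsHermitian := by rw [IsHermitian, conjTranspose_eq_transpose_of_trivial, hY]
  refine ⟨hH.eigenvectorUnitary, hH.eigenvalues, ?_, ?_, ?_⟩
  · have := Unitary.coe_mul_star_self hH.eigenvectorUnitary
    rwa [Unitary.coe_star, star_eq_conjTranspose,
      conjTranspose_eq_transpose_of_trivial] at this
  · have := Unitary.coe_star_mul_self hH.eigenvectorUnitary
    rwa [star_eq_conjTranspose,
      conjTranspose_eq_transpose_of_trivial] at this
  · have := hH.spectral_theorem
    rw [Unitary.conjStarAlgAut_apply, star_eq_conjTranspose,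
      conjTranspose_eq_transpose_of_trivial] at this
    simpa using this

lemma exp_orthogonal_diagonal {U : Matrix ι ι ℝ} {e : ι → ℝ} (h1 : U * Uᵀ = 1)
    (h2 : Uᵀ * U = 1) :
    NormedSpace.exp (U * diagonal e * Uᵀ) = U * diagonal (fun i => Real.exp (e i)) * Uᵀ := by
  have hinv : U⁻¹ = Uᵀ := inv_eq_right_inv h1
  have hu : IsUnit U := ⟨⟨U, Uᵀ, h1, h2⟩, rfl⟩
  rw [← hinv, Matrix.exp_conj _ _ hu, Matrix.exp_diagonal]
  congr 3
  funext i
  rw [Pi.coe_exp, Real.exp_eq_exp_ℝ]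

/-- If the eigenvalues of `Y` are at most `1`, then `exp Y ≤ 1 + Y + Y²`. -/
lemma posSemidef_exp_bound {Y : Matrix ι ι ℝ} (hY : Yᵀ = Y)
    (h : ∀ z : ι → ℝ, z ⬝ᵥ Y *ᵥ z ≤ z ⬝ᵥ z) :
    (1 + Y + Y * Y - NormedSpace.exp Y).PosSemidef := by
  obtain ⟨U, e, h1, h2, rfl⟩ := exists_orthogonal_diagonal hY
  have he : ∀ i, e i ≤ 1 := by
    intro i
    have := h (U *ᵥ Pi.single i 1)
    have e1 : (U *ᵥ Pi.single i 1) ⬝ᵥ (U * diagonal e * Uᵀ) *ᵥ (U *ᵥ Pi.single i 1) = e i := by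
      rw [mulVec_mulVec, mul_assoc, h2, mul_one, ← mulVec_mulVec, dotProduct_mulVec,
        vecMul_mulVec, h2]
      simp
    have e2 : (U *ᵥ Pi.single i (1 : ℝ)) ⬝ᵥ (U *ᵥ Pi.single i 1) = 1 := by
      rw [dotProduct_mulVec, vecMul_mulVec, h2]
      simp
    rwa [e1, e2] at this
  rw [exp_orthogonal_diagonal h1 h2]
  have hd : ∀ x : ℝ, x ≤ 1 → Real.exp x ≤ 1 + x + x * x := by
    intro x hx
    rcases le_or_gt (-1) x with hx1 | hx1
    · have := Real.abs_exp_sub_one_sub_id_le (abs_le.2 ⟨hx1, hx⟩)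
      have := (abs_le.1 this).2
      nlinarith
    · have : Real.exp x ≤ 1 := Real.exp_le_one_iff.2 (by linarith)
      nlinarith
  have key : 1 + U * diagonal e * Uᵀ + U * diagonal e * Uᵀ * (U * diagonal e * Uᵀ)
      - U * diagonal (fun i => Real.exp (e i)) * Uᵀ
      = U * diagonal (fun i => 1 + e i + e i * e i - Real.exp (e i)) * Uᵀ := by
    have a1 : U * diagonal e * Uᵀ * (U * diagonal e * Uᵀ)
        = U * diagonal (fun i => e i * e i) * Uᵀ := by
      calc _ = U * diagonal e * (Uᵀ * U) * diagonal e * Uᵀ := by simp only [mul_assoc]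
        _ = _ := by rw [h2, mul_one, mul_assoc U, diagonal_mul_diagonal]
    have a2 : (1 : Matrix ι ι ℝ) = U * diagonal (fun _ => (1 : ℝ)) * Uᵀ := by
      rw [diagonal_one, mul_one, h1]
    rw [a1]
    nth_rw 1 [a2]
    rw [← add_mul, ← mul_add, diagonal_add, ← add_mul, ← mul_add, diagonal_add, ← sub_mul,
      ← mul_sub, diagonal_sub]
  rw [key]
  have := (PosSemidef.diagonal (R := ℝ) (d := fun i => 1 + e i + e i * e i - Real.exp (e i))
    (fun i => sub_nonneg.2 (hd _ (he i)))).mul_mul_conjTranspose_same U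
  rwa [conjTranspose_eq_transpose_of_trivial] at this

/-- A Rayleigh quotient bounds the largest eigenvalue, hence the trace of the exponential. -/
lemma exp_le_trace_exp {Y : Matrix ι ι ℝ} (hY : Yᵀ = Y) {c : ℝ} {z : ι → ℝ}
    (h : c * (z ⬝ᵥ z) < z ⬝ᵥ Y *ᵥ z) : Real.exp c ≤ (NormedSpace.exp Y).trace := by
  obtain ⟨U, e, h1, h2, rfl⟩ := exists_orthogonal_diagonal hY
  have : ∃ i, c ≤ e i := by
    by_contra! hc
    set w := Uᵀ *ᵥ z with hw
    have e1 : z ⬝ᵥ (U * diagonal e * Uᵀ) *ᵥ z = ∑ i, e i * (w i * w i) := by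
      rw [← mulVec_mulVec, ← mulVec_mulVec, dotProduct_mulVec, ← mulVec_transpose, ← hw]
      simp only [dotProduct, mulVec_diagonal]
      exact Finset.sum_congr rfl fun i _ => by ring
    have e2 : z ⬝ᵥ z = ∑ i, w i * w i := by
      change _ = w ⬝ᵥ w
      rw [hw, dotProduct_mulVec, ← mulVec_transpose, transpose_transpose, mulVec_mulVec, h1,
        one_mulVec]
    rw [e1, e2, Finset.mul_sum] at h
    refine absurd h (not_lt.2 (Finset.sum_le_sum fun i _ => ?_))
    exact mul_le_mul_of_nonneg_right (hc i).le (mul_self_nonneg _)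
  obtain ⟨i, hi⟩ := this
  rw [exp_orthogonal_diagonal h1 h2, trace_mul_comm, ← mul_assoc, h2, one_mul, trace_diagonal]
  exact (Real.exp_le_exp.2 hi).trans
    (Finset.single_le_sum (f := fun i => Real.exp (e i)) (fun i _ => (Real.exp_pos _).le)
      (Finset.mem_univ i))

/-- The trace is monotone in the second factor: write `exp D` as the square of `exp (D / 2)`. -/
lemma trace_exp_mul_nonneg {D Q : Matrix ι ι ℝ} (hD : Dᵀ = D) (hQ : Q.PosSemidef) :
    0 ≤ (NormedSpace.exp D * Q).trace := by
  set E := NormedSpace.exp ((1 / 2 : ℝ) • D) with hE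
  have hEt : Eᵀ = E := by rw [hE, ← Matrix.exp_transpose, transpose_smul, hD]
  have hDE : NormedSpace.exp D = E * E := by
    rw [hE, ← pow_two, ← Matrix.exp_nsmul, ← Nat.cast_smul_eq_nsmul ℝ, smul_smul]
    norm_num
  rw [hDE, mul_assoc, trace_mul_comm]
  have := (hQ.mul_mul_conjTranspose_same E).trace_nonneg
  rwa [conjTranspose_eq_transpose_of_trivial, hEt] at this

end Spectral
end RowSampling

/-! ### Numerical sparsity and the spectral norm -/

namespace RowSampling
open Matrix

section NumericalSparsity

/-- The infimum is attained at `‖a‖₁² / ‖a‖₂²`; for the zero vector this quotient is `0 / 0 = 0`,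
which is the right value. -/
lemma vecNs_eq {ι : Type} [Fintype ι] (a : ι → ℝ) :
    vecNs a = (∑ i, |a i|) ^ 2 / ∑ i, a i ^ 2 := by
  have hS : 0 ≤ ∑ i, |a i| := Finset.sum_nonneg fun i _ => abs_nonneg _
  have hQ : 0 ≤ ∑ i, a i ^ 2 := Finset.sum_nonneg fun i _ => sq_nonneg _
  have hset : {k : ℝ | 0 ≤ k ∧ ∑ i, |a i| ≤ Real.sqrt k * Real.sqrt (∑ i, a i ^ 2)}
      = Set.Ici ((∑ i, |a i|) ^ 2 / ∑ i, a i ^ 2) := by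
    ext k
    simp only [Set.mem_ofPred_eq, Set.mem_Ici]
    rcases hQ.eq_or_lt with h0 | hpos
    · have hz : ∀ i, a i = 0 := fun i => by
        have := (Finset.sum_eq_zero_iff_of_nonneg (fun i _ => sq_nonneg (a i))).1 h0.symm i
          (Finset.mem_univ i)
        simpa using this
      simp [hz]
    · rw [div_le_iff₀ hpos]
      constructor
      · rintro ⟨hk, h⟩
        rw [← Real.sqrt_mul hk] at h
        exact (Real.le_sqrt' (by
          by_contra hn
          have : ∑ i, |a i| = 0 := le_antisymm (not_lt.1 hn) hS
          have hz := (Finset.sum_eq_zero_iff_of_nonneg (fun i _ => abs_nonneg (a i))).1 this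
          simp only [Finset.mem_univ, abs_eq_zero, true_imp_iff] at hz
          simp [hz] at hpos)).1 h
      · intro h
        have hk : 0 ≤ k := by
          by_contra hn
          nlinarith [sq_nonneg (∑ i, |a i|)]
        refine ⟨hk, ?_⟩
        rw [← Real.sqrt_mul hk]
        exact Real.le_sqrt_of_sq_le h
  rw [vecNs, hset, csInf_Ici]

lemma vecNs_nonneg {ι : Type} [Fintype ι] (a : ι → ℝ) : 0 ≤ vecNs a :=
  Real.sInf_nonneg fun _ h => h.1

variable {m n : ℕ} (A : Matrix (Fin m) (Fin n) ℝ)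

lemma vecNs_row_le (i : Fin m) : vecNs (fun j => A i j) ≤ ns A :=
  (le_ciSup (Set.finite_range fun i : Fin m => vecNs fun j => A i j).bddAbove i).trans
    (le_max_left _ _)

lemma vecNs_col_le (j : Fin n) : vecNs (fun i => A i j) ≤ ns A :=
  (le_ciSup (Set.finite_range fun j : Fin n => vecNs fun i => A i j).bddAbove j).trans
    (le_max_right _ _)

lemma ns_nonneg : 0 ≤ ns A :=
  le_max_of_le_left (Real.iSup_nonneg fun _ => vecNs_nonneg _)

lemma ns_le {M : ℝ} (hM : 0 ≤ M) (hr : ∀ i, vecNs (fun j => A i j) ≤ M)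
    (hc : ∀ j, vecNs (fun i => A i j) ≤ M) : ns A ≤ M :=
  max_le (Real.iSup_le hr hM) (Real.iSup_le hc hM)

lemma sum_abs_sq_le {ι : Type} [Fintype ι] {a : ι → ℝ} {k : ℝ} (h : vecNs a ≤ k) :
    (∑ i, |a i|) ^ 2 ≤ k * ∑ i, a i ^ 2 := by
  rcases (Finset.sum_nonneg fun i _ => sq_nonneg (a i) : 0 ≤ ∑ i, a i ^ 2).eq_or_lt with h0 | hpos
  · have hz := (Finset.sum_eq_zero_iff_of_nonneg (fun i _ => sq_nonneg (a i))).1 h0.symm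
    simp only [Finset.mem_univ, true_imp_iff, pow_eq_zero_iff, ne_eq, OfNat.ofNat_ne_zero,
      not_false_eq_true] at hz
    simp [hz]
  · rw [vecNs_eq, div_le_iff₀ hpos] at h
    exact h

lemma sum_sq_le_sum_abs_sq {ι : Type} [Fintype ι] (a : ι → ℝ) :
    ∑ i, a i ^ 2 ≤ (∑ i, |a i|) ^ 2 := by
  simp_rw [← sq_abs (a _)]
  exact Finset.sum_sq_le_sq_sum_of_nonneg fun i _ => abs_nonneg _

/-- A nonzero row has numerical sparsity at least `1`. -/
lemma one_le_ns {A : Matrix (Fin m) (Fin n) ℝ} (hA : A ≠ 0) : 1 ≤ ns A := by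
  obtain ⟨i, j, hij⟩ : ∃ i j, A i j ≠ 0 := by
    by_contra! h
    exact hA (Matrix.ext h)
  refine le_trans ?_ (vecNs_row_le A i)
  rw [vecNs_eq, one_le_div]
  · exact sum_sq_le_sum_abs_sq _
  · exact Finset.sum_pos' (fun j _ => sq_nonneg _) ⟨j, Finset.mem_univ j, by positivity⟩

end NumericalSparsity

section SpectralNorm
variable {m n : ℕ}

lemma specNorm_nonneg (M : Matrix (Fin m) (Fin n) ℝ) : 0 ≤ specNorm M := by
  open scoped Matrix.Norms.L2Operator in exact norm_nonneg M

lemma specNorm_sub_le (M N : Matrix (Fin m) (Fin n) ℝ) :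
    specNorm (M - N) ≤ specNorm M + specNorm N := by
  open scoped Matrix.Norms.L2Operator in exact norm_sub_le M N

lemma specNorm_zero : specNorm (0 : Matrix (Fin m) (Fin n) ℝ) = 0 := by
  open scoped Matrix.Norms.L2Operator in exact norm_zero

lemma specNorm_neg (M : Matrix (Fin m) (Fin n) ℝ) : specNorm (-M) = specNorm M := by
  open scoped Matrix.Norms.L2Operator in exact norm_neg M

lemma specNorm_transpose (M : Matrix (Fin m) (Fin n) ℝ) : specNorm Mᵀ = specNorm M := by
  have := Matrix.l2_opNorm_conjTranspose M
  rwa [conjTranspose_eq_transpose_of_trivial] at this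

lemma sum_sq_mulVec_le (M : Matrix (Fin m) (Fin n) ℝ) (v : Fin n → ℝ) :
    ∑ i, (M *ᵥ v) i ^ 2 ≤ specNorm M ^ 2 * ∑ j, v j ^ 2 := by
  have h := Matrix.l2_opNorm_mulVec M (WithLp.toLp 2 v)
  have h2 := pow_le_pow_left₀ (norm_nonneg _) h 2
  rw [mul_pow, EuclideanSpace.real_norm_sq_eq, EuclideanSpace.real_norm_sq_eq] at h2
  exact h2

/-- The spectral norm is at most `t` if the quadratic form of the symmetric dilation is. -/
lemma specNorm_le_of_forall {M : Matrix (Fin m) (Fin n) ℝ} {t : ℝ} (ht : 0 ≤ t)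
    (h : ∀ u v, 2 * (u ⬝ᵥ M *ᵥ v) ≤ t * (u ⬝ᵥ u + v ⬝ᵥ v)) : specNorm M ≤ t := by
  have hd : ∀ {k : ℕ} (w : Fin k → ℝ), w ⬝ᵥ w = ‖WithLp.toLp 2 w‖ ^ 2 := fun w => by
    rw [EuclideanSpace.real_norm_sq_eq]; simp [dotProduct, pow_two]
  rw [specNorm, Matrix.l2_opNorm_def]
  refine ContinuousLinearMap.opNorm_le_bound _ ht fun x => ?_
  obtain ⟨v, rfl⟩ : ∃ v, x = WithLp.toLp 2 v := ⟨x.ofLp, rfl⟩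
  change ‖WithLp.toLp 2 (M *ᵥ v)‖ ≤ t * ‖WithLp.toLp 2 v‖
  set a := ‖WithLp.toLp 2 (M *ᵥ v)‖ with ha
  set b := ‖WithLp.toLp 2 v‖ with hb
  have ha0 : 0 ≤ a := norm_nonneg _
  have hb0 : 0 ≤ b := norm_nonneg _
  have key := fun c : ℝ => h (c • (M *ᵥ v)) v
  simp only [smul_dotProduct, dotProduct_smul, smul_eq_mul] at key
  simp only [hd, ← ha, ← hb] at key
  rcases ha0.eq_or_lt with h0 | hpos
  · rw [← h0]; positivity
  rcases hb0.eq_or_lt with h0 | hbpos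
  · have : v = 0 := by
      have := norm_eq_zero.1 (hb.symm.trans h0.symm)
      simpa using this
    rw [ha, this]
    simpa using mul_nonneg ht hb0
  -- rescale the left vector to the norm of the right one
  have := key (b / a)
  have e1 : 2 * (b / a * a ^ 2) = 2 * b * a := by field_simp
  have e2 : t * (b / a * (b / a * a ^ 2) + b ^ 2) = 2 * b * (t * b) := by field_simp; ring
  rw [e1, e2] at this
  exact le_of_mul_le_mul_left this (by positivity)

lemma sum_col_sq_le (M : Matrix (Fin m) (Fin n) ℝ) (j : Fin n) :
    ∑ i, M i j ^ 2 ≤ specNorm M ^ 2 := by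
  have := sum_sq_mulVec_le M (Pi.single j 1)
  simpa [Pi.single_apply] using this

lemma sum_row_sq_le (M : Matrix (Fin m) (Fin n) ℝ) (i : Fin m) :
    ∑ j, M i j ^ 2 ≤ specNorm M ^ 2 := by
  have := sum_col_sq_le Mᵀ i
  rwa [specNorm_transpose] at this

variable (A : Matrix (Fin m) (Fin n) ℝ)

lemma row_l1_sq_le (i : Fin m) : (∑ j, |A i j|) ^ 2 ≤ ns A * specNorm A ^ 2 :=
  (sum_abs_sq_le (vecNs_row_le A i)).trans
    (mul_le_mul_of_nonneg_left (sum_row_sq_le A i) (ns_nonneg A))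

lemma col_l1_sq_le (j : Fin n) : (∑ i, |A i j|) ^ 2 ≤ ns A * specNorm A ^ 2 :=
  (sum_abs_sq_le (vecNs_col_le A j)).trans
    (mul_le_mul_of_nonneg_left (sum_col_sq_le A j) (ns_nonneg A))

/-- The bound for the variance of the columns: both the rows and the columns have `ℓ₁` norms at most
`√(ns A) ‖A‖`. -/
lemma sum_l1_mul_abs_le (j : Fin n) :
    ∑ i, (∑ l, |A i l|) * |A i j| ≤ ns A * specNorm A ^ 2 := by
  set R := Real.sqrt (ns A * specNorm A ^ 2) with hR
  have h0 : 0 ≤ ns A * specNorm A ^ 2 := mul_nonneg (ns_nonneg A) (sq_nonneg _)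
  calc _ ≤ ∑ i, R * |A i j| := Finset.sum_le_sum fun i _ =>
        mul_le_mul_of_nonneg_right (Real.le_sqrt_of_sq_le (row_l1_sq_le A i)) (abs_nonneg _)
    _ = R * ∑ i, |A i j| := by rw [Finset.mul_sum]
    _ ≤ R * R := mul_le_mul_of_nonneg_left (Real.le_sqrt_of_sq_le (col_l1_sq_le A j))
        (Real.sqrt_nonneg _)
    _ = _ := Real.mul_self_sqrt h0

end SpectralNorm
end RowSampling

/-! ### The matrix Laplace transform -/

namespace RowSampling
open Matrix

section MatrixMGF
variable {ι : Type*} [Fintype ι] [DecidableEq ι]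

/-- One step of the matrix Laplace transform method. If a random symmetric matrix `Y` satisfies
`Y ≤ 1` and `𝔼 (Y + Y²) ≤ 0`, then `𝔼 tr exp (D + Y) ≤ tr exp D`. -/
lemma sum_trace_exp_le [Nonempty ι] {Ω : Type*} [Fintype Ω] {p : Ω → ℝ} (hp : ∀ x, 0 ≤ p x)
    (hp1 : ∑ x, p x = 1) {Y : Ω → Matrix ι ι ℝ} (hY : ∀ x, (Y x)ᵀ = Y x)
    (hle : ∀ x z, z ⬝ᵥ Y x *ᵥ z ≤ z ⬝ᵥ z)
    (hE : ∀ z, ∑ x, p x * (z ⬝ᵥ Y x *ᵥ z + (Y x *ᵥ z) ⬝ᵥ (Y x *ᵥ z)) ≤ 0)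
    {D : Matrix ι ι ℝ} (hD : Dᵀ = D) :
    ∑ x, p x * (NormedSpace.exp (D + Y x)).trace ≤ (NormedSpace.exp D).trace := by
  have h1 : ∀ x, (NormedSpace.exp (D + Y x)).trace
      ≤ (NormedSpace.exp D * (1 + Y x + Y x * Y x)).trace := by
    intro x
    refine (trace_exp_add_le hD (hY x)).trans ?_
    have := trace_exp_mul_nonneg hD (posSemidef_exp_bound (hY x) (hle x))
    rw [mul_sub, trace_sub] at this
    linarith
  have hpsd : (-∑ x, p x • (Y x + Y x * Y x)).PosSemidef := by
    refine PosSemidef.of_dotProduct_mulVec_nonneg ?_ fun z => ?_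
    · rw [IsHermitian, conjTranspose_eq_transpose_of_trivial]
      simp [transpose_sum, hY]
    · have := hE z
      rw [neg_mulVec, dotProduct_neg, sum_mulVec, dotProduct_sum]
      simp only [star_trivial, smul_mulVec, dotProduct_smul, add_mulVec, dotProduct_add,
        smul_eq_mul]
      rw [neg_nonneg]
      refine le_trans (le_of_eq (Finset.sum_congr rfl fun x _ => ?_)) this
      congr 2
      rw [← mulVec_mulVec, dotProduct_mulVec, ← mulVec_transpose, hY]
  have h2 := trace_exp_mul_nonneg hD hpsd
  rw [mul_neg, trace_neg, Finset.mul_sum, trace_sum] at h2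
  calc _ ≤ ∑ x, p x * (NormedSpace.exp D * (1 + Y x + Y x * Y x)).trace :=
        Finset.sum_le_sum fun x _ => mul_le_mul_of_nonneg_left (h1 x) (hp x)
    _ = ∑ x, (p x * (NormedSpace.exp D).trace
          + (NormedSpace.exp D * (p x • (Y x + Y x * Y x))).trace) := by
        refine Finset.sum_congr rfl fun x _ => ?_
        rw [mul_smul_comm, trace_smul, add_assoc, mul_add, trace_add, mul_one, smul_eq_mul, mul_add]
    _ ≤ _ := by
        rw [Finset.sum_add_distrib, ← Finset.sum_mul, hp1, one_mul]
        linarith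

end MatrixMGF

section Iteration
open ENNReal

/-- If adding the random increment `Y i` never increases the potential `Φ` in expectation, then
neither does adding the sum of independent increments. -/
lemma lintegral_pi_potential_le {κ Ω E : Type*} [Fintype κ] [DecidableEq κ] [Finite Ω]
    [MeasurableSpace Ω] [MeasurableSingletonClass Ω] [AddCommMonoid E]
    (ν : κ → Measure Ω) [∀ i, IsProbabilityMeasure (ν i)] (good : E → Prop) (Φ : E → ℝ≥0∞)
    (Y : κ → Ω → E) (hgood : ∀ D i x, good D → good (D + Y i x))
    (hstep : ∀ D i, good D → ∫⁻ x, Φ (D + Y i x) ∂ν i ≤ Φ D) {D : E} (hD : good D) :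
    ∫⁻ q, Φ (D + ∑ i, Y i (q i)) ∂Measure.pi ν ≤ Φ D := by
  rcases isEmpty_or_nonempty (κ → Ω) with he | ⟨⟨q₀⟩⟩
  · simp
  rw [lintegral_eq_lmarginal_univ q₀]
  have key : ∀ T : Finset κ, ∀ q : κ → Ω,
      (∫⋯∫⁻_T, (fun q => Φ (D + ∑ i ∈ T, Y i (q i))) ∂ν) q ≤ Φ D := by
    intro T
    induction T using Finset.induction_on with
    | empty => intro q; simp
    | insert a T ha ih =>
      intro q
      rw [lmarginal_insert' _ (measurable_of_finite _) ha]
      refine le_trans (lmarginal_mono (fun q => ?_) q) (ih q)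
      have hgT : good (D + ∑ i ∈ T, Y i (q i)) := by
        clear ih
        induction T using Finset.induction_on with
        | empty => simpa using hD
        | insert b T hb ih2 =>
          rw [Finset.sum_insert hb, add_comm (Y b _), ← add_assoc]
          exact hgood _ _ _ (ih2 fun h => ha (Finset.mem_insert_of_mem h))
      refine le_trans (le_of_eq ?_) (hstep _ a hgT)
      refine lintegral_congr fun x => ?_
      rw [Finset.sum_insert ha, Function.update_self, add_comm (Y a x), ← add_assoc]
      congr 3
      refine Finset.sum_congr rfl fun i hi => ?_
      rw [Function.update_of_ne (ne_of_mem_of_not_mem hi ha)]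
  exact key Finset.univ q₀

end Iteration
end RowSampling

/-! ### Sampling as a choice of indices -/

namespace RowSampling
open Matrix

section IndexLaw
open ENNReal
variable {n : ℕ}

/-- The sampling weights of a row, completed by uniform weights for the zero row. -/
noncomputable def drawWeight (a : Fin n → ℝ) (j : Fin n) : ℝ :=
  open Classical in if a = 0 then 1 / (n : ℝ) else l1Prob a j

/-- The only nonzero coordinate `a_j / p_j` of the sample that picks the index `j`. -/
noncomputable def drawCoeff (a : Fin n → ℝ) (j : Fin n) : ℝ := a j / l1Prob a j

/-- The sample that picks the index `j`. -/
noncomputable def drawValue (a : Fin n → ℝ) (j : Fin n) : Fin n → ℝ := Pi.single j (drawCoeff a j)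

/-- The law of the index picked by a sample. -/
noncomputable def drawIndex (a : Fin n → ℝ) : Measure (Fin n) :=
  ∑ j, ENNReal.ofReal (drawWeight a j) • Measure.dirac j

lemma l1_pos {a : Fin n → ℝ} (ha : a ≠ 0) : 0 < ∑ l, |a l| := by
  obtain ⟨j, hj⟩ := Function.ne_iff.1 ha
  exact Finset.sum_pos' (fun l _ => abs_nonneg _) ⟨j, Finset.mem_univ j, abs_pos.2 hj⟩

lemma drawWeight_nonneg (a : Fin n → ℝ) (j : Fin n) : 0 ≤ drawWeight a j := by
  unfold drawWeight l1Prob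
  split_ifs
  · positivity
  · exact div_nonneg (abs_nonneg _) (Finset.sum_nonneg fun _ _ => abs_nonneg _)

lemma sum_drawWeight [NeZero n] (a : Fin n → ℝ) : ∑ j, drawWeight a j = 1 := by
  unfold drawWeight l1Prob
  split_ifs with h
  · have : (n : ℝ) ≠ 0 := Nat.cast_ne_zero.2 (NeZero.ne n)
    simp [this]
  · rw [← Finset.sum_div, div_self (l1_pos h).ne']

lemma drawWeight_mul_l1 (a : Fin n → ℝ) (j : Fin n) : drawWeight a j * ∑ l, |a l| = |a j| := by
  unfold drawWeight l1Prob
  split_ifs with h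
  · simp [h]
  · rw [div_mul_cancel₀ _ (l1_pos h).ne']

lemma drawCoeff_mul_abs (a : Fin n → ℝ) (j : Fin n) :
    drawCoeff a j * |a j| = a j * ∑ l, |a l| := by
  unfold drawCoeff l1Prob
  by_cases h : a j = 0
  · simp [h]
  · have h1 : ∑ l, |a l| ≠ 0 := (l1_pos (fun h0 => h (congrFun h0 j))).ne'
    have h2 : |a j| ≠ 0 := abs_ne_zero.2 h
    field_simp

lemma drawCoeff_zero {a : Fin n → ℝ} {j : Fin n} (h : a j = 0) : drawCoeff a j = 0 := by
  simp [drawCoeff, h]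

/-- All samples of a row have the same length `‖a‖₁`. -/
lemma drawCoeff_sq (a : Fin n → ℝ) {j : Fin n} (h : a j ≠ 0) :
    drawCoeff a j ^ 2 = (∑ l, |a l|) ^ 2 := by
  have := drawCoeff_mul_abs a j
  have h2 : |a j| ^ 2 ≠ 0 := pow_ne_zero _ (abs_ne_zero.2 h)
  refine mul_right_cancel₀ h2 ?_
  rw [← mul_pow, this, mul_pow, sq_abs, mul_comm]

lemma drawCoeff_sq_le (a : Fin n → ℝ) (j : Fin n) : drawCoeff a j ^ 2 ≤ (∑ l, |a l|) ^ 2 := by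
  by_cases h : a j = 0
  · rw [drawCoeff_zero h, zero_pow two_ne_zero]; exact sq_nonneg _
  · exact (drawCoeff_sq a h).le

lemma drawCoeff_mul_self_nonneg (a : Fin n → ℝ) (j : Fin n) : 0 ≤ drawCoeff a j * a j := by
  unfold drawCoeff l1Prob
  rw [div_mul_eq_mul_div]
  exact div_nonneg (mul_self_nonneg _)
    (div_nonneg (abs_nonneg _) (Finset.sum_nonneg fun _ _ => abs_nonneg _))

/-- A sample of a row has the row as its mean. -/
lemma drawWeight_mul_coeff (a : Fin n → ℝ) (j : Fin n) : drawWeight a j * drawCoeff a j = a j := by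
  by_cases h : a j = 0
  · rw [drawCoeff_zero h, h, mul_zero]
  · have h1 := drawWeight_mul_l1 a j
    have h2 := drawCoeff_mul_abs a j
    have h3 : ∑ l, |a l| ≠ 0 := (l1_pos (fun h0 => h (congrFun h0 j))).ne'
    refine mul_right_cancel₀ h3 ?_
    rw [mul_right_comm, h1, mul_comm, h2]

lemma drawWeight_mul_coeff_sq (a : Fin n → ℝ) (j : Fin n) :
    drawWeight a j * drawCoeff a j ^ 2 = |a j| * ∑ l, |a l| := by
  by_cases h : a j = 0
  · simp [drawCoeff_zero h, h]
  · rw [drawCoeff_sq a h, pow_two, ← mul_assoc, drawWeight_mul_l1]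

instance [NeZero n] (a : Fin n → ℝ) : IsProbabilityMeasure (drawIndex a) := by
  constructor
  simp only [drawIndex, Measure.coe_finsetSum, Finset.sum_apply, Measure.smul_apply,
    measure_univ, smul_eq_mul, mul_one]
  rw [← ENNReal.ofReal_sum_of_nonneg fun j _ => drawWeight_nonneg a j, sum_drawWeight,
    ENNReal.ofReal_one]

lemma lintegral_drawIndex (a : Fin n → ℝ) (f : Fin n → ℝ≥0∞) :
    ∫⁻ j, f j ∂drawIndex a = ∑ j, ENNReal.ofReal (drawWeight a j) * f j := by
  simp [drawIndex, lintegral_finsetSum_measure]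

lemma map_drawIndex [NeZero n] (a : Fin n → ℝ) : (drawIndex a).map (drawValue a) = rowDraw a := by
  have hm : Measurable (drawValue a) := measurable_of_finite _
  have h0 : (drawIndex a).map (drawValue a)
      = ∑ j, ENNReal.ofReal (drawWeight a j) • Measure.dirac (drawValue a j) := by
    rw [drawIndex, Measure.map_finset_sum hm.aemeasurable]
    simp_rw [Measure.map_smul, Measure.map_dirac' hm]
  rw [h0]
  unfold rowDraw
  split_ifs with h
  · have : ∀ j, drawValue a j = 0 := fun j => by simp [drawValue, drawCoeff, h]
    simp_rw [this, ← Finset.sum_smul]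
    rw [← ENNReal.ofReal_sum_of_nonneg fun j _ => drawWeight_nonneg a j, sum_drawWeight,
      ENNReal.ofReal_one, one_smul]
  · simp [drawWeight, h, drawValue, drawCoeff]

variable {m : ℕ}

/-- The random matrix as a function of the picked indices. -/
noncomputable def assembleIndex (A : Matrix (Fin m) (Fin n) ℝ) (s : ℕ) (keep : Set (Fin m))
    (f : Fin m × Fin s → Fin n) : Fin m → Fin n → ℝ :=
  assemble A s keep fun it => drawValue (A it.1) (f it)

lemma measurable_assemble (A : Matrix (Fin m) (Fin n) ℝ) (s : ℕ) (keep : Set (Fin m)) :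
    Measurable (assemble A s keep) := by
  unfold assemble
  refine measurable_pi_iff.2 fun i => measurable_pi_iff.2 fun j => ?_
  split_ifs
  · fun_prop
  · fun_prop

/-- Row sampling is the image of a measure on a finite space, on which all sets are measurable. -/
lemma rowSampling_eq_map [NeZero n] (A : Matrix (Fin m) (Fin n) ℝ) (s : ℕ) (keep : Set (Fin m)) :
    rowSampling A s keep
      = (Measure.pi fun it : Fin m × Fin s => drawIndex (A it.1)).map (assembleIndex A s keep) := by
  unfold rowSampling
  have : (Measure.pi fun it : Fin m × Fin s => rowDraw (A it.1))
      = (Measure.pi fun it : Fin m × Fin s => drawIndex (A it.1)).map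
        (fun f it => drawValue (A it.1) (f it)) := by
    rw [Measure.pi_map_pi fun it => (measurable_of_finite _).aemeasurable]
    simp_rw [map_drawIndex]
  rw [this, Measure.map_map (measurable_assemble A s keep) (measurable_of_finite _)]
  rfl

end IndexLaw
end RowSampling

/-! ### The matrix increment of a sample -/

namespace RowSampling
open Matrix

section Increment
variable {m n : ℕ}

/-- The increment of the matrix Laplace transform method that belongs to one sample: the symmetric
dilation of `β e_i (sample - a)ᵀ`, compensated by a diagonal matrix which is twice a bound for its
second moment. -/
noncomputable def increment (a : Fin n → ℝ) (i : Fin m) (β : ℝ) (j : Fin n) :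
    Matrix (Fin m ⊕ Fin n) (Fin m ⊕ Fin n) ℝ :=
  fromBlocks (-diagonal (Pi.single i (2 * β ^ 2 * (∑ l, |a l|) ^ 2)))
    (vecMulVec (Pi.single i β) (drawValue a j - a))
    (vecMulVec (drawValue a j - a) (Pi.single i β))
    (-diagonal fun l => 2 * β ^ 2 * ((∑ l, |a l|) * |a l|))

lemma increment_transpose (a : Fin n → ℝ) (i : Fin m) (β : ℝ) (j : Fin n) :
    (increment a i β j)ᵀ = increment a i β j := by
  rw [increment, fromBlocks_transpose]
  simp [transpose_vecMulVec]

lemma increment_mulVec (a : Fin n → ℝ) (i : Fin m) (β : ℝ) (j : Fin n) (u : Fin m → ℝ)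
    (v : Fin n → ℝ) :
    increment a i β j *ᵥ Sum.elim u v = Sum.elim
      (Pi.single i (β * ((drawValue a j - a) ⬝ᵥ v) - 2 * β ^ 2 * (∑ l, |a l|) ^ 2 * u i))
      (fun l => β * u i * (drawValue a j - a) l - 2 * β ^ 2 * ((∑ l, |a l|) * |a l|) * v l) := by
  rw [increment, fromBlocks_mulVec]
  congr 1
  · ext k
    by_cases hk : k = i
    · subst hk
      simp [vecMulVec_mulVec, mulVec_diagonal]; ring
    · simp [vecMulVec_mulVec, mulVec_diagonal, hk]
  · ext l
    simp [vecMulVec_mulVec, mulVec_diagonal]; ring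

lemma increment_quadratic (a : Fin n → ℝ) (i : Fin m) (β : ℝ) (j : Fin n) (u : Fin m → ℝ)
    (v : Fin n → ℝ) :
    Sum.elim u v ⬝ᵥ increment a i β j *ᵥ Sum.elim u v
      = 2 * β * u i * ((drawValue a j - a) ⬝ᵥ v) - 2 * β ^ 2 * (∑ l, |a l|) ^ 2 * u i ^ 2
        - ∑ l, 2 * β ^ 2 * ((∑ l, |a l|) * |a l|) * v l ^ 2 := by
  rw [increment_mulVec, sumElim_dotProduct_sumElim, dotProduct_single]
  have : v ⬝ᵥ (fun l => β * u i * (drawValue a j - a) l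
      - 2 * β ^ 2 * ((∑ l, |a l|) * |a l|) * v l)
      = β * u i * ((drawValue a j - a) ⬝ᵥ v)
        - ∑ l, 2 * β ^ 2 * ((∑ l, |a l|) * |a l|) * v l ^ 2 := by
    simp only [dotProduct, Finset.mul_sum, ← Finset.sum_sub_distrib]
    exact Finset.sum_congr rfl fun l _ => by ring
  rw [this]; ring

lemma drawValue_sub_dotProduct (a : Fin n → ℝ) (j : Fin n) (v : Fin n → ℝ) :
    (drawValue a j - a) ⬝ᵥ v = drawCoeff a j * v j - a ⬝ᵥ v := by
  rw [sub_dotProduct, drawValue, single_dotProduct]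

/-- The eigenvalues of the increment are at most `1` if `β ‖a‖₁ ≤ 1 / 2`. -/
lemma increment_rayleigh_le (a : Fin n → ℝ) (i : Fin m) {β : ℝ} (hβ : 0 ≤ β)
    (hβS : β * ∑ l, |a l| ≤ 1 / 2) (j : Fin n) (z : Fin m ⊕ Fin n → ℝ) :
    z ⬝ᵥ increment a i β j *ᵥ z ≤ z ⬝ᵥ z := by
  obtain ⟨u, v, rfl⟩ : ∃ u v, z = Sum.elim u v := ⟨_, _, (Sum.elim_comp_inl_inr z).symm⟩
  rw [increment_quadratic, sumElim_dotProduct_sumElim]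
  set x := drawValue a j - a with hx
  have hS : 0 ≤ ∑ l, |a l| := Finset.sum_nonneg fun _ _ => abs_nonneg _
  have h1 : 0 ≤ ∑ l, 2 * β ^ 2 * ((∑ l, |a l|) * |a l|) * v l ^ 2 :=
    Finset.sum_nonneg fun l _ => by positivity
  have h2 : 0 ≤ 2 * β ^ 2 * (∑ l, |a l|) ^ 2 * u i ^ 2 := by positivity
  have hxx : x ⬝ᵥ x ≤ 2 * (∑ l, |a l|) ^ 2 := by
    have e : x ⬝ᵥ x = drawCoeff a j ^ 2 - 2 * (drawCoeff a j * a j) + ∑ l, a l ^ 2 := by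
      rw [hx, drawValue_sub_dotProduct, dotProduct_sub, drawValue, dotProduct_single]
      simp only [Pi.sub_apply, Pi.single_eq_same, dotProduct, ← pow_two]
      ring
    have := drawCoeff_sq_le a j
    have := drawCoeff_mul_self_nonneg a j
    have := sum_sq_le_sum_abs_sq a
    linarith
  have hcs : (x ⬝ᵥ v) ^ 2 ≤ (x ⬝ᵥ x) * (v ⬝ᵥ v) := by
    simpa [dotProduct, pow_two] using Finset.sum_mul_sq_le_sq_mul_sq Finset.univ x v
  have hvv : 0 ≤ v ⬝ᵥ v := Finset.sum_nonneg fun _ _ => mul_self_nonneg _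
  have hu : u i ^ 2 ≤ u ⬝ᵥ u := by
    simpa [dotProduct, pow_two] using
      Finset.single_le_sum (f := fun i => u i * u i) (fun i _ => mul_self_nonneg _)
        (Finset.mem_univ i)
  have hb : β ^ 2 * (x ⬝ᵥ v) ^ 2 ≤ v ⬝ᵥ v := by
    have h3 : β ^ 2 * (∑ l, |a l|) ^ 2 ≤ 1 / 4 := by
      rw [← mul_pow]
      calc _ ≤ (1 / 2 : ℝ) ^ 2 := pow_le_pow_left₀ (mul_nonneg hβ hS) hβS 2
        _ = _ := by norm_num
    calc β ^ 2 * (x ⬝ᵥ v) ^ 2 ≤ β ^ 2 * ((2 * (∑ l, |a l|) ^ 2) * (v ⬝ᵥ v)) := by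
          gcongr
          exact hcs.trans (mul_le_mul_of_nonneg_right hxx hvv)
      _ = 2 * (β ^ 2 * (∑ l, |a l|) ^ 2) * (v ⬝ᵥ v) := by ring
      _ ≤ 1 * (v ⬝ᵥ v) := by gcongr; linarith
      _ = _ := one_mul _
  nlinarith [sq_nonneg (u i - β * (x ⬝ᵥ v))]

/-- The expectation of `Y + Y²` is negative semidefinite for the increment `Y`: the diagonal matrix
in `Y` outweighs the second moment of the sample and its own square. -/
lemma increment_moment_le [NeZero n] (a : Fin n → ℝ) (i : Fin m) {β : ℝ} (hβ : 0 ≤ β)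
    (hβS : β * ∑ l, |a l| ≤ 1 / 2) (z : Fin m ⊕ Fin n → ℝ) :
    ∑ j, drawWeight a j * (z ⬝ᵥ increment a i β j *ᵥ z
      + (increment a i β j *ᵥ z) ⬝ᵥ (increment a i β j *ᵥ z)) ≤ 0 := by
  obtain ⟨u, v, rfl⟩ : ∃ u v, z = Sum.elim u v := ⟨_, _, (Sum.elim_comp_inl_inr z).symm⟩
  set S := ∑ l, |a l| with hS
  have hS0 : 0 ≤ S := Finset.sum_nonneg fun _ _ => abs_nonneg _
  set g := 2 * β ^ 2 * S ^ 2 with hg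
  set h : Fin n → ℝ := fun l => 2 * β ^ 2 * (S * |a l|) with hh
  set α := a ⬝ᵥ v with hα
  set Q := ∑ l, a l ^ 2 with hQ
  set H1 := ∑ l, h l * v l ^ 2 with hH1
  set H2 := ∑ l, h l ^ 2 * v l ^ 2 with hH2
  set τ := ∑ l, a l * (h l * v l) with hτ
  set W := ∑ l, |a l| * S * v l ^ 2 with hW
  -- a polynomial in the random coefficient, of which only the first two moments matter
  have hF : ∀ j, Sum.elim u v ⬝ᵥ increment a i β j *ᵥ Sum.elim u v
      + (increment a i β j *ᵥ Sum.elim u v) ⬝ᵥ (increment a i β j *ᵥ Sum.elim u v)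
      = (- 2 * β * u i * α - g * u i ^ 2 - H1 + β ^ 2 * α ^ 2 + 2 * β * g * u i * α
          + g ^ 2 * u i ^ 2 + β ^ 2 * u i ^ 2 * Q + 2 * β * u i * τ + H2)
        + drawCoeff a j * ((2 * β * u i - 2 * β ^ 2 * α - 2 * β * g * u i) * v j)
        - drawCoeff a j * (2 * β ^ 2 * u i ^ 2 * a j)
        - drawCoeff a j * (2 * β * u i * (h j * v j))
        + drawCoeff a j ^ 2 * (β ^ 2 * v j ^ 2)
        + drawCoeff a j ^ 2 * (β ^ 2 * u i ^ 2) := by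
    intro j
    rw [increment_quadratic, increment_mulVec, sumElim_dotProduct_sumElim, single_dotProduct,
      Pi.single_eq_same]
    have e1 : (fun l => β * u i * (drawValue a j - a) l - 2 * β ^ 2 * (S * |a l|) * v l) ⬝ᵥ
        (fun l => β * u i * (drawValue a j - a) l - 2 * β ^ 2 * (S * |a l|) * v l)
        = β ^ 2 * u i ^ 2 * (drawCoeff a j ^ 2 - 2 * (drawCoeff a j * a j) + Q)
          - 2 * β * u i * (drawCoeff a j * (h j * v j) - τ) + H2 := by
      have e2 : drawCoeff a j ^ 2 - 2 * (drawCoeff a j * a j) + Q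
          = ∑ l, (drawValue a j - a) l ^ 2 := by
        have : (drawValue a j - a) ⬝ᵥ (drawValue a j - a) = ∑ l, (drawValue a j - a) l ^ 2 := by
          simp [dotProduct, pow_two]
        rw [← this, drawValue_sub_dotProduct, dotProduct_sub, drawValue, dotProduct_single]
        simp only [Pi.sub_apply, Pi.single_eq_same, dotProduct, ← pow_two]
        ring
      have e3 : drawCoeff a j * (h j * v j) - τ = ∑ l, (drawValue a j - a) l * (h l * v l) := by
        have := drawValue_sub_dotProduct a j (fun l => h l * v l)
        simp only [dotProduct] at this
        rw [this]
      rw [e2, e3, hH2]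
      simp only [dotProduct, Finset.mul_sum, ← Finset.sum_sub_distrib, ← Finset.sum_add_distrib]
      exact Finset.sum_congr rfl fun l _ => by rw [hh]; ring
    rw [e1, drawValue_sub_dotProduct]
    have e4 : ∑ l, 2 * β ^ 2 * (S * |a l|) * v l ^ 2 = H1 := rfl
    rw [← hS, e4]
    ring
  have lin : ∀ y : Fin n → ℝ, ∑ j, drawWeight a j * (drawCoeff a j * y j) = ∑ j, a j * y j :=
    fun y => Finset.sum_congr rfl fun j _ => by rw [← mul_assoc, drawWeight_mul_coeff]
  have quad : ∀ y : Fin n → ℝ,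
      ∑ j, drawWeight a j * (drawCoeff a j ^ 2 * y j) = ∑ j, |a j| * S * y j :=
    fun y => Finset.sum_congr rfl fun j _ => by rw [← mul_assoc, drawWeight_mul_coeff_sq]
  have hsum : ∀ (K : ℝ) (y₁ y₂ y₃ y₄ y₅ : Fin n → ℝ), ∑ j, drawWeight a j *
      (K + drawCoeff a j * y₁ j - drawCoeff a j * y₂ j - drawCoeff a j * y₃ j
        + drawCoeff a j ^ 2 * y₄ j + drawCoeff a j ^ 2 * y₅ j)
      = K + ∑ j, a j * y₁ j - ∑ j, a j * y₂ j - ∑ j, a j * y₃ j + ∑ j, |a j| * S * y₄ j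
        + ∑ j, |a j| * S * y₅ j := by
    intro K y₁ y₂ y₃ y₄ y₅
    rw [← lin, ← lin, ← lin, ← quad, ← quad]
    nth_rw 2 [← one_mul K]
    rw [← sum_drawWeight a, Finset.sum_mul]
    simp only [← Finset.sum_sub_distrib, ← Finset.sum_add_distrib]
    exact Finset.sum_congr rfl fun j _ => by ring
  rw [Finset.sum_congr rfl fun j _ => by rw [hF j], hsum]
  have s1 : ∀ c : ℝ, ∑ j, a j * (c * v j) = c * α := fun c => by
    rw [hα, dotProduct, Finset.mul_sum]; exact Finset.sum_congr rfl fun j _ => by ring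
  have s2 : ∀ c : ℝ, ∑ j, a j * (c * a j) = c * Q := fun c => by
    rw [hQ, Finset.mul_sum]; exact Finset.sum_congr rfl fun j _ => by ring
  have s3 : ∀ c : ℝ, ∑ j, a j * (c * (h j * v j)) = c * τ := fun c => by
    rw [hτ, Finset.mul_sum]; exact Finset.sum_congr rfl fun j _ => by ring
  have s4 : ∀ c : ℝ, ∑ j, |a j| * S * (c * v j ^ 2) = c * W := fun c => by
    rw [hW, Finset.mul_sum]; exact Finset.sum_congr rfl fun j _ => by ring
  have s5 : ∀ c : ℝ, ∑ j, |a j| * S * c = c * S ^ 2 := fun c => by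
    rw [← Finset.sum_mul, ← Finset.sum_mul, ← hS]; ring
  rw [s1, s2, s3, s4, s5]
  have hβ2 : β ^ 2 * S ^ 2 ≤ 1 / 4 := by
    rw [← mul_pow]
    calc _ ≤ (1 / 2 : ℝ) ^ 2 := pow_le_pow_left₀ (mul_nonneg hβ hS0) hβS 2
      _ = _ := by norm_num
  have hH1W : H1 = 2 * β ^ 2 * W := by
    rw [hH1, hW, Finset.mul_sum]; exact Finset.sum_congr rfl fun j _ => by rw [hh]; ring
  have hH2le : H2 ≤ 1 / 2 * H1 := by
    rw [hH1, hH2, Finset.mul_sum]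
    refine Finset.sum_le_sum fun l _ => ?_
    have h0 : 0 ≤ h l := by simp only [hh]; positivity
    have hl : h l ≤ 1 / 2 := by
      have : |a l| ≤ S := Finset.single_le_sum (f := fun l => |a l|)
        (fun _ _ => abs_nonneg _) (Finset.mem_univ l)
      have : S * |a l| ≤ S ^ 2 := by rw [pow_two]; gcongr
      calc h l = 2 * (β ^ 2 * (S * |a l|)) := by simp only [hh]; ring
        _ ≤ 2 * (β ^ 2 * S ^ 2) := by gcongr
        _ ≤ 1 / 2 := by linarith
    calc h l ^ 2 * v l ^ 2 = h l * (h l * v l ^ 2) := by ring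
      _ ≤ 1 / 2 * (h l * v l ^ 2) := by gcongr
  have hg2 : g ≤ 1 / 2 := by rw [hg]; linarith
  have hg0 : 0 ≤ g := by positivity
  have hQ0 : 0 ≤ Q := Finset.sum_nonneg fun _ _ => sq_nonneg _
  have p1 : g ^ 2 * u i ^ 2 ≤ 1 / 2 * g * u i ^ 2 := by
    have : g ^ 2 ≤ 1 / 2 * g := by nlinarith
    gcongr
  have p2 : β ^ 2 * u i ^ 2 * S ^ 2 = 1 / 2 * g * u i ^ 2 := by rw [hg]; ring
  have p3 : 0 ≤ β ^ 2 * u i ^ 2 * Q := by positivity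
  have p4 : 0 ≤ β ^ 2 * α ^ 2 := by positivity
  linarith

end Increment
end RowSampling

/-! ### A matrix Bernstein inequality for row sampling -/

namespace RowSampling
open Matrix

section Bernstein
variable {m n : ℕ}

/-- The samples of the row `i`, centered and with weight `θ / s`, add up to `θ` times the error. -/
lemma sum_drawValue_sub (A : Matrix (Fin m) (Fin n) ℝ) {s : ℕ} (hs : 0 < s) (keep : Set (Fin m))
    [DecidablePred (· ∈ keep)] (θ : ℝ) (f : Fin m × Fin s → Fin n) (i : Fin m) (v : Fin n → ℝ) :
    ∑ t, (if i ∈ keep then 0 else θ / s) * ((drawValue (A i) (f (i, t)) - A i) ⬝ᵥ v)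
      = θ * ((Matrix.of (assembleIndex A s keep f) - A) *ᵥ v) i := by
  have hs0 : (s : ℝ) ≠ 0 := Nat.cast_ne_zero.2 hs.ne'
  by_cases hi : i ∈ keep
  · have : ∀ j, assembleIndex A s keep f i j = A i j := fun j => by
      simp [assembleIndex, assemble, hi]
    simp [hi, mulVec, dotProduct, this]
  · have : ∀ j, assembleIndex A s keep f i j
        = (1 / (s : ℝ)) * ∑ t, drawValue (A i) (f (i, t)) j := fun j => by
      simp [assembleIndex, assemble, hi]
    simp only [hi, if_false, mulVec, dotProduct, Matrix.sub_apply, of_apply, this, Pi.sub_apply]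
    rw [← Finset.mul_sum, Finset.sum_comm, Finset.mul_sum, Finset.mul_sum]
    refine Finset.sum_congr rfl fun j _ => ?_
    rw [← Finset.sum_mul, Finset.sum_sub_distrib]
    simp only [Finset.sum_const, Finset.card_univ, Fintype.card_fin, nsmul_eq_mul]
    field_simp

/-- A matrix Bernstein inequality for row sampling. The number `w` bounds the total compensation in
every row and column of the dilation. -/
theorem measure_lt_specNorm_le [NeZero n] (A : Matrix (Fin m) (Fin n) ℝ) {s : ℕ} (hs : 0 < s)
    (keep : Set (Fin m)) {θ w t : ℝ} (hθ : 0 < θ) (ht : 0 ≤ t)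
    (h1 : ∀ i, θ / s * ∑ l, |A i l| ≤ 1 / 2)
    (h2 : ∀ i, 2 * θ ^ 2 / s * (∑ l, |A i l|) ^ 2 ≤ w)
    (h3 : ∀ j, 2 * θ ^ 2 / s * ∑ i, (∑ l, |A i l|) * |A i j| ≤ w) :
    (Measure.pi fun it : Fin m × Fin s => drawIndex (A it.1))
        {f | t < specNorm (Matrix.of (assembleIndex A s keep f) - A)}
      ≤ ENNReal.ofReal (((m : ℝ) + n) * Real.exp (w - θ * t)) := by
  classical
  have hs0 : (0 : ℝ) < s := Nat.cast_pos.2 hs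
  -- rows that are kept do not contribute to the error
  set β : Fin m → ℝ := fun i => if i ∈ keep then 0 else θ / s with hβ
  have hβ0 : ∀ i, 0 ≤ β i := fun i => by
    simp only [hβ]; split_ifs
    · exact le_rfl
    · positivity
  have hβle : ∀ i, β i ≤ θ / s := fun i => by
    simp only [hβ]; split_ifs
    · positivity
    · exact le_rfl
  have hS0 : ∀ i, 0 ≤ ∑ l, |A i l| := fun i => Finset.sum_nonneg fun _ _ => abs_nonneg _
  have hβS : ∀ i, β i * ∑ l, |A i l| ≤ 1 / 2 := fun i =>
    (mul_le_mul_of_nonneg_right (hβle i) (hS0 i)).trans (h1 i)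
  set Y : Fin m × Fin s → Fin n → Matrix (Fin m ⊕ Fin n) (Fin m ⊕ Fin n) ℝ :=
    fun it j => increment (A it.1) it.1 (β it.1) j with hY
  set Φ : Matrix (Fin m ⊕ Fin n) (Fin m ⊕ Fin n) ℝ → ENNReal :=
    fun D => ENNReal.ofReal (NormedSpace.exp D).trace with hΦ
  set ν := Measure.pi fun it : Fin m × Fin s => drawIndex (A it.1) with hν
  have : Nonempty (Fin m ⊕ Fin n) := ⟨Sum.inr 0⟩
  have hint : ∫⁻ f, Φ (0 + ∑ it, Y it (f it)) ∂ν ≤ Φ 0 := by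
    refine lintegral_pi_potential_le _ (fun D => Dᵀ = D) Φ Y (fun D it j hD => ?_)
      (fun D it hD => ?_) (by simp)
    · rw [transpose_add, hD, increment_transpose]
    · rw [lintegral_drawIndex]
      simp only [hΦ]
      simp_rw [← ENNReal.ofReal_mul (drawWeight_nonneg _ _)]
      rw [← ENNReal.ofReal_sum_of_nonneg]
      · exact ENNReal.ofReal_le_ofReal (sum_trace_exp_le (drawWeight_nonneg _) (sum_drawWeight _)
          (fun j => increment_transpose _ _ _ j)
          (fun j z => increment_rayleigh_le _ _ (hβ0 _) (hβS _) j z)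
          (fun z => increment_moment_le _ _ (hβ0 _) (hβS _) z) hD)
      · intro j _
        refine mul_nonneg (drawWeight_nonneg _ _) ?_
        have := trace_exp_mul_nonneg (D := D + Y it j)
          (by rw [transpose_add, hD, increment_transpose]) (PosSemidef.one (n := Fin m ⊕ Fin n))
        rwa [mul_one] at this
  have hΦ0 : Φ 0 = ENNReal.ofReal ((m : ℝ) + n) := by
    simp [hΦ, NormedSpace.exp_zero, trace_one]
  have hsub : {f | t < specNorm (Matrix.of (assembleIndex A s keep f) - A)}
      ⊆ {f | ENNReal.ofReal (Real.exp (θ * t - w)) ≤ Φ (0 + ∑ it, Y it (f it))} := by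
    intro f hf
    rw [Set.mem_ofPred_eq] at hf ⊢
    simp only [hΦ, zero_add]
    refine ENNReal.ofReal_le_ofReal ?_
    -- a vector that witnesses the large norm has a large Rayleigh quotient for the dilation
    obtain ⟨u, v, huv⟩ : ∃ u v, t * (u ⬝ᵥ u + v ⬝ᵥ v)
        < 2 * (u ⬝ᵥ (Matrix.of (assembleIndex A s keep f) - A) *ᵥ v) := by
      by_contra! hcon
      exact absurd (specNorm_le_of_forall ht hcon) (not_le.2 hf)
    refine exp_le_trace_exp (z := Sum.elim u v) ?_ ?_
    · rw [transpose_sum]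
      exact Finset.sum_congr rfl fun it _ => increment_transpose _ _ _ _
    · rw [sum_mulVec, dotProduct_sum, sumElim_dotProduct_sumElim]
      simp only [hY, increment_quadratic, Finset.sum_sub_distrib]
      have e1 : ∑ it : Fin m × Fin s, 2 * β it.1 * u it.1 *
          ((drawValue (A it.1) (f it) - A it.1) ⬝ᵥ v)
          = 2 * θ * (u ⬝ᵥ (Matrix.of (assembleIndex A s keep f) - A) *ᵥ v) := by
        rw [Fintype.sum_prod_type, dotProduct, Finset.mul_sum]
        refine Finset.sum_congr rfl fun i _ => ?_
        have := sum_drawValue_sub A hs keep θ f i v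
        calc _ = 2 * u i * ∑ t, (if i ∈ keep then 0 else θ / s) *
              ((drawValue (A i) (f (i, t)) - A i) ⬝ᵥ v) := by
              rw [Finset.mul_sum]
              exact Finset.sum_congr rfl fun t _ => by simp only [hβ]; ring
          _ = _ := by rw [this]; ring
      have hβ2 : ∀ i, (s : ℝ) * (2 * β i ^ 2) ≤ 2 * θ ^ 2 / s := fun i => by
        calc (s : ℝ) * (2 * β i ^ 2) ≤ s * (2 * (θ / s) ^ 2) := by
              gcongr
              exact hβle i
          _ = _ := by field_simp
      have e2 : ∑ it : Fin m × Fin s, 2 * β it.1 ^ 2 * (∑ l, |A it.1 l|) ^ 2 * u it.1 ^ 2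
          ≤ w * (u ⬝ᵥ u) := by
        rw [Fintype.sum_prod_type, dotProduct, Finset.mul_sum]
        refine Finset.sum_le_sum fun i _ => ?_
        simp only [Finset.sum_const, Finset.card_univ, Fintype.card_fin, nsmul_eq_mul]
        calc (s : ℝ) * (2 * β i ^ 2 * (∑ l, |A i l|) ^ 2 * u i ^ 2)
            = (s * (2 * β i ^ 2)) * (∑ l, |A i l|) ^ 2 * u i ^ 2 := by ring
          _ ≤ (2 * θ ^ 2 / s) * (∑ l, |A i l|) ^ 2 * u i ^ 2 := by
              gcongr; exact hβ2 i
          _ ≤ w * u i ^ 2 := mul_le_mul_of_nonneg_right (h2 i) (sq_nonneg _)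
          _ = _ := by ring
      have e3 : ∑ it : Fin m × Fin s, ∑ j, 2 * β it.1 ^ 2 * ((∑ l, |A it.1 l|) * |A it.1 j|)
          * v j ^ 2 ≤ w * (v ⬝ᵥ v) := by
        rw [Finset.sum_comm, dotProduct, Finset.mul_sum]
        refine Finset.sum_le_sum fun j _ => ?_
        rw [Fintype.sum_prod_type]
        simp only [Finset.sum_const, Finset.card_univ, Fintype.card_fin, nsmul_eq_mul]
        calc ∑ i, (s : ℝ) * (2 * β i ^ 2 * ((∑ l, |A i l|) * |A i j|) * v j ^ 2)
            ≤ ∑ i, (2 * θ ^ 2 / s) * ((∑ l, |A i l|) * |A i j|) * v j ^ 2 := by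
              refine Finset.sum_le_sum fun i _ => ?_
              have h0 := hS0 i
              calc _ = (s * (2 * β i ^ 2)) * ((∑ l, |A i l|) * |A i j|) * v j ^ 2 := by ring
                _ ≤ _ := by gcongr; exact hβ2 i
          _ = (2 * θ ^ 2 / s * ∑ i, (∑ l, |A i l|) * |A i j|) * v j ^ 2 := by
              rw [Finset.mul_sum, Finset.sum_mul]
          _ ≤ w * v j ^ 2 := mul_le_mul_of_nonneg_right (h3 j) (sq_nonneg _)
          _ = _ := by ring
      rw [e1]
      have := mul_lt_mul_of_pos_left huv hθ
      nlinarith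
  refine (measure_mono hsub).trans ?_
  have hexp : ENNReal.ofReal (Real.exp (θ * t - w)) ≠ 0 := by
    simp [Real.exp_pos]
  refine (meas_ge_le_lintegral_div (measurable_of_finite _).aemeasurable hexp
    ENNReal.ofReal_ne_top).trans ?_
  refine (ENNReal.div_le_div_right hint _).trans ?_
  rw [hΦ0, ← ENNReal.ofReal_div_of_pos (Real.exp_pos _)]
  refine ENNReal.ofReal_le_ofReal (le_of_eq ?_)
  rw [div_eq_mul_inv, ← Real.exp_neg, neg_sub]

end Bernstein
end RowSampling

/-! ### The Schur test and column loads -/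

namespace RowSampling
open Matrix

section FewSamples
variable {m n : ℕ}

/-- The Schur test for a matrix of averaged samples: the spectral norm is controlled by the number of
samples in every column, where a sample of the row `i` counts `‖A_i‖₁²`. -/
lemma specNorm_assembleIndex_le (A : Matrix (Fin m) (Fin n) ℝ) {s : ℕ} (hs : 0 < s)
    (f : Fin m × Fin s → Fin n) {ρ : ℝ} (hρ : 0 < ρ)
    (h : ∀ j, ∑ it, (if f it = j then (∑ l, |A it.1 l|) ^ 2 else 0) ≤ ρ ^ 2 * s) :
    specNorm (Matrix.of (assembleIndex A s ∅ f)) ≤ ρ := by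
  have hs0 : (0 : ℝ) < s := Nat.cast_pos.2 hs
  refine specNorm_le_of_forall hρ.le fun u v => ?_
  have e1 : 2 * (u ⬝ᵥ Matrix.of (assembleIndex A s ∅ f) *ᵥ v)
      = (1 / s) * ∑ it, 2 * (u it.1 * drawCoeff (A it.1) (f it) * v (f it)) := by
    have : ∀ i j, assembleIndex A s ∅ f i j
        = (1 / (s : ℝ)) * ∑ t, drawValue (A i) (f (i, t)) j := fun i j => by
      simp [assembleIndex, assemble]
    rw [Fintype.sum_prod_type, dotProduct, Finset.mul_sum, Finset.mul_sum]
    refine Finset.sum_congr rfl fun i _ => ?_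
    simp only [mulVec, dotProduct, of_apply, this]
    have e2 : ∑ j, (1 / (s : ℝ)) * (∑ t, drawValue (A i) (f (i, t)) j) * v j
        = (1 / s) * ∑ t, drawCoeff (A i) (f (i, t)) * v (f (i, t)) := by
      rw [Finset.mul_sum]
      simp_rw [Finset.mul_sum, Finset.sum_mul]
      rw [Finset.sum_comm]
      refine Finset.sum_congr rfl fun t _ => ?_
      simp_rw [mul_assoc]
      rw [← Finset.mul_sum]
      congr 1
      exact single_dotProduct v (drawCoeff (A i) (f (i, t))) (f (i, t))
    rw [e2, ← Finset.mul_sum]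
    simp_rw [mul_assoc (u i)]
    rw [← Finset.mul_sum]
    ring
  have e3 : ∀ it, 2 * (u it.1 * drawCoeff (A it.1) (f it) * v (f it))
      ≤ ρ * u it.1 ^ 2 + (1 / ρ) * ((∑ l, |A it.1 l|) ^ 2 * v (f it) ^ 2) := fun it => by
    have hc := drawCoeff_sq_le (A it.1) (f it)
    set c := drawCoeff (A it.1) (f it)
    have h0 : 0 ≤ (1 / ρ) * (ρ * u it.1 - c * v (f it)) ^ 2 := by positivity
    have h1 : (1 / ρ) * (ρ * u it.1 - c * v (f it)) ^ 2
        = ρ * u it.1 ^ 2 - 2 * (u it.1 * c * v (f it)) + (1 / ρ) * (c ^ 2 * v (f it) ^ 2) := by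
      field_simp; ring
    have h2 : (1 / ρ) * (c ^ 2 * v (f it) ^ 2)
        ≤ (1 / ρ) * ((∑ l, |A it.1 l|) ^ 2 * v (f it) ^ 2) := by gcongr
    linarith
  have e4 : ∑ it : Fin m × Fin s, u it.1 ^ 2 = s * (u ⬝ᵥ u) := by
    rw [Fintype.sum_prod_type]
    simp [dotProduct, Finset.mul_sum, pow_two]
  have e5 : ∑ it : Fin m × Fin s, (∑ l, |A it.1 l|) ^ 2 * v (f it) ^ 2
      ≤ ρ ^ 2 * s * (v ⬝ᵥ v) := by
    calc _ = ∑ it : Fin m × Fin s, ∑ j, (if f it = j then (∑ l, |A it.1 l|) ^ 2 else 0) * v j ^ 2 := by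
          refine Finset.sum_congr rfl fun it _ => ?_
          simp
      _ = ∑ j, (∑ it, if f it = j then (∑ l, |A it.1 l|) ^ 2 else 0) * v j ^ 2 := by
          rw [Finset.sum_comm]
          exact Finset.sum_congr rfl fun j _ => by rw [Finset.sum_mul]
      _ ≤ ∑ j, ρ ^ 2 * s * v j ^ 2 := Finset.sum_le_sum fun j _ =>
          mul_le_mul_of_nonneg_right (h j) (sq_nonneg _)
      _ = _ := by simp [dotProduct, Finset.mul_sum, pow_two]
  rw [e1]
  calc _ ≤ (1 / (s : ℝ)) * ∑ it : Fin m × Fin s, (ρ * u it.1 ^ 2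
        + (1 / ρ) * ((∑ l, |A it.1 l|) ^ 2 * v (f it) ^ 2)) := by
        gcongr with it
        exact e3 it
    _ ≤ (1 / (s : ℝ)) * (ρ * (s * (u ⬝ᵥ u)) + (1 / ρ) * (ρ ^ 2 * s * (v ⬝ᵥ v))) := by
        rw [Finset.sum_add_distrib, ← Finset.mul_sum, ← Finset.mul_sum, e4]
        gcongr
    _ = ρ * (u ⬝ᵥ u + v ⬝ᵥ v) := by field_simp

/-- A Chernoff bound for the weighted number of samples that pick the column `j`. -/
lemma measure_column_load_le [NeZero n] (A : Matrix (Fin m) (Fin n) ℝ) (s : ℕ) {T l : ℝ}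
    (hT : 0 < T) (h1 : ∀ i, (∑ l, |A i l|) ^ 2 ≤ T) (j : Fin n)
    (h2 : ∑ i, (∑ l, |A i l|) * |A i j| ≤ T) :
    (Measure.pi fun it : Fin m × Fin s => drawIndex (A it.1))
        {f | T * (2 * s + l) < ∑ it, (if f it = j then (∑ l, |A it.1 l|) ^ 2 else 0)}
      ≤ ENNReal.ofReal (Real.exp (-l)) := by
  -- after division by `T` the weights are at most `1`, where `exp x ≤ 1 + 2 x`
  set κ : Fin m → ℝ := fun i => (∑ l, |A i l|) ^ 2 / T with hκ
  have hκ0 : ∀ i, 0 ≤ κ i := fun i => by positivity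
  have hκ1 : ∀ i, κ i ≤ 1 := fun i => (div_le_one hT).2 (h1 i)
  set Y : Fin m × Fin s → Fin n → ℝ := fun it x =>
    (if x = j then κ it.1 else 0) - 2 * (drawWeight (A it.1) j * κ it.1) with hY
  set Φ : ℝ → ENNReal := fun x => ENNReal.ofReal (Real.exp x) with hΦ
  have hint : ∫⁻ f, Φ (0 + ∑ it, Y it (f it))
      ∂(Measure.pi fun it : Fin m × Fin s => drawIndex (A it.1)) ≤ Φ 0 := by
    refine lintegral_pi_potential_le _ (fun _ => True) Φ Y (fun _ _ _ _ => trivial)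
      (fun D it _ => ?_) trivial
    rw [lintegral_drawIndex]
    simp only [hΦ]
    simp_rw [← ENNReal.ofReal_mul (drawWeight_nonneg _ _)]
    rw [← ENNReal.ofReal_sum_of_nonneg fun x _ =>
      mul_nonneg (drawWeight_nonneg _ _) (Real.exp_pos _).le]
    refine ENNReal.ofReal_le_ofReal ?_
    set p := drawWeight (A it.1) j with hp
    have hp0 : 0 ≤ p := drawWeight_nonneg _ _
    have k1 : Real.exp (κ it.1) ≤ 1 + 2 * κ it.1 := by
      have := (abs_le.1 (Real.abs_exp_sub_one_sub_id_le
        (abs_le.2 ⟨by linarith [hκ0 it.1], hκ1 it.1⟩))).2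
      nlinarith [hκ0 it.1, hκ1 it.1]
    have k2 : ∀ x, Real.exp (D + Y it x) = Real.exp (D - 2 * (p * κ it.1)) *
        (1 + if x = j then Real.exp (κ it.1) - 1 else 0) := by
      intro x
      simp only [hY]
      split_ifs
      · rw [add_sub_cancel, ← Real.exp_add]; congr 1; ring
      · rw [add_zero, mul_one]; congr 1; ring
    calc ∑ x, drawWeight (A it.1) x * Real.exp (D + Y it x)
        = Real.exp (D - 2 * (p * κ it.1)) * (1 + p * (Real.exp (κ it.1) - 1)) := by
          have : 1 + p * (Real.exp (κ it.1) - 1)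
              = ∑ x, drawWeight (A it.1) x *
                (1 + if x = j then Real.exp (κ it.1) - 1 else 0) := by
            simp [mul_add, Finset.sum_add_distrib, sum_drawWeight, hp]
          rw [this, Finset.mul_sum]
          exact Finset.sum_congr rfl fun x _ => by rw [k2]; ring
      _ ≤ Real.exp (D - 2 * (p * κ it.1)) * Real.exp (2 * (p * κ it.1)) := by
          gcongr
          have := Real.add_one_le_exp (2 * (p * κ it.1))
          nlinarith
      _ = Real.exp D := by rw [← Real.exp_add]; congr 1; ring
  have hΦ0 : Φ 0 = 1 := by simp [hΦ]
  have hsub : {f : Fin m × Fin s → Fin n |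
      T * (2 * s + l) < ∑ it, (if f it = j then (∑ l, |A it.1 l|) ^ 2 else 0)}
      ⊆ {f | ENNReal.ofReal (Real.exp l) ≤ Φ (0 + ∑ it, Y it (f it))} := by
    intro f hf
    rw [Set.mem_ofPred_eq] at hf ⊢
    refine ENNReal.ofReal_le_ofReal (Real.exp_le_exp.2 ?_)
    rw [zero_add]
    simp only [hY, Finset.sum_sub_distrib]
    have e1 : ∑ it : Fin m × Fin s, (if f it = j then κ it.1 else 0)
        = (∑ it, (if f it = j then (∑ l, |A it.1 l|) ^ 2 else 0)) / T := by
      rw [Finset.sum_div]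
      exact Finset.sum_congr rfl fun it _ => by simp only [hκ]; split_ifs <;> simp
    have e2 : ∑ it : Fin m × Fin s, 2 * (drawWeight (A it.1) j * κ it.1) ≤ 2 * s := by
      rw [Fintype.sum_prod_type]
      simp only [Finset.sum_const, Finset.card_univ, Fintype.card_fin, nsmul_eq_mul]
      calc ∑ i, (s : ℝ) * (2 * (drawWeight (A i) j * κ i))
          = 2 * s * ((∑ i, (∑ l, |A i l|) * |A i j|) / T) := by
            rw [Finset.sum_div, Finset.mul_sum]
            refine Finset.sum_congr rfl fun i _ => ?_
            rw [← drawWeight_mul_l1 (A i) j]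
            simp only [hκ]; ring
        _ ≤ 2 * s * 1 := by
            gcongr
            exact (div_le_one hT).2 h2
        _ = _ := mul_one _
    rw [e1]
    have : 2 * s + l < (∑ it, (if f it = j then (∑ l, |A it.1 l|) ^ 2 else 0)) / T := by
      rw [lt_div_iff₀ hT, mul_comm]; exact hf
    linarith
  refine (measure_mono hsub).trans ?_
  have hexp : ENNReal.ofReal (Real.exp l) ≠ 0 := by simp [Real.exp_pos]
  refine (meas_ge_le_lintegral_div (measurable_of_finite _).aemeasurable hexp
    ENNReal.ofReal_ne_top).trans ?_
  refine (ENNReal.div_le_div_right hint _).trans ?_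
  rw [hΦ0, ← ENNReal.ofReal_one, ← ENNReal.ofReal_div_of_pos (Real.exp_pos _), one_div,
    ← Real.exp_neg]

end FewSamples
end RowSampling

/-! ### The failure probability of row sampling -/

namespace RowSampling
open Matrix

section Tail
variable {m n : ℕ}

/-- The image of a measure on a finite space has finite support, so that the set `S` need not be
measurable. -/
lemma map_apply_le_of_finite {α β : Type*} [Finite α] [MeasurableSpace α]
    [MeasurableSingletonClass α] [MeasurableSpace β] [MeasurableSingletonClass β] (ν : Measure α)
    (g : α → β) (S : Set β) : (ν.map g) S ≤ ν (g ⁻¹' S) := by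
  have hg : Measurable g := measurable_of_finite g
  have hfin : (Set.range g).Finite := Set.finite_range g
  calc (ν.map g) S ≤ (ν.map g) ((S ∩ Set.range g) ∪ (Set.range g)ᶜ) :=
        measure_mono fun x hx => by
          by_cases h : x ∈ Set.range g
          · exact Or.inl ⟨hx, h⟩
          · exact Or.inr h
    _ ≤ (ν.map g) (S ∩ Set.range g) + (ν.map g) (Set.range g)ᶜ := measure_union_le _ _
    _ = ν (g ⁻¹' (S ∩ Set.range g)) := by
        rw [Measure.map_apply hg (hfin.subset Set.inter_subset_right).measurableSet,
          Measure.map_apply hg hfin.measurableSet.compl]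
        simp
    _ ≤ ν (g ⁻¹' S) := measure_mono (Set.preimage_mono Set.inter_subset_left)

/-- The entries of the sampled matrix are nonnegative multiples of those of `A`. -/
lemma assembleIndex_eq_mul (A : Matrix (Fin m) (Fin n) ℝ) (s : ℕ) (keep : Set (Fin m))
    (f : Fin m × Fin s → Fin n) :
    ∃ w : Fin m → Fin n → ℝ, ∀ i j, 0 ≤ w i j ∧ assembleIndex A s keep f i j = w i j * A i j := by
  have key : ∀ i j, ∃ w : ℝ, 0 ≤ w ∧ assembleIndex A s keep f i j = w * A i j := by
    intro i j
    by_cases hi : i ∈ keep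
    · exact ⟨1, zero_le_one, by simp [assembleIndex, assemble, hi]⟩
    · refine ⟨(1 / (s : ℝ)) * ∑ t, if f (i, t) = j then (l1Prob (A i) j)⁻¹ else 0, ?_, ?_⟩
      · refine mul_nonneg (by positivity) (Finset.sum_nonneg fun t _ => ?_)
        split_ifs
        · exact inv_nonneg.2 (div_nonneg (abs_nonneg _)
            (Finset.sum_nonneg fun _ _ => abs_nonneg _))
        · exact le_rfl
      · simp only [assembleIndex, assemble, hi, if_false]
        rw [mul_assoc, Finset.sum_mul]
        congr 1
        refine Finset.sum_congr rfl fun t _ => ?_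
        simp only [drawValue, drawCoeff, Pi.single_apply]
        by_cases h : f (i, t) = j
        · subst h
          simp [div_eq_mul_inv, mul_comm]
        · simp [h, Ne.symm h]
  choose w hw using key
  exact ⟨w, hw⟩

lemma rowNnz_assembleIndex_le (A : Matrix (Fin m) (Fin n) ℝ) (s : ℕ) (keep : Set (Fin m))
    (f : Fin m × Fin s → Fin n) {i : Fin m} (hi : i ∉ keep) :
    rowNnz (assembleIndex A s keep f) i ≤ s := by
  classical
  have hsub : {j : Fin n | assembleIndex A s keep f i j ≠ 0}
      ⊆ ((Finset.univ.image fun t => f (i, t) : Finset (Fin n)) : Set (Fin n)) := by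
    intro j hj
    by_contra hn
    apply hj
    simp only [assembleIndex, assemble, hi, if_false]
    rw [Finset.sum_eq_zero, mul_zero]
    intro t _
    refine Pi.single_eq_of_ne (fun h => hn ?_) _
    simp [h]
  refine (Set.ncard_le_ncard hsub (Finset.finite_toSet _)).trans ?_
  rw [Set.ncard_coe_finset]
  exact Finset.card_image_le.trans (by simp)

/-- For a matrix without entries there is nothing to show. -/
lemma isSparsifier_of_isEmpty (h : m = 0 ∨ n = 0) (ε : ℝ) (A B : Matrix (Fin m) (Fin n) ℝ) :
    IsSparsifier ε A B := by
  have hB : ∀ M : Matrix (Fin m) (Fin n) ℝ, M = 0 := fun M => by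
    ext i j
    rcases h with rfl | rfl
    · exact i.elim0
    · exact j.elim0
  rw [hB A, hB B]
  exact ⟨⟨0, by simp⟩, by rw [sub_zero, specNorm_zero, mul_zero]⟩

lemma not_isSparsifier_eq_empty (h : m = 0 ∨ n = 0) (ε : ℝ) (A : Matrix (Fin m) (Fin n) ℝ) :
    {B : Fin m → Fin n → ℝ | ¬ IsSparsifier ε A B} = ∅ :=
  Set.eq_empty_of_forall_notMem fun B hB => hB (isSparsifier_of_isEmpty h ε A B)

/-- Reduction of the failure probability to the finite space of picked indices. -/
lemma rowSampling_not_isSparsifier_le [NeZero n] (A : Matrix (Fin m) (Fin n) ℝ) (s : ℕ)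
    (keep : Set (Fin m)) (ε : ℝ) :
    rowSampling A s keep {B | ¬ IsSparsifier ε A B}
      ≤ (Measure.pi fun it : Fin m × Fin s => drawIndex (A it.1))
        {f | ε * specNorm A < specNorm (Matrix.of (assembleIndex A s keep f) - A)} := by
  rw [rowSampling_eq_map]
  refine (map_apply_le_of_finite _ _ _).trans (measure_mono fun f hf => ?_)
  by_contra hn
  exact hf ⟨assembleIndex_eq_mul A s keep f, not_lt.1 hn⟩

lemma specNorm_pos {A : Matrix (Fin m) (Fin n) ℝ} (hA : A ≠ 0) : 0 < specNorm A := by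
  open scoped Matrix.Norms.L2Operator in exact norm_pos_iff.2 hA

lemma two_le_add [NeZero m] [NeZero n] : (2 : ℝ) ≤ (m : ℝ) + n := by
  have h1 : (1 : ℝ) ≤ m := by exact_mod_cast NeZero.one_le
  have h2 : (1 : ℝ) ≤ n := by exact_mod_cast NeZero.one_le
  linarith

lemma log_add_pos [NeZero m] [NeZero n] : 0 < Real.log ((m : ℝ) + n) :=
  Real.log_pos (by have := two_le_add (m := m) (n := n); linarith)

/-- With at least logarithmically many samples, the matrix Bernstein inequality applies in its
sub-Gaussian range. -/
theorem rowSampling_failure_le_of_many [NeZero m] [NeZero n] {A : Matrix (Fin m) (Fin n) ℝ}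
    (hA : A ≠ 0) {ε : ℝ} (hε : 0 < ε) (c s : ℕ) (keep : Set (Fin m))
    (hs : 64 * Real.log ((m : ℝ) + n) ≤ s)
    (hs2 : ((c : ℝ) + 20) ^ 2 * (ε⁻¹ ^ 2 * ns A * Real.log ((m : ℝ) + n)) ≤ s) :
    rowSampling A s keep {B | ¬ IsSparsifier ε A B}
      ≤ ENNReal.ofReal (1 / ((m : ℝ) + n) ^ c) := by
  refine (rowSampling_not_isSparsifier_le A s keep ε).trans ?_
  have hL := log_add_pos (m := m) (n := n)
  have h2 := two_le_add (m := m) (n := n)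
  set L := Real.log ((m : ℝ) + n) with hLdef
  have hN := specNorm_pos hA
  set N := specNorm A with hNdef
  have hns : 0 < ns A := lt_of_lt_of_le one_pos (one_le_ns hA)
  have hT : 0 < ns A * N ^ 2 := by positivity
  have hs0 : (0 : ℝ) < s := by linarith
  have hs0' : 0 < s := by exact_mod_cast hs0
  -- for this `θ` the variance term in the Bernstein inequality is `2 L`
  set θ := Real.sqrt (s * L / (ns A * N ^ 2)) with hθ
  have hθpos : 0 < θ := Real.sqrt_pos.2 (by positivity)
  have hθ2 : θ ^ 2 = s * L / (ns A * N ^ 2) := Real.sq_sqrt (by positivity)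
  refine (measure_lt_specNorm_le A hs0' keep (θ := θ) (w := 2 * L) hθpos (by positivity)
    (fun i => ?_) (fun i => ?_) (fun j => ?_)).trans (ENNReal.ofReal_le_ofReal ?_)
  · have hS0 : 0 ≤ ∑ l, |A i l| := Finset.sum_nonneg fun _ _ => abs_nonneg _
    refine le_of_sq_le_sq ?_ (by norm_num)
    calc (θ / s * ∑ l, |A i l|) ^ 2 = θ ^ 2 / s ^ 2 * (∑ l, |A i l|) ^ 2 := by ring
      _ ≤ θ ^ 2 / s ^ 2 * (ns A * N ^ 2) := by gcongr; exact row_l1_sq_le A i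
      _ = L / s := by rw [hθ2]; field_simp
      _ ≤ (1 / 2) ^ 2 := by
          rw [div_le_iff₀ hs0]; linarith
  · calc 2 * θ ^ 2 / s * (∑ l, |A i l|) ^ 2 ≤ 2 * θ ^ 2 / s * (ns A * N ^ 2) := by
          gcongr; exact row_l1_sq_le A i
      _ = 2 * L := by rw [hθ2]; field_simp
  · calc 2 * θ ^ 2 / s * ∑ i, (∑ l, |A i l|) * |A i j| ≤ 2 * θ ^ 2 / s * (ns A * N ^ 2) := by
          gcongr; exact sum_l1_mul_abs_le A j
      _ = 2 * L := by rw [hθ2]; field_simp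
  · have hθt : ((c : ℝ) + 20) * L ≤ θ * (ε * N) := by
      refine le_of_sq_le_sq ?_ (by positivity)
      calc (((c : ℝ) + 20) * L) ^ 2
          = ((c : ℝ) + 20) ^ 2 * (ε⁻¹ ^ 2 * ns A * L) * (ε ^ 2 * L / ns A) := by field_simp
        _ ≤ s * (ε ^ 2 * L / ns A) := by gcongr
        _ = (θ * (ε * N)) ^ 2 := by rw [mul_pow, hθ2]; field_simp
    have hpos : (0 : ℝ) < (m : ℝ) + n := by linarith
    have hexp : ∀ k : ℕ, ((m : ℝ) + n) ^ k = Real.exp (k * L) := fun k => by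
      rw [Real.exp_nat_mul, hLdef, Real.exp_log hpos]
    have e1 : (m : ℝ) + n = Real.exp L := (Real.exp_log hpos).symm
    rw [hexp, one_div, ← Real.exp_neg]
    nth_rw 1 [e1]
    rw [← Real.exp_add]
    apply Real.exp_le_exp.2
    nlinarith

/-- With fewer than logarithmically many samples, the claim only concerns a large `ε`, and the norm
of the sampled matrix is controlled by the Schur test. -/
theorem rowSampling_failure_le_of_few [NeZero m] [NeZero n] {A : Matrix (Fin m) (Fin n) ℝ}
    (hA : A ≠ 0) {ε : ℝ} (hε : 0 < ε) (c s : ℕ) (hs : s < 64 * Real.log ((m : ℝ) + n))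
    (hs2 : ((c : ℝ) + 20) ^ 2 * (ε⁻¹ ^ 2 * ns A * Real.log ((m : ℝ) + n)) ≤ s) :
    rowSampling A s ∅ {B | ¬ IsSparsifier ε A B} ≤ ENNReal.ofReal (1 / ((m : ℝ) + n) ^ c) := by
  refine (rowSampling_not_isSparsifier_le A s ∅ ε).trans ?_
  have hL := log_add_pos (m := m) (n := n)
  have h2 := two_le_add (m := m) (n := n)
  set L := Real.log ((m : ℝ) + n) with hLdef
  have hN := specNorm_pos hA
  set N := specNorm A with hNdef
  have hns1 := one_le_ns hA
  have hns : 0 < ns A := lt_of_lt_of_le one_pos hns1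
  have hT : 0 < ns A * N ^ 2 := by positivity
  have hs0 : (0 : ℝ) < s := lt_of_lt_of_le (by positivity) hs2
  have hs0' : 0 < s := by exact_mod_cast hs0
  set l := ((c : ℝ) + 1) * L with hl
  have hl0 : 0 ≤ l := by positivity
  -- `ε` is at least `(c + 20) r`, and `r ≥ 1 / 8` since `s` is small and `ns A ≥ 1`
  set r := Real.sqrt (ns A * L / s) with hr
  have hr0 : 0 ≤ r := Real.sqrt_nonneg _
  have hr2 : r ^ 2 = ns A * L / s := Real.sq_sqrt (by positivity)
  have hεr : ((c : ℝ) + 20) * r ≤ ε := by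
    refine le_of_sq_le_sq ?_ hε.le
    rw [mul_pow, hr2]
    calc ((c : ℝ) + 20) ^ 2 * (ns A * L / s)
        = ((c : ℝ) + 20) ^ 2 * (ε⁻¹ ^ 2 * ns A * L) * (ε ^ 2 / s) := by field_simp
      _ ≤ s * (ε ^ 2 / s) := by gcongr
      _ = ε ^ 2 := by field_simp
  have hr8 : 1 ≤ 8 * r := by
    refine le_of_sq_le_sq ?_ (by positivity)
    rw [mul_pow, hr2, one_pow]
    have : 1 ≤ L / s * 64 := by
      rw [div_mul_eq_mul_div, le_div_iff₀ hs0]; linarith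
    calc (1 : ℝ) ≤ L / s * 64 := this
      _ = 1 * (L / s * 64) := (one_mul _).symm
      _ ≤ ns A * (L / s * 64) := by gcongr
      _ = _ := by ring
  set ρ := N * (((c : ℝ) + 12) * r) with hρ
  have hrpos : 0 < r := by linarith
  have hρpos : 0 < ρ := by positivity
  have hρs : ns A * N ^ 2 * (2 * s + l) ≤ ρ ^ 2 * s := by
    have e1 : ρ ^ 2 * s = ns A * N ^ 2 * (((c : ℝ) + 12) ^ 2 * L) := by
      rw [hρ, mul_pow, mul_pow, hr2]; field_simp
    rw [e1]
    refine mul_le_mul_of_nonneg_left ?_ hT.le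
    have hc : (0 : ℝ) ≤ c := Nat.cast_nonneg c
    have : ((c : ℝ) + 12) ^ 2 * L = (c ^ 2 + 24 * c + 144) * L := by ring
    rw [this, hl]
    nlinarith [mul_nonneg hc hL.le, mul_nonneg (mul_nonneg hc hc) hL.le]
  have hsub : {f | ε * N < specNorm (Matrix.of (assembleIndex A s ∅ f) - A)}
      ⊆ ⋃ j : Fin n, {f : Fin m × Fin s → Fin n | ns A * N ^ 2 * (2 * s + l)
        < ∑ it, (if f it = j then (∑ l, |A it.1 l|) ^ 2 else 0)} := by
    intro f hf
    rw [Set.mem_iUnion]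
    by_contra! hcon
    have h1 := specNorm_assembleIndex_le A hs0' f hρpos fun j =>
      (not_lt.1 (hcon j)).trans hρs
    have h3 := specNorm_sub_le (Matrix.of (assembleIndex A s ∅ f)) A
    refine absurd hf (not_lt.2 (h3.trans ?_))
    calc _ ≤ ρ + N := add_le_add h1 le_rfl
      _ = (((c : ℝ) + 12) * r + 1) * N := by rw [hρ]; ring
      _ ≤ ε * N := by gcongr; linarith
  refine (measure_mono hsub).trans ((measure_iUnion_le _).trans ?_)
  rw [tsum_fintype]
  refine (Finset.sum_le_sum fun j _ => measure_column_load_le A s hT (row_l1_sq_le A) j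
    (sum_l1_mul_abs_le A j)).trans ?_
  rw [← ENNReal.ofReal_sum_of_nonneg fun _ _ => (Real.exp_pos _).le]
  refine ENNReal.ofReal_le_ofReal ?_
  simp only [Finset.sum_const, Finset.card_univ, Fintype.card_fin, nsmul_eq_mul]
  have hpos : (0 : ℝ) < (m : ℝ) + n := by linarith
  have hexp : ∀ k : ℕ, ((m : ℝ) + n) ^ k = Real.exp (k * L) := fun k => by
    rw [Real.exp_nat_mul, hLdef, Real.exp_log hpos]
  have e1 : (m : ℝ) + n = Real.exp L := (Real.exp_log hpos).symm
  calc (n : ℝ) * Real.exp (-l) ≤ Real.exp L * Real.exp (-l) := by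
        gcongr
        rw [← e1]
        have : (0 : ℝ) ≤ m := Nat.cast_nonneg m
        linarith
    _ = 1 / ((m : ℝ) + n) ^ c := by
        rw [hexp, one_div, ← Real.exp_neg, ← Real.exp_add, hl]; congr 1; ring

lemma rowSampling_ae_of_forall [NeZero n] (A : Matrix (Fin m) (Fin n) ℝ) (s : ℕ)
    (keep : Set (Fin m)) {p : (Fin m → Fin n → ℝ) → Prop}
    (h : ∀ f, p (assembleIndex A s keep f)) : ∀ᵐ B ∂(rowSampling A s keep), p B := by
  rw [ae_iff, rowSampling_eq_map]
  refine le_antisymm ((map_apply_le_of_finite _ _ _).trans (le_of_eq ?_)) zero_le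
  have : assembleIndex A s keep ⁻¹' {B | ¬ p B} = ∅ := by
    ext f; simp [h f]
  rw [this, measure_empty]

lemma assembleIndex_zero (s : ℕ) (keep : Set (Fin m)) (f : Fin m × Fin s → Fin n) :
    assembleIndex (0 : Matrix (Fin m) (Fin n) ℝ) s keep f = 0 := by
  ext i j
  simp [assembleIndex, assemble, drawValue, drawCoeff]

lemma rowSampling_zero_failure (s : ℕ) (keep : Set (Fin m)) [NeZero n] (ε : ℝ) :
    rowSampling (0 : Matrix (Fin m) (Fin n) ℝ) s keep {B | ¬ IsSparsifier ε 0 B} = 0 := by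
  refine ae_iff.1 (rowSampling_ae_of_forall 0 s keep fun f => ?_)
  rw [assembleIndex_zero]
  refine ⟨⟨0, by simp⟩, ?_⟩
  change specNorm ((0 : Matrix (Fin m) (Fin n) ℝ) - 0) ≤ _
  rw [sub_zero, specNorm_zero, mul_zero]

/-- Sampling every row often enough yields a sparsifier with high probability. -/
theorem rowSampling_all (c : ℕ) (A : Matrix (Fin m) (Fin n) ℝ) {ε : ℝ} (hε : 0 < ε) (s : ℕ)
    (hs : ((c : ℝ) + 20) ^ 2 * (ε⁻¹ ^ 2 * ns A * Real.log ((m : ℝ) + n)) ≤ s) :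
    (∀ᵐ B ∂(rowSampling A s ∅), ∀ i, rowNnz B i ≤ s) ∧
      rowSampling A s ∅ {B | ¬ IsSparsifier ε A B} ≤ ENNReal.ofReal (1 / ((m : ℝ) + n) ^ c) := by
  by_cases hn : n = 0
  · subst hn
    refine ⟨Filter.Eventually.of_forall fun B i => ?_, ?_⟩
    · simp [rowNnz, Set.eq_empty_of_isEmpty]
    · rw [not_isSparsifier_eq_empty (Or.inr rfl), measure_empty]
      exact zero_le
  have : NeZero n := ⟨hn⟩
  refine ⟨rowSampling_ae_of_forall A s ∅ fun f i =>
    rowNnz_assembleIndex_le A s ∅ f (Set.notMem_empty i), ?_⟩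
  by_cases hm : m = 0
  · rw [not_isSparsifier_eq_empty (Or.inl hm), measure_empty]
    exact zero_le
  have : NeZero m := ⟨hm⟩
  by_cases hA : A = 0
  · subst hA
    rw [rowSampling_zero_failure]
    exact zero_le
  rcases le_or_gt (64 * Real.log ((m : ℝ) + n)) s with h | h
  · exact rowSampling_failure_le_of_many hA hε c s ∅ h hs
  · exact rowSampling_failure_le_of_few hA hε c s h hs

end Tail
end RowSampling

/-! ### Reasoning about programs -/

namespace RowSampling

section ProgramLogic

/-- Programs without loops. -/
def Prog.LoopFree : Prog → Prop
  | .seq P Q => P.LoopFree ∧ Q.LoopFree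
  | .cond _ P Q => P.LoopFree ∧ Q.LoopFree
  | .loop _ _ => False
  | _ => True

/-- Programs without random draws. -/
def Prog.NoDraw : Prog → Prop
  | .seq P Q => P.NoDraw ∧ Q.NoDraw
  | .cond _ P Q => P.NoDraw ∧ Q.NoDraw
  | .loop _ P => P.NoDraw
  | .drawReal _ => False
  | .drawNat _ _ => False
  | _ => True

/-- Programs that do not write the natural number register `r`. -/
def Prog.KeepsNReg (r : ℕ) : Prog → Prop
  | .nset r' _ => r' ≠ r
  | .drawNat r' _ => r' ≠ r
  | .seq P Q => P.KeepsNReg r ∧ Q.KeepsNReg r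
  | .cond _ P Q => P.KeepsNReg r ∧ Q.KeepsNReg r
  | .loop _ P => P.KeepsNReg r
  | _ => True

/-- Programs that do not write the real register `r`. -/
def Prog.KeepsRReg (r : ℕ) : Prog → Prop
  | .rset r' _ => r' ≠ r
  | .drawReal r' => r' ≠ r
  | .seq P Q => P.KeepsRReg r ∧ Q.KeepsRReg r
  | .cond _ P Q => P.KeepsRReg r ∧ Q.KeepsRReg r
  | .loop _ P => P.KeepsRReg r
  | _ => True

/-- Programs that do not write the natural number array `a`. -/
def Prog.KeepsNArr (a : ℕ) : Prog → Prop
  | .nstore a' _ _ => a' ≠ a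
  | .seq P Q => P.KeepsNArr a ∧ Q.KeepsNArr a
  | .cond _ P Q => P.KeepsNArr a ∧ Q.KeepsNArr a
  | .loop _ P => P.KeepsNArr a
  | _ => True

/-- Programs that do not write the real array `a`. -/
def Prog.KeepsRArr (a : ℕ) : Prog → Prop
  | .rstore a' _ _ => a' ≠ a
  | .seq P Q => P.KeepsRArr a ∧ Q.KeepsRArr a
  | .cond _ P Q => P.KeepsRArr a ∧ Q.KeepsRArr a
  | .loop _ P => P.KeepsRArr a
  | _ => True

/-- `τ` agrees with `σ` on every register and array that `P` does not write. -/
structure Frame (P : Prog) (σ τ : State) : Prop where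
  nreg : ∀ r, P.KeepsNReg r → τ.nreg r = σ.nreg r
  rreg : ∀ r, P.KeepsRReg r → τ.rreg r = σ.rreg r
  narr : ∀ a, P.KeepsNArr a → τ.narr a = σ.narr a
  rarr : ∀ a, P.KeepsRArr a → τ.rarr a = σ.rarr a
  pos : P.NoDraw → τ.pos = σ.pos

lemma Frame.refl (P : Prog) (σ : State) : Frame P σ σ :=
  ⟨fun _ _ => rfl, fun _ _ => rfl, fun _ _ => rfl, fun _ _ => rfl, fun _ => rfl⟩

lemma Frame.trans {P : Prog} {σ τ υ : State} (h1 : Frame P σ τ) (h2 : Frame P τ υ) :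
    Frame P σ υ :=
  ⟨fun r h => (h2.nreg r h).trans (h1.nreg r h), fun r h => (h2.rreg r h).trans (h1.rreg r h),
    fun r h => (h2.narr r h).trans (h1.narr r h), fun r h => (h2.rarr r h).trans (h1.rarr r h),
    fun h => (h2.pos h).trans (h1.pos h)⟩

lemma Frame.mono {P Q : Prog} {σ τ : State} (h : Frame P σ τ)
    (hn : ∀ r, Q.KeepsNReg r → P.KeepsNReg r) (hr : ∀ r, Q.KeepsRReg r → P.KeepsRReg r)
    (hna : ∀ r, Q.KeepsNArr r → P.KeepsNArr r) (hra : ∀ r, Q.KeepsRArr r → P.KeepsRArr r)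
    (hd : Q.NoDraw → P.NoDraw) : Frame Q σ τ :=
  ⟨fun r k => h.nreg r (hn r k), fun r k => h.rreg r (hr r k), fun r k => h.narr r (hna r k),
    fun r k => h.rarr r (hra r k), fun k => h.pos (hd k)⟩

theorem Run.frame {ω : Tape} {P : Prog} {σ τ : State} {t : ℕ} (h : Run ω P σ t τ) :
    Frame P σ τ := by
  induction h with
  | skip σ => exact Frame.refl _ _
  | nset σ r e =>
    exact ⟨fun r' h => Function.update_of_ne (Ne.symm h) _ _, fun _ _ => rfl, fun _ _ => rfl,
      fun _ _ => rfl, fun _ => rfl⟩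
  | rset σ r e =>
    exact ⟨fun _ _ => rfl, fun r' h => Function.update_of_ne (Ne.symm h) _ _, fun _ _ => rfl,
      fun _ _ => rfl, fun _ => rfl⟩
  | nstore σ a i e =>
    exact ⟨fun _ _ => rfl, fun _ _ => rfl, fun r' h => Function.update_of_ne (Ne.symm h) _ _,
      fun _ _ => rfl, fun _ => rfl⟩
  | rstore σ a i e =>
    exact ⟨fun _ _ => rfl, fun _ _ => rfl, fun _ _ => rfl,
      fun r' h => Function.update_of_ne (Ne.symm h) _ _, fun _ => rfl⟩
  | drawReal σ r =>
    exact ⟨fun _ _ => rfl, fun r' h => Function.update_of_ne (Ne.symm h) _ _, fun _ _ => rfl,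
      fun _ _ => rfl, fun h => h.elim⟩
  | drawNat σ r e =>
    exact ⟨fun r' h => Function.update_of_ne (Ne.symm h) _ _, fun _ _ => rfl, fun _ _ => rfl,
      fun _ _ => rfl, fun h => h.elim⟩
  | @seq P Q σ σ₁ σ₂ _ _ _ _ ih1 ih2 =>
    have a : Frame (.seq P Q) σ σ₁ := ih1.mono (fun _ h => h.1) (fun _ h => h.1) (fun _ h => h.1)
      (fun _ h => h.1) (fun h => h.1)
    have b : Frame (.seq P Q) σ₁ σ₂ := ih2.mono (fun _ h => h.2) (fun _ h => h.2)
      (fun _ h => h.2) (fun _ h => h.2) (fun h => h.2)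
    exact a.trans b
  | condTrue _ _ ih =>
    exact ih.mono (fun _ h => h.1) (fun _ h => h.1) (fun _ h => h.1) (fun _ h => h.1) (fun h => h.1)
  | condFalse _ _ ih =>
    exact ih.mono (fun _ h => h.2) (fun _ h => h.2) (fun _ h => h.2) (fun _ h => h.2) (fun h => h.2)
  | loopStop _ => exact Frame.refl _ _
  | @loopStep b P σ σ₁ σ₂ _ _ _ _ _ ih1 ih2 =>
    have a : Frame (.loop b P) σ σ₁ := ih1.mono (fun _ h => h) (fun _ h => h) (fun _ h => h)
      (fun _ h => h) (fun h => h)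
    exact a.trans ih2

/-- A run without random draws does not depend on the tape. -/
theorem Run.congr_tape {ω : Tape} {P : Prog} {σ τ : State} {t : ℕ} (h : Run ω P σ t τ)
    (hP : P.NoDraw) (ω' : Tape) : Run ω' P σ t τ := by
  induction h with
  | skip σ => exact .skip σ
  | nset σ r e => exact .nset σ r e
  | rset σ r e => exact .rset σ r e
  | nstore σ a i e => exact .nstore σ a i e
  | rstore σ a i e => exact .rstore σ a i e
  | drawReal σ r => exact hP.elim
  | drawNat σ r e => exact hP.elim
  | seq _ _ ih1 ih2 => exact .seq (ih1 hP.1) (ih2 hP.2)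
  | condTrue hb _ ih => exact .condTrue hb (ih hP.1)
  | condFalse hb _ ih => exact .condFalse hb (ih hP.2)
  | loopStop hb => exact .loopStop hb
  | loopStep hb _ _ ih1 ih2 => exact .loopStep hb (ih1 hP) (ih2 hP)

/-- The final state of a loop-free program. -/
noncomputable def Prog.exec (ω : Tape) : Prog → State → State
  | .skip, σ => σ
  | .nset r e, σ => { σ with nreg := Function.update σ.nreg r (e.eval σ) }
  | .rset r e, σ => { σ with rreg := Function.update σ.rreg r (e.eval σ) }
  | .nstore a i e, σ =>
    { σ with narr := Function.update σ.narr a (Function.update (σ.narr a) (i.eval σ) (e.eval σ)) }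
  | .rstore a i e, σ =>
    { σ with rarr := Function.update σ.rarr a (Function.update (σ.rarr a) (i.eval σ) (e.eval σ)) }
  | .drawReal r, σ =>
    { σ with rreg := Function.update σ.rreg r (ω σ.pos : ℝ), pos := σ.pos + 1 }
  | .drawNat r e, σ =>
    { σ with nreg := Function.update σ.nreg r (pickNat (ω σ.pos) (e.eval σ)), pos := σ.pos + 1 }
  | .seq P Q, σ => Q.exec ω (P.exec ω σ)
  | .cond b P Q, σ => open Classical in if b.Holds σ then P.exec ω σ else Q.exec ω σ
  | .loop _ _, σ => σ

/-- A bound for the number of steps of a loop-free program. -/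
def Prog.steps : Prog → ℕ
  | .skip => 1
  | .nset _ e => e.cost + 1
  | .rset _ e => e.cost + 1
  | .nstore _ i e => i.cost + e.cost + 1
  | .rstore _ i e => i.cost + e.cost + 1
  | .drawReal _ => 1
  | .drawNat _ e => e.cost + 1
  | .seq P Q => P.steps + Q.steps
  | .cond b P Q => b.cost + 1 + (P.steps + Q.steps)
  | .loop _ _ => 0

theorem run_exec (ω : Tape) (P : Prog) (hP : P.LoopFree) (σ : State) :
    ∃ t, t ≤ P.steps ∧ Run ω P σ t (P.exec ω σ) := by
  induction P generalizing σ with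
  | skip => exact ⟨_, le_rfl, .skip σ⟩
  | nset r e => exact ⟨_, le_rfl, .nset σ r e⟩
  | rset r e => exact ⟨_, le_rfl, .rset σ r e⟩
  | nstore a i e => exact ⟨_, le_rfl, .nstore σ a i e⟩
  | rstore a i e => exact ⟨_, le_rfl, .rstore σ a i e⟩
  | drawReal r => exact ⟨_, le_rfl, .drawReal σ r⟩
  | drawNat r e => exact ⟨_, le_rfl, .drawNat σ r e⟩
  | seq P Q ihP ihQ =>
    obtain ⟨t1, h1, r1⟩ := ihP hP.1 σ
    obtain ⟨t2, h2, r2⟩ := ihQ hP.2 (P.exec ω σ)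
    exact ⟨_, add_le_add h1 h2, .seq r1 r2⟩
  | cond b P Q ihP ihQ =>
    obtain ⟨t1, h1, r1⟩ := ihP hP.1 σ
    obtain ⟨t2, h2, r2⟩ := ihQ hP.2 σ
    simp only [Prog.steps, Prog.exec]
    by_cases hb : b.Holds σ
    · rw [if_pos hb]
      exact ⟨_, by omega, .condTrue hb r1⟩
    · rw [if_neg hb]
      exact ⟨_, by omega, .condFalse hb r2⟩
  | loop b P => exact hP.elim

/-- `for p = 0, …, N - 1 do body`; the register `4` holds `p` and the register `2` holds `N`. -/
def forLoop (body : Prog) : Prog :=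
  .seq (.nset 4 (.const 0))
    (.loop (.nlt (.reg 4) (.reg 2)) (.seq body (.nset 4 (.add (.reg 4) (.const 1)))))

/-- The invariant rule for `forLoop` with a loop-free body, with its running time. -/
theorem run_forLoop (ω : Tape) {body : Prog} (hLF : body.LoopFree) (h4 : body.KeepsNReg 4)
    (h2 : body.KeepsNReg 2) (Inv : ℕ → State → Prop) {N : ℕ} {σ : State} (hN : σ.nreg 2 = N)
    (hreg : ∀ k τ x, Inv k τ → Inv k { τ with nreg := Function.update τ.nreg 4 x })
    (h0 : Inv 0 σ)
    (hstep : ∀ k < N, ∀ τ, τ.nreg 4 = k → Frame (forLoop body) σ τ → Inv k τ →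
      Inv (k + 1) (body.exec ω τ)) :
    ∃ t τ, Run ω (forLoop body) σ t τ ∧ t ≤ (body.steps + 10) * (N + 1) ∧
      Frame (forLoop body) σ τ ∧ Inv N τ := by
  have h2' : (forLoop body).KeepsNReg 2 := by simp [forLoop, Prog.KeepsNReg, h2]
  have key : ∀ d k τ, k + d = N → τ.nreg 4 = k → Frame (forLoop body) σ τ → Inv k τ →
      ∃ t τ', Run ω (.loop (.nlt (.reg 4) (.reg 2))
        (.seq body (.nset 4 (.add (.reg 4) (.const 1))))) τ t τ' ∧
        t ≤ (body.steps + 8) * d + 4 ∧ Inv N τ' := by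
    intro d
    induction d with
    | zero =>
      intro k τ hk hk4 hF hI
      refine ⟨_, τ, .loopStop ?_, ?_, ?_⟩
      · have := hF.nreg 2 h2'
        simp only [Test.Holds, NExpr.eval]
        omega
      · simp [Test.cost, NExpr.cost]
      · rwa [← hk, add_zero]
    | succ d ih =>
      intro k τ hk hk4 hF hI
      obtain ⟨t1, ht1, r1⟩ := run_exec ω body hLF τ
      set τ1 := body.exec ω τ with hτ1
      have r2 : Run ω (.nset 4 (.add (.reg 4) (.const 1))) τ1 _ _ := .nset τ1 4 _
      have e4 : τ1.nreg 4 = k := (r1.frame.nreg 4 h4).trans hk4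
      have rs := Run.seq r1 r2
      have hfr : Frame (forLoop body) τ _ := rs.frame.mono (fun r h => h.2)
        (fun r h => h.2) (fun r h => h.2) (fun r h => h.2) (fun h => h.2)
      have hI' := hreg (k + 1) τ1 ((NExpr.add (.reg 4) (.const 1)).eval τ1)
        (hstep k (by omega) τ hk4 hF hI)
      obtain ⟨t', τ', hr, ht, hN'⟩ := ih (k + 1) _ (by omega)
        (by simp [NExpr.eval, e4]) (hF.trans hfr) hI'
      refine ⟨_, τ', .loopStep ?_ rs hr, ?_, hN'⟩
      · have := hF.nreg 2 h2'
        simp only [Test.Holds, NExpr.eval]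
        omega
      · simp only [Test.cost, NExpr.cost]
        nlinarith
  have r0 : Run ω (.nset 4 (.const 0)) σ _ _ := .nset σ 4 (.const 0)
  have hF0 : Frame (forLoop body) σ _ := r0.frame.mono (fun r h => h.1) (fun r h => h.1)
    (fun r h => h.1) (fun r h => h.1) (fun h => h.1)
  obtain ⟨t, τ, hr, ht, hI⟩ := key N 0 _ (zero_add N) (by simp [NExpr.eval]) hF0
    (hreg 0 σ _ h0)
  have hrun := Run.seq r0 hr
  refine ⟨_, τ, hrun, ?_, hrun.frame, hI⟩
  simp only [NExpr.cost]
  nlinarith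

/-- `acc key f k i` is the sum of `f q` over the positions `q < k` with `key q = i`. -/
def acc {M : Type*} [AddCommMonoid M] (key : ℕ → ℕ) (f : ℕ → M) (k i : ℕ) : M :=
  ∑ q ∈ Finset.range k, if key q = i then f q else 0

lemma acc_zero {M : Type*} [AddCommMonoid M] (key : ℕ → ℕ) (f : ℕ → M) : acc key f 0 = 0 := by
  funext i; simp [acc]

lemma acc_succ {M : Type*} [AddCommMonoid M] (key : ℕ → ℕ) (f : ℕ → M) (k : ℕ) :
    acc key f (k + 1) = Function.update (acc key f k) (key k) (acc key f k (key k) + f k) := by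
  funext i
  by_cases h : i = key k
  · subst h; simp [acc, Finset.sum_range_succ]
  · rw [Function.update_of_ne h]; simp [acc, Finset.sum_range_succ, Ne.symm h]

end ProgramLogic
end RowSampling

/-! ### The program -/

namespace RowSampling

section TheProgram

/-- Sequential composition. -/
def block : List Prog → Prog
  | [] => .skip
  | P :: Ps => .seq P (block Ps)

/-- The row of the current entry. -/
def rowE : NExpr := .cell 0 (.reg 4)

/-- The column of the current entry. -/
def colE : NExpr := .cell 1 (.reg 4)

/-- Compute the absolute values of the entries, the `ℓ₁` norms and squared `ℓ₂` norms of the rows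
and columns, and the number of entries and the first position of every row. -/
def scanBody : Prog := block [
  .rset 4 (.cell 0 (.reg 4)),
  .cond (.rlt (.reg 4) (.ofNat (.const 0))) (.rset 4 (.sub (.ofNat (.const 0)) (.reg 4))) .skip,
  .rstore 6 (.reg 4) (.reg 4),
  .rstore 7 (.reg 4) (.reg 4),
  .rstore 2 rowE (.add (.cell 2 rowE) (.reg 4)),
  .rstore 3 rowE (.add (.cell 3 rowE) (.mul (.reg 4) (.reg 4))),
  .rstore 4 colE (.add (.cell 4 colE) (.reg 4)),
  .rstore 5 colE (.add (.cell 5 colE) (.mul (.reg 4) (.reg 4))),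
  .cond (.nlt (.const 0) (.cell 4 rowE)) .skip (.nstore 5 rowE (.reg 4)),
  .nstore 4 rowE (.add (.cell 4 rowE) (.const 1))]

/-- Update the maximum of the numerical sparsities of the rows and columns. -/
def maxBody : Prog := block [
  .rset 5 (.div (.mul (.cell 2 rowE) (.cell 2 rowE)) (.cell 3 rowE)),
  .cond (.rlt (.reg 1) (.reg 5)) (.rset 1 (.reg 5)) .skip,
  .rset 5 (.div (.mul (.cell 4 colE) (.cell 4 colE)) (.cell 5 colE)),
  .cond (.rlt (.reg 1) (.reg 5)) (.rset 1 (.reg 5)) .skip]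

/-- Double the register `6` and count in the register `5`, until `m + n` is reached. -/
def logBody : Prog :=
  .cond (.nlt (.reg 6) (.add (.reg 0) (.reg 1)))
    (.seq (.nset 6 (.add (.reg 6) (.reg 6))) (.nset 5 (.add (.reg 5) (.const 1)))) .skip

/-- Count in the register `7` until the real register `2` is reached. -/
def ceilBody : Prog :=
  .cond (.rlt (.ofNat (.reg 7)) (.reg 2)) (.nset 7 (.add (.reg 7) (.const 1))) .skip

/-- Partition the entries of every row into those below and those above the average. -/
def partBody : Prog :=
  .cond (.rlt (.mul (.cell 6 (.reg 4)) (.ofNat (.cell 4 rowE))) (.cell 2 rowE))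
    (block [
      .nstore 8 (.add (.cell 5 rowE) (.cell 6 rowE)) (.reg 4),
      .nstore 6 rowE (.add (.cell 6 rowE) (.const 1))])
    (block [
      .nstore 7 rowE (.add (.cell 7 rowE) (.const 1)),
      .nstore 8 (.sub (.add (.cell 5 rowE) (.cell 4 rowE)) (.cell 7 rowE)) (.reg 4)])

/-- The average absolute value of the entries of the current row. -/
def avgE : RExpr := .div (.cell 2 rowE) (.ofNat (.cell 4 rowE))

/-- One step of the alias method: the entry in the register `8` is completed to a full cell by a
part of the first entry above the average. -/
def aliasBody : Prog := block [
  .nset 8 (.cell 8 (.reg 4)),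
  .cond (.nlt (.reg 4) (.add (.cell 5 rowE) (.cell 6 rowE)))
    (block [
      .nset 9 (.cell 8 (.add (.cell 5 rowE) (.cell 6 rowE))),
      .nstore 9 (.reg 8) (.reg 9),
      .rstore 6 (.reg 9) (.sub (.cell 6 (.reg 9)) (.sub avgE (.cell 6 (.reg 8)))),
      .cond (.rlt (.cell 6 (.reg 9)) avgE) (.nstore 6 rowE (.add (.cell 6 rowE) (.const 1))) .skip])
    (block [
      .nstore 9 (.reg 8) (.reg 8),
      .nstore 6 rowE (.add (.cell 6 rowE) (.const 1))])]

/-- Draw a sample of the current row and count it for the entry that it picks, provided that the row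
has more than `s` entries and that the current entry is among its first `s` ones. The two random
draws are made in any case. -/
def sampleBody : Prog := block [
  .drawNat 8 (.cell 4 rowE),
  .drawReal 3,
  .cond (.and (.nlt (.reg 7) (.cell 4 rowE)) (.nlt (.sub (.reg 4) (.cell 5 rowE)) (.reg 7)))
    (block [
      .nset 8 (.add (.cell 5 rowE) (.reg 8)),
      .cond (.rlt (.mul (.reg 3) avgE) (.cell 6 (.reg 8))) .skip (.nset 8 (.cell 9 (.reg 8))),
      .nstore 10 (.reg 8) (.add (.cell 10 (.reg 8)) (.const 1))])
    .skip]

/-- Append the current position with the given value to the output. -/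
def emit (e : RExpr) : Prog := block [
  .nstore 2 (.reg 3) rowE,
  .nstore 3 (.reg 3) colE,
  .rstore 1 (.reg 3) e,
  .nset 3 (.add (.reg 3) (.const 1))]

/-- Output the current entry: unchanged in a row with at most `s` entries, and otherwise rescaled
by its number of samples. -/
def outputBody : Prog :=
  .cond (.nlt (.reg 7) (.cell 4 rowE))
    (.cond (.nlt (.const 0) (.cell 10 (.reg 4)))
      (emit (.mul (.div (.ofNat (.const 1)) (.ofNat (.reg 7)))
        (.mul (.ofNat (.cell 10 (.reg 4)))
          (.div (.cell 0 (.reg 4)) (.div (.cell 7 (.reg 4)) (.cell 2 rowE))))))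
      .skip)
    (emit (.cell 0 (.reg 4)))

/-- The deterministic part of the algorithm: the number of samples and the alias tables. -/
def prepare (C : ℕ) : Prog := block [
  forLoop scanBody,
  forLoop maxBody,
  .nset 6 (.const 1),
  forLoop logBody,
  .cond (.rlt (.reg 0) (.ofNat (.const 1)))
    (.rset 2 (.mul (.ofNat (.const C))
      (.div (.mul (.reg 1) (.ofNat (.reg 5))) (.mul (.reg 0) (.reg 0)))))
    .skip,
  forLoop ceilBody,
  forLoop partBody,
  forLoop aliasBody]

/-- The algorithm, with the constant `C` in the number of samples. It uses

* the natural number registers `0`, `1`, `2` for `m`, `n` and the number of entries, `3` for the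
  number of output entries, `4` for the loop index, `5` for the logarithm, `6` for a power of `2`,
  `7` for the number of samples, and `8`, `9` for temporary values;
* the natural number arrays `0`, `1` for the input positions, `2`, `3` for the output positions, `4`
  and `5` for the size and the first position of every row, `6` and `7` for the numbers of small and
  large entries of every row, `8` for the partitioned entries, `9` for the partners in the alias
  table, and `10` for the numbers of samples that picked the entries;
* the real registers `0` for `ε`, `1` for the numerical sparsity, `2` for the number of samples
  before rounding, and `3`, `4`, `5` for temporary values;
* the real arrays `0` and `1` for the input and output values, `2`, `3` and `4`, `5` for the `ℓ₁`
  norms and squared `ℓ₂` norms of the rows and the columns, `6` for the residual weights in the alias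
  table, and `7` for the absolute values of the entries. -/
def sparsify (C : ℕ) : Prog :=
  .seq (prepare C) (.seq (forLoop sampleBody) (forLoop outputBody))

end TheProgram

end RowSampling

/-! ### Norms, sizes and positions of the rows -/

namespace RowSampling

section Scan

/-- The number of positions below `N` whose row is smaller than `i`: for sorted rows, this is the
first position of the row `i`. -/
def rowStart (row : ℕ → ℕ) (N i : ℕ) : ℕ := {q ∈ Finset.range N | row q < i}.card

/-- The number of entries of the row `i`. -/
def rowSize (row : ℕ → ℕ) (N i : ℕ) : ℕ := {q ∈ Finset.range N | row q = i}.card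

lemma acc_one (row : ℕ → ℕ) (N i : ℕ) : acc row (fun _ => 1) N i = rowSize row N i := by
  simp [acc, rowSize]

/-- Rows are listed in increasing order. -/
def SortedRows (row : ℕ → ℕ) (N : ℕ) : Prop := ∀ p q, p ≤ q → q < N → row p ≤ row q

lemma lt_rowStart_iff {row : ℕ → ℕ} {N : ℕ} (h : SortedRows row N) {q i : ℕ} (hq : q < N) :
    q < rowStart row N i ↔ row q < i := by
  constructor
  · intro hlt
    by_contra hn
    have : {p ∈ Finset.range N | row p < i} ⊆ Finset.range q := by
      intro p hp
      simp only [Finset.mem_filter, Finset.mem_range] at hp ⊢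
      by_contra hpq
      have := h q p (not_lt.1 hpq) hp.1
      omega
    have := Finset.card_le_card this
    rw [Finset.card_range] at this
    exact absurd hlt (not_lt.2 this)
  · intro hlt
    have : Finset.range (q + 1) ⊆ {p ∈ Finset.range N | row p < i} := by
      intro p hp
      simp only [Finset.mem_filter, Finset.mem_range] at hp ⊢
      exact ⟨by omega, (h p q (by omega) hq).trans_lt hlt⟩
    have := Finset.card_le_card this
    rw [Finset.card_range] at this
    exact this

lemma rowStart_add_rowSize (row : ℕ → ℕ) (N i : ℕ) :
    rowStart row N i + rowSize row N i = rowStart row N (i + 1) := by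
  rw [rowStart, rowSize, rowStart, ← Finset.card_union_of_disjoint]
  · congr 1
    ext q
    simp only [Finset.mem_union, Finset.mem_filter]
    constructor
    · rintro (h | h) <;> exact ⟨h.1, by omega⟩
    · rintro ⟨h1, h2⟩
      rcases Nat.lt_succ_iff_lt_or_eq.1 h2 with h | h
      · exact Or.inl ⟨h1, h⟩
      · exact Or.inr ⟨h1, h⟩
  · rw [Finset.disjoint_filter]
    intro q _ h1 h2
    omega

lemma rowStart_add_rowSize_le (row : ℕ → ℕ) (N i : ℕ) :
    rowStart row N i + rowSize row N i ≤ N := by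
  rw [rowStart_add_rowSize]
  exact (Finset.card_filter_le _ _).trans (by simp)

/-- The positions of the row `i` form an interval. -/
lemma row_eq_iff {row : ℕ → ℕ} {N : ℕ} (h : SortedRows row N) {q i : ℕ} (hq : q < N) :
    row q = i ↔ rowStart row N i ≤ q ∧ q < rowStart row N i + rowSize row N i := by
  rw [rowStart_add_rowSize, lt_rowStart_iff h hq, ← not_lt, lt_rowStart_iff h hq]
  omega

/-- The position at which a row is met first is the start of the row. -/
lemma rowStart_eq_of_first {row : ℕ → ℕ} {N : ℕ} (h : SortedRows row N) {k : ℕ} (hk : k < N)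
    (hfirst : ∀ q < k, row q ≠ row k) : rowStart row N (row k) = k := by
  refine le_antisymm ?_ ?_
  · exact ((row_eq_iff h hk).1 rfl).1
  · rcases Nat.eq_zero_or_pos k with h0 | h0
    · omega
    · have := (lt_rowStart_iff h (q := k - 1) (i := row k) (by omega)).2
        (lt_of_le_of_ne (h _ _ (by omega) hk) (hfirst _ (by omega)))
      omega

lemma scan_exec (ω : Tape) (τ : State) {k r c : ℕ} {a : ℝ} (hk : τ.nreg 4 = k)
    (hr : τ.narr 0 k = r) (hc : τ.narr 1 k = c) (ha : |τ.rarr 0 k| = a) :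
    (scanBody.exec ω τ).rarr 6 = Function.update (τ.rarr 6) k a ∧
    (scanBody.exec ω τ).rarr 7 = Function.update (τ.rarr 7) k a ∧
    (scanBody.exec ω τ).rarr 2 = Function.update (τ.rarr 2) r (τ.rarr 2 r + a) ∧
    (scanBody.exec ω τ).rarr 3 = Function.update (τ.rarr 3) r (τ.rarr 3 r + a * a) ∧
    (scanBody.exec ω τ).rarr 4 = Function.update (τ.rarr 4) c (τ.rarr 4 c + a) ∧
    (scanBody.exec ω τ).rarr 5 = Function.update (τ.rarr 5) c (τ.rarr 5 c + a * a) ∧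
    (scanBody.exec ω τ).narr 5
      = (if 0 < τ.narr 4 r then τ.narr 5 else Function.update (τ.narr 5) r k) ∧
    (scanBody.exec ω τ).narr 4 = Function.update (τ.narr 4) r (τ.narr 4 r + 1) := by
  subst hk hr hc ha
  by_cases h : τ.rarr 0 (τ.nreg 4) < 0 <;>
  by_cases h2 : 0 < τ.narr 4 (τ.narr 0 (τ.nreg 4)) <;>
  simp [scanBody, block, Prog.exec, NExpr.eval, RExpr.eval, Test.Holds, rowE, colE, h, h2,
    abs_of_neg, abs_of_nonneg, not_lt.1]

/-- The memory after scanning the first `k` entries. -/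
structure Scanned (row col : ℕ → ℕ) (v : ℕ → ℝ) (N k : ℕ) (τ : State) : Prop where
  res : ∀ q < k, τ.rarr 6 q = |v q|
  abs : ∀ q < k, τ.rarr 7 q = |v q|
  rowL1 : τ.rarr 2 = acc row (fun q => |v q|) k
  rowL2 : τ.rarr 3 = acc row (fun q => |v q| * |v q|) k
  colL1 : τ.rarr 4 = acc col (fun q => |v q|) k
  colL2 : τ.rarr 5 = acc col (fun q => |v q| * |v q|) k
  size : τ.narr 4 = acc row (fun _ => 1) k
  start : ∀ q < k, τ.narr 5 (row q) = rowStart row N (row q)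

lemma run_scan (ω : Tape) {σ : State} {N : ℕ} (hN : σ.nreg 2 = N)
    (hsort : SortedRows (σ.narr 0) N) (hn : ∀ a, 2 ≤ a → σ.narr a = 0)
    (hr : ∀ a, 1 ≤ a → σ.rarr a = 0) :
    ∃ t τ, Run ω (forLoop scanBody) σ t τ ∧ t ≤ (scanBody.steps + 10) * (N + 1) ∧
      Frame (forLoop scanBody) σ τ ∧ Scanned (σ.narr 0) (σ.narr 1) (σ.rarr 0) N N τ := by
  refine run_forLoop ω (by simp [scanBody, block, Prog.LoopFree])
    (by simp [scanBody, block, Prog.KeepsNReg]) (by simp [scanBody, block, Prog.KeepsNReg])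
    (fun k τ => Scanned (σ.narr 0) (σ.narr 1) (σ.rarr 0) N k τ) hN ?_ ?_ ?_
  · intro k τ x h
    exact ⟨h.res, h.abs, h.rowL1, h.rowL2, h.colL1, h.colL2, h.size, h.start⟩
  · constructor <;> simp [hn, hr, acc_zero]
  · intro k hk τ h4 hF h
    have e0 : τ.narr 0 = σ.narr 0 := hF.narr 0 (by simp [forLoop, scanBody, block, Prog.KeepsNArr])
    have e1 : τ.narr 1 = σ.narr 1 := hF.narr 1 (by simp [forLoop, scanBody, block, Prog.KeepsNArr])
    have e2 : τ.rarr 0 = σ.rarr 0 := hF.rarr 0 (by simp [forLoop, scanBody, block, Prog.KeepsRArr])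
    obtain ⟨x1, x2, x3, x4, x5, x6, x7, x8⟩ := scan_exec ω τ (k := k) (r := σ.narr 0 k)
      (c := σ.narr 1 k) (a := |σ.rarr 0 k|) h4 (by rw [e0]) (by rw [e1]) (by rw [e2])
    have upd : ∀ (f : ℕ → ℝ), (∀ q < k, f q = |σ.rarr 0 q|) →
        ∀ q < k + 1, Function.update f k |σ.rarr 0 k| q = |σ.rarr 0 q| := by
      intro f hf q hq
      rcases Nat.lt_succ_iff_lt_or_eq.1 hq with h | h
      · rw [Function.update_of_ne (by omega), hf q h]
      · rw [h, Function.update_self]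
    refine ⟨?_, ?_, ?_, ?_, ?_, ?_, ?_, ?_⟩
    · rw [x1]; exact upd _ h.res
    · rw [x2]; exact upd _ h.abs
    · rw [x3, h.rowL1, acc_succ]
    · rw [x4, h.rowL2, acc_succ]
    · rw [x5, h.colL1, acc_succ]
    · rw [x6, h.colL2, acc_succ]
    · rw [x8, h.size, acc_succ]
    · rw [x7, h.size, acc_one]
      by_cases hpos : 0 < rowSize (σ.narr 0) k (σ.narr 0 k)
      · rw [if_pos hpos]
        obtain ⟨p, hp⟩ := Finset.card_pos.1 hpos
        simp only [Finset.mem_filter, Finset.mem_range] at hp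
        intro q hq
        rcases Nat.lt_succ_iff_lt_or_eq.1 hq with hq | hq
        · exact h.start q hq
        · rw [hq, ← hp.2]; exact h.start p hp.1
      · rw [if_neg hpos]
        have hfirst : ∀ q < k, σ.narr 0 q ≠ σ.narr 0 k := by
          intro q hq he
          exact hpos (Finset.card_pos.2 ⟨q, by simp [hq, he]⟩)
        intro q hq
        rcases Nat.lt_succ_iff_lt_or_eq.1 hq with hq | hq
        · rw [Function.update_of_ne (hfirst q hq)]; exact h.start q hq
        · rw [hq, Function.update_self, rowStart_eq_of_first hsort hk hfirst]

end Scan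
end RowSampling

/-! ### The number of samples -/

namespace RowSampling

section SampleSize

/-- The numerical sparsity of the row `i`, as computed from its norms in memory. -/
noncomputable def rowRatio (σ : State) (i : ℕ) : ℝ := σ.rarr 2 i * σ.rarr 2 i / σ.rarr 3 i

/-- The numerical sparsity of the column `j`, as computed from its norms in memory. -/
noncomputable def colRatio (σ : State) (j : ℕ) : ℝ := σ.rarr 4 j * σ.rarr 4 j / σ.rarr 5 j

lemma max_exec (ω : Tape) (τ : State) {k : ℕ} (hk : τ.nreg 4 = k) :
    (maxBody.exec ω τ).rreg 1
      = max (max (τ.rreg 1) (rowRatio τ (τ.narr 0 k))) (colRatio τ (τ.narr 1 k)) := by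
  subst hk
  by_cases h : τ.rreg 1 < rowRatio τ (τ.narr 0 (τ.nreg 4))
  · have hm := max_eq_right h.le
    unfold rowRatio at h hm
    by_cases h2 : rowRatio τ (τ.narr 0 (τ.nreg 4)) < colRatio τ (τ.narr 1 (τ.nreg 4))
    · have hm2 := max_eq_right h2.le
      unfold rowRatio colRatio at h2 hm2
      simp [maxBody, block, Prog.exec, NExpr.eval, RExpr.eval, Test.Holds, rowE, colE, h, h2,
        rowRatio, colRatio, hm, hm2]
    · have hm2 := max_eq_left (not_lt.1 h2)
      unfold rowRatio colRatio at h2 hm2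
      simp [maxBody, block, Prog.exec, NExpr.eval, RExpr.eval, Test.Holds, rowE, colE, h, h2,
        rowRatio, colRatio, hm, hm2]
  · have hm := max_eq_left (not_lt.1 h)
    unfold rowRatio at h hm
    by_cases h2 : τ.rreg 1 < colRatio τ (τ.narr 1 (τ.nreg 4))
    · have hm2 := max_eq_right h2.le
      unfold colRatio at h2 hm2
      simp [maxBody, block, Prog.exec, NExpr.eval, RExpr.eval, Test.Holds, rowE, colE, h, h2,
        rowRatio, colRatio, hm, hm2]
    · have hm2 := max_eq_left (not_lt.1 h2)
      unfold colRatio at h2 hm2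
      simp [maxBody, block, Prog.exec, NExpr.eval, RExpr.eval, Test.Holds, rowE, colE, h, h2,
        rowRatio, colRatio, hm, hm2]

/-- The real register `1` holds the maximal sparsity of the rows and columns of the first `k`
entries. -/
structure MaxRatio (σ : State) (k : ℕ) (M : ℝ) : Prop where
  nonneg : 0 ≤ M
  row_le : ∀ q < k, rowRatio σ (σ.narr 0 q) ≤ M
  col_le : ∀ q < k, colRatio σ (σ.narr 1 q) ≤ M
  le : ∀ B, 0 ≤ B → (∀ q < k, rowRatio σ (σ.narr 0 q) ≤ B) →
    (∀ q < k, colRatio σ (σ.narr 1 q) ≤ B) → M ≤ B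

lemma run_max (ω : Tape) {σ : State} {N : ℕ} (hN : σ.nreg 2 = N) (h1 : σ.rreg 1 = 0) :
    ∃ t τ, Run ω (forLoop maxBody) σ t τ ∧ t ≤ (maxBody.steps + 10) * (N + 1) ∧
      Frame (forLoop maxBody) σ τ ∧ MaxRatio σ N (τ.rreg 1) := by
  refine run_forLoop ω (by simp [maxBody, block, Prog.LoopFree])
    (by simp [maxBody, block, Prog.KeepsNReg]) (by simp [maxBody, block, Prog.KeepsNReg])
    (fun k τ => MaxRatio σ k (τ.rreg 1)) hN ?_ ?_ ?_
  · intro k τ x h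
    exact h
  · rw [h1]
    exact ⟨le_rfl, fun q h => absurd h (Nat.not_lt_zero q), fun q h => absurd h (Nat.not_lt_zero q),
      fun B hB _ _ => hB⟩
  · intro k hk τ h4 hF h
    have ea : ∀ a, τ.narr a = σ.narr a := fun a =>
      hF.narr a (by simp [forLoop, maxBody, block, Prog.KeepsNArr])
    have er : ∀ a, τ.rarr a = σ.rarr a := fun a =>
      hF.rarr a (by simp [forLoop, maxBody, block, Prog.KeepsRArr])
    have e1 : ∀ i, rowRatio τ i = rowRatio σ i := fun i => by rw [rowRatio, er, er]; rfl
    have e2 : ∀ i, colRatio τ i = colRatio σ i := fun i => by rw [colRatio, er, er]; rfl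
    simp only [max_exec ω τ h4, e1, e2, ea]
    refine ⟨?_, fun q hq => ?_, fun q hq => ?_, fun B hB hr hc => ?_⟩
    · exact le_max_of_le_left (le_max_of_le_left h.nonneg)
    · rcases Nat.lt_succ_iff_lt_or_eq.1 hq with hq | rfl
      · exact le_max_of_le_left (le_max_of_le_left (h.row_le q hq))
      · exact le_max_of_le_left (le_max_right _ _)
    · rcases Nat.lt_succ_iff_lt_or_eq.1 hq with hq | rfl
      · exact le_max_of_le_left (le_max_of_le_left (h.col_le q hq))
      · exact le_max_right _ _
    · refine max_le (max_le (h.le B hB (fun q hq => hr q (by omega))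
        (fun q hq => hc q (by omega))) (hr k (by omega))) (hc k (by omega))

/-- The logarithm loop computes `⌈log₂ (m + n)⌉`, cut off at the number of entries. -/
lemma run_log (ω : Tape) {σ : State} {N M : ℕ} (hN : σ.nreg 2 = N) (h5 : σ.nreg 5 = 0)
    (h6 : σ.nreg 6 = 1) (hM : σ.nreg 0 + σ.nreg 1 = M) :
    ∃ t τ, Run ω (forLoop logBody) σ t τ ∧ t ≤ (logBody.steps + 10) * (N + 1) ∧
      Frame (forLoop logBody) σ τ ∧
      (τ.nreg 5 = min N (Nat.clog 2 M) ∧ τ.nreg 6 = 2 ^ min N (Nat.clog 2 M)) := by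
  refine run_forLoop ω (by simp [logBody, Prog.LoopFree])
    (by simp [logBody, Prog.KeepsNReg]) (by simp [logBody, Prog.KeepsNReg])
    (fun k τ => τ.nreg 5 = min k (Nat.clog 2 M) ∧ τ.nreg 6 = 2 ^ min k (Nat.clog 2 M)) hN ?_ ?_ ?_
  · intro k τ x h
    exact h
  · simp [h5, h6]
  · intro k hk τ h4 hF h
    have e0 : τ.nreg 0 = σ.nreg 0 := hF.nreg 0 (by simp [forLoop, logBody, Prog.KeepsNReg])
    have e1 : τ.nreg 1 = σ.nreg 1 := hF.nreg 1 (by simp [forLoop, logBody, Prog.KeepsNReg])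
    have hcl := Nat.lt_clog_iff_pow_lt (b := 2) (x := M) (y := min k (Nat.clog 2 M)) (by norm_num)
    by_cases hc : 2 ^ min k (Nat.clog 2 M) < M
    · have := hcl.2 hc
      have e2 : min (k + 1) (Nat.clog 2 M) = min k (Nat.clog 2 M) + 1 := by omega
      rw [e2]
      simp [logBody, Prog.exec, NExpr.eval, Test.Holds, h.1, h.2, e0, e1, hM, hc, pow_succ, mul_two]
    · have := mt hcl.1 hc
      have e2 : min (k + 1) (Nat.clog 2 M) = min k (Nat.clog 2 M) := by omega
      rw [e2]
      simp [logBody, Prog.exec, NExpr.eval, Test.Holds, h.1, h.2, e0, e1, hM, hc]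

/-- The ceiling loop rounds the real register `2` up, cut off at the number of entries. -/
lemma run_ceil (ω : Tape) {σ : State} {N : ℕ} (hN : σ.nreg 2 = N) (h7 : σ.nreg 7 = 0) :
    ∃ t τ, Run ω (forLoop ceilBody) σ t τ ∧ t ≤ (ceilBody.steps + 10) * (N + 1) ∧
      Frame (forLoop ceilBody) σ τ ∧ τ.nreg 7 = min N ⌈σ.rreg 2⌉₊ := by
  refine run_forLoop ω (by simp [ceilBody, Prog.LoopFree])
    (by simp [ceilBody, Prog.KeepsNReg]) (by simp [ceilBody, Prog.KeepsNReg])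
    (fun k τ => τ.nreg 7 = min k ⌈σ.rreg 2⌉₊) hN ?_ ?_ ?_
  · intro k τ x h
    exact h
  · simp [h7]
  · intro k hk τ h4 hF h
    have e0 : τ.rreg 2 = σ.rreg 2 := hF.rreg 2 (by simp [forLoop, ceilBody, Prog.KeepsRReg])
    have hcl := Nat.lt_ceil (a := σ.rreg 2) (n := min k ⌈σ.rreg 2⌉₊)
    by_cases hc : ((min k ⌈σ.rreg 2⌉₊ : ℕ) : ℝ) < σ.rreg 2
    · have := hcl.2 hc
      have e2 : min (k + 1) ⌈σ.rreg 2⌉₊ = min k ⌈σ.rreg 2⌉₊ + 1 := by omega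
      rw [e2]
      simp only [ceilBody, Prog.exec, NExpr.eval, RExpr.eval, Test.Holds, h, e0, hc, if_true]
      simp
    · have := mt hcl.1 hc
      have e2 : min (k + 1) ⌈σ.rreg 2⌉₊ = min k ⌈σ.rreg 2⌉₊ := by omega
      rw [e2]
      simp only [ceilBody, Prog.exec, NExpr.eval, RExpr.eval, Test.Holds, h, e0, hc, if_false]

end SampleSize
end RowSampling

/-! ### Partitioning the rows -/

namespace RowSampling

section Partition

lemma acc_mono (row : ℕ → ℕ) (f : ℕ → ℕ) (i : ℕ) : Monotone fun k => acc row f k i := fun _ _ h =>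
  Finset.sum_le_sum_of_subset (Finset.range_mono h)

lemma acc_succ_self (row : ℕ → ℕ) (f : ℕ → ℕ) (k : ℕ) :
    acc row f (k + 1) (row k) = acc row f k (row k) + f k := by
  rw [acc_succ, Function.update_self]

/-- The place of the entry `q` after the partition of its row: the entries satisfying `P` are filled
in from the left, the others from the right. -/
noncomputable def slot (row : ℕ → ℕ) (N : ℕ) (P : ℕ → Prop) (q : ℕ) : ℕ :=
  open Classical in
  if P q then rowStart row N (row q) + acc row (fun q => if P q then 1 else 0) q (row q)
  else rowStart row N (row q) + rowSize row N (row q)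
    - (acc row (fun q => if P q then 0 else 1) q (row q) + 1)

open Classical in
/-- Every entry of a row satisfies `P` or not. -/
lemma acc_add_acc (row : ℕ → ℕ) (P : ℕ → Prop) (N i : ℕ) :
    acc row (fun q => if P q then 1 else 0) N i + acc row (fun q => if P q then 0 else 1) N i
      = rowSize row N i := by
  rw [← acc_one, acc, acc, acc, ← Finset.sum_add_distrib]
  refine Finset.sum_congr rfl fun q _ => ?_
  split_ifs <;> rfl

open Classical in
lemma slot_of_pos {row : ℕ → ℕ} {N : ℕ} {P : ℕ → Prop} {q : ℕ} (hq : q < N) (h : P q) :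
    slot row N P q = rowStart row N (row q) + acc row (fun q => if P q then 1 else 0) q (row q) ∧
      acc row (fun q => if P q then 1 else 0) q (row q)
        < acc row (fun q => if P q then 1 else 0) N (row q) := by
  refine ⟨by simp [slot, h], ?_⟩
  have h1 := acc_succ_self row (fun q => if P q then 1 else 0) q
  have h2 := acc_mono row (fun q => if P q then 1 else 0) (row q) (show q + 1 ≤ N from hq)
  simp only [h, if_true] at h1
  simp only at h2
  omega

open Classical in
lemma slot_of_neg {row : ℕ → ℕ} {N : ℕ} {P : ℕ → Prop} {q : ℕ} (hq : q < N) (h : ¬ P q) :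
    slot row N P q = rowStart row N (row q) + rowSize row N (row q)
        - (acc row (fun q => if P q then 0 else 1) q (row q) + 1) ∧
      acc row (fun q => if P q then 0 else 1) q (row q)
        < acc row (fun q => if P q then 0 else 1) N (row q) := by
  refine ⟨by simp [slot, h], ?_⟩
  have h1 := acc_succ_self row (fun q => if P q then 0 else 1) q
  have h2 := acc_mono row (fun q => if P q then 0 else 1) (row q) (show q + 1 ≤ N from hq)
  simp only [h, if_false] at h1
  simp only at h2
  omega

lemma slot_lt {row : ℕ → ℕ} {N : ℕ} (hs : SortedRows row N) (P : ℕ → Prop) {q : ℕ} (hq : q < N) :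
    slot row N P q < N ∧ row (slot row N P q) = row q := by
  classical
  have h1 := acc_add_acc row P N (row q)
  have h2 := rowStart_add_rowSize_le row N (row q)
  have h3 : slot row N P q < N ∧ rowStart row N (row q) ≤ slot row N P q ∧
      slot row N P q < rowStart row N (row q) + rowSize row N (row q) := by
    by_cases h : P q
    · have := slot_of_pos (row := row) hq h
      omega
    · have := slot_of_neg (row := row) hq h
      omega
  exact ⟨h3.1, (row_eq_iff hs h3.1).2 h3.2⟩

lemma slot_ne {row : ℕ → ℕ} {N : ℕ} (hs : SortedRows row N) (P : ℕ → Prop) {p q : ℕ} (hpq : p < q)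
    (hq : q < N) : slot row N P p ≠ slot row N P q := by
  classical
  intro he
  have hp : p < N := by omega
  have hrow : row p = row q := by rw [← (slot_lt hs P hp).2, ← (slot_lt hs P hq).2, he]
  have h1 := acc_add_acc row P N (row q)
  have a1 := acc_succ_self row (fun q => if P q then 1 else 0) p
  have a2 := acc_mono row (fun q => if P q then 1 else 0) (row p) (show p + 1 ≤ q from hpq)
  have b1 := acc_succ_self row (fun q => if P q then 0 else 1) p
  have b2 := acc_mono row (fun q => if P q then 0 else 1) (row p) (show p + 1 ≤ q from hpq)
  simp only at a2 b2
  by_cases h : P p <;> by_cases h' : P q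
  · have := slot_of_pos (row := row) hp h
    have := slot_of_pos (row := row) hq h'
    simp only [h, if_true] at a1
    rw [hrow] at *
    omega
  · have := slot_of_pos (row := row) hp h
    have := slot_of_neg (row := row) hq h'
    rw [hrow] at *
    omega
  · have := slot_of_neg (row := row) hp h
    have := slot_of_pos (row := row) hq h'
    rw [hrow] at *
    omega
  · have := slot_of_neg (row := row) hp h
    have := slot_of_neg (row := row) hq h'
    simp only [h, if_false] at b1
    rw [hrow] at *
    omega

/-- The array `ord` rearranges every row such that exactly its first `lo` entries satisfy `P`. -/
structure Partitioned (row : ℕ → ℕ) (N : ℕ) (P : ℕ → Prop) (ord lo : ℕ → ℕ) : Prop where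
  lt : ∀ x < N, ord x < N
  row_eq : ∀ x < N, row (ord x) = row x
  inj : ∀ x < N, ∀ y < N, ord x = ord y → x = y
  iff : ∀ x < N, (P (ord x) ↔ x < rowStart row N (row x) + lo (row x))

open Classical in
lemma partitioned_of_slot {row : ℕ → ℕ} {N : ℕ} (hs : SortedRows row N) {P : ℕ → Prop}
    {ord : ℕ → ℕ} (h : ∀ q < N, ord (slot row N P q) = q) :
    Partitioned row N P ord (acc row (fun q => if P q then 1 else 0) N) := by
  have hsurj : ∀ x < N, ∃ q < N, slot row N P q = x := by
    have hmaps : Set.MapsTo (slot row N P) (Finset.range N) (Finset.range N) := fun q hq => by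
      simp only [Finset.coe_range, Set.mem_Iio] at hq ⊢
      exact (slot_lt hs P hq).1
    have hinj : Set.InjOn (slot row N P) (Finset.range N) := fun p hp q hq he => by
      simp only [Finset.coe_range, Set.mem_Iio] at hp hq
      rcases lt_trichotomy p q with hlt | heq | hlt
      · exact absurd he (slot_ne hs P hlt hq)
      · exact heq
      · exact absurd he.symm (slot_ne hs P hlt hp)
    intro x hx
    obtain ⟨q, hq, he⟩ := Finset.surjOn_of_injOn_of_card_le _ hmaps hinj le_rfl
      (show x ∈ (Finset.range N : Set ℕ) by simpa using hx)
    exact ⟨q, by simpa using hq, he⟩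
  refine ⟨fun x hx => ?_, fun x hx => ?_, fun x hx y hy he => ?_, fun x hx => ?_⟩
  · obtain ⟨q, hq, rfl⟩ := hsurj x hx
    rw [h q hq]; exact hq
  · obtain ⟨q, hq, rfl⟩ := hsurj x hx
    rw [h q hq, (slot_lt hs P hq).2]
  · obtain ⟨q, hq, rfl⟩ := hsurj x hx
    obtain ⟨q', hq', rfl⟩ := hsurj y hy
    rw [h q hq, h q' hq'] at he
    rw [he]
  · obtain ⟨q, hq, rfl⟩ := hsurj x hx
    rw [h q hq, (slot_lt hs P hq).2]
    have h1 := acc_add_acc row P N (row q)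
    by_cases hP : P q
    · have := slot_of_pos (row := row) hq hP
      simp only [hP, true_iff]
      omega
    · have := slot_of_neg (row := row) hq hP
      simp only [hP, false_iff]
      omega

/-- The test of the partition loop: the residual weight of the entry `q` is below the average of its
row. -/
def Small (σ : State) (q : ℕ) : Prop := σ.rarr 6 q * (σ.narr 4 (σ.narr 0 q) : ℝ) < σ.rarr 2 (σ.narr 0 q)

lemma part_exec_pos (ω : Tape) (τ : State) {k r : ℕ} (hk : τ.nreg 4 = k) (hr : τ.narr 0 k = r)
    (h : Small τ k) :
    (partBody.exec ω τ).narr 6 = Function.update (τ.narr 6) r (τ.narr 6 r + 1) ∧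
    (partBody.exec ω τ).narr 7 = τ.narr 7 ∧
    (partBody.exec ω τ).narr 8 = Function.update (τ.narr 8) (τ.narr 5 r + τ.narr 6 r) k := by
  subst hk hr
  unfold Small at h
  simp [partBody, block, Prog.exec, NExpr.eval, RExpr.eval, Test.Holds, rowE, h]

lemma part_exec_neg (ω : Tape) (τ : State) {k r : ℕ} (hk : τ.nreg 4 = k) (hr : τ.narr 0 k = r)
    (h : ¬ Small τ k) :
    (partBody.exec ω τ).narr 6 = τ.narr 6 ∧
    (partBody.exec ω τ).narr 7 = Function.update (τ.narr 7) r (τ.narr 7 r + 1) ∧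
    (partBody.exec ω τ).narr 8 = Function.update (τ.narr 8)
      (τ.narr 5 r + τ.narr 4 r - (τ.narr 7 r + 1)) k := by
  subst hk hr
  unfold Small at h
  simp [partBody, block, Prog.exec, NExpr.eval, RExpr.eval, Test.Holds, rowE, h]

/-- The partition loop stores every entry in its slot. -/
lemma run_part (ω : Tape) {σ : State} {N : ℕ} (hN : σ.nreg 2 = N)
    (hsort : SortedRows (σ.narr 0) N) (h4 : ∀ q < N, σ.narr 4 (σ.narr 0 q)
      = rowSize (σ.narr 0) N (σ.narr 0 q))
    (h5 : ∀ q < N, σ.narr 5 (σ.narr 0 q) = rowStart (σ.narr 0) N (σ.narr 0 q))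
    (h6 : σ.narr 6 = 0) (h7 : σ.narr 7 = 0) :
    ∃ t τ, Run ω (forLoop partBody) σ t τ ∧ t ≤ (partBody.steps + 10) * (N + 1) ∧
      Frame (forLoop partBody) σ τ ∧
      Partitioned (σ.narr 0) N (Small σ) (τ.narr 8) (τ.narr 6) := by
  classical
  have key : ∃ t τ, Run ω (forLoop partBody) σ t τ ∧ t ≤ (partBody.steps + 10) * (N + 1) ∧
      Frame (forLoop partBody) σ τ ∧
      (τ.narr 6 = acc (σ.narr 0) (fun q => if Small σ q then 1 else 0) N ∧
      τ.narr 7 = acc (σ.narr 0) (fun q => if Small σ q then 0 else 1) N ∧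
      ∀ q < N, τ.narr 8 (slot (σ.narr 0) N (Small σ) q) = q) := by
    refine run_forLoop ω (by simp [partBody, block, Prog.LoopFree])
      (by simp [partBody, block, Prog.KeepsNReg]) (by simp [partBody, block, Prog.KeepsNReg])
      (fun k τ => τ.narr 6 = acc (σ.narr 0) (fun q => if Small σ q then 1 else 0) k ∧
        τ.narr 7 = acc (σ.narr 0) (fun q => if Small σ q then 0 else 1) k ∧
        ∀ q < k, τ.narr 8 (slot (σ.narr 0) N (Small σ) q) = q) hN
      (fun k τ x h => h) ⟨by rw [h6, acc_zero], by rw [h7, acc_zero],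
        fun q hq => absurd hq (Nat.not_lt_zero q)⟩ ?_
    intro k hk τ hk4 hF ⟨i6, i7, i8⟩
    have f0 : τ.narr 0 = σ.narr 0 := hF.narr 0 (by simp [forLoop, partBody, block, Prog.KeepsNArr])
    have f4 : τ.narr 4 = σ.narr 4 := hF.narr 4 (by simp [forLoop, partBody, block, Prog.KeepsNArr])
    have f5 : τ.narr 5 = σ.narr 5 := hF.narr 5 (by simp [forLoop, partBody, block, Prog.KeepsNArr])
    have fr : ∀ a, τ.rarr a = σ.rarr a := fun a =>
      hF.rarr a (by simp [forLoop, partBody, block, Prog.KeepsRArr])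
    have hsm : Small τ k ↔ Small σ k := by simp only [Small, f0, f4, fr]
    have upd : ∀ y : ℕ, y = slot (σ.narr 0) N (Small σ) k → ∀ q < k + 1,
        Function.update (τ.narr 8) y k (slot (σ.narr 0) N (Small σ) q) = q := by
      intro y hy q hq
      rcases Nat.lt_succ_iff_lt_or_eq.1 hq with hq | rfl
      · rw [Function.update_of_ne (hy ▸ slot_ne hsort _ hq hk), i8 q hq]
      · rw [hy, Function.update_self]
    by_cases h : Small σ k
    · obtain ⟨x6, x7, x8⟩ := part_exec_pos ω τ hk4 (congrFun f0 k) (hsm.2 h)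
      rw [x6, x7, x8, acc_succ, acc_succ, i6, i7]
      refine ⟨by simp [h], by simp [h], upd _ ?_⟩
      rw [(slot_of_pos hk h).1, f5, h5 k hk]
    · obtain ⟨x6, x7, x8⟩ := part_exec_neg ω τ hk4 (congrFun f0 k) (mt hsm.1 h)
      rw [x6, x7, x8, acc_succ, acc_succ, i6, i7]
      refine ⟨by simp [h], by simp [h], upd _ ?_⟩
      rw [(slot_of_neg hk h).1, f5, h5 k hk, f4, h4 k hk]
  obtain ⟨t, τ, hrun, ht, hF, e6, -, e8⟩ := key
  refine ⟨t, τ, hrun, ht, hF, ?_⟩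
  rw [e6]
  exact partitioned_of_slot hsort e8

end Partition
end RowSampling

/-! ### The alias method -/

namespace RowSampling

section Alias

/-- The state of the alias method when the cells `x < p` are complete. The residual weight of the
entry `j` is `r j`, its partner is `al j`; in the cell `x` lies the entry `ord x`, and the incomplete
cells of a row with average `μ` have residual weights below `μ` up to the position
`rowStart + lo`, and at least `μ` from there on. -/
structure AliasInv (row : ℕ → ℕ) (N : ℕ) (ord : ℕ → ℕ) (μ w : ℕ → ℝ) (p : ℕ) (lo : ℕ → ℕ)
    (r : ℕ → ℝ) (al : ℕ → ℕ) : Prop where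
  small_iff : ∀ x, p ≤ x → x < N → (r (ord x) < μ (row x) ↔ x < rowStart row N (row x) + lo (row x))
  le_lo : ∀ i, p < rowStart row N i + rowSize row N i → p ≤ rowStart row N i + lo i
  sum_zero : ∀ i, ∑ x ∈ Finset.range N, (if row x = i ∧ p ≤ x then r (ord x) - μ i else 0) = 0
  weight : ∀ j < N, r j + ∑ x ∈ Finset.range p,
    (if al (ord x) = j then μ (row x) - r (ord x) else 0) = w j
  le_avg : ∀ x < p, r (ord x) ≤ μ (row x)
  al_row : ∀ x < p, al (ord x) < N ∧ row (al (ord x)) = row x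
  nonneg : ∀ j < N, 0 ≤ r j

variable {row : ℕ → ℕ} {N : ℕ} {ord : ℕ → ℕ} {μ w : ℕ → ℝ} {p : ℕ} {lo : ℕ → ℕ} {r : ℕ → ℝ}
  {al : ℕ → ℕ}

lemma sum_step (hp : p < N) (f : ℕ → ℝ) :
    ∑ x ∈ Finset.range N, (if row x = row p ∧ p ≤ x then f x else 0)
      = f p + ∑ x ∈ Finset.range N, (if row x = row p ∧ p + 1 ≤ x then f x else 0) := by
  have : ∀ x, (if row x = row p ∧ p ≤ x then f x else 0)
      = (if x = p then f x else 0) + (if row x = row p ∧ p + 1 ≤ x then f x else 0) := by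
    intro x
    by_cases hx : x = p
    · subst hx; simp
    · have : p + 1 ≤ x ↔ p ≤ x := by omega
      simp [hx, this]
  simp_rw [this, Finset.sum_add_distrib]
  congr 1
  simp [hp]

lemma sum_other {i : ℕ} (hi : row p ≠ i) (f : ℕ → ℝ) :
    ∑ x ∈ Finset.range N, (if row x = i ∧ p + 1 ≤ x then f x else 0)
      = ∑ x ∈ Finset.range N, (if row x = i ∧ p ≤ x then f x else 0) := by
  refine Finset.sum_congr rfl fun x _ => ?_
  by_cases hx : x = p
  · subst hx; simp [hi]
  · have : p + 1 ≤ x ↔ p ≤ x := by omega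
    simp [this]

lemma le_lo_other (hs : SortedRows row N) (hp : p < N) {i : ℕ}
    (hi : row p ≠ i) (hlt : p + 1 < rowStart row N i + rowSize row N i) :
    p + 1 ≤ rowStart row N i + lo i := by
  have := mt (row_eq_iff hs hp (i := i)).2 hi
  omega

/-- The current entry is below the average: its cell is filled up by the first large entry, which
exists since the residual weights of the incomplete cells have the right average. -/
lemma AliasInv.step_small (hs : SortedRows row N) {P : ℕ → Prop} {lo₀ : ℕ → ℕ}
    (ho : Partitioned row N P ord lo₀)
    (h : AliasInv row N ord μ w p lo r al) (hp : p < N)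
    (hlt : p < rowStart row N (row p) + lo (row p)) {y : ℕ}
    (hy : y = ord (rowStart row N (row p) + lo (row p))) {r' : ℕ → ℝ} {lo' : ℕ → ℕ}
    (hr' : r' = Function.update r y (r y - (μ (row p) - r (ord p))))
    (hlo' : lo' = if r' y < μ (row p) then Function.update lo (row p) (lo (row p) + 1) else lo) :
    AliasInv row N ord μ w (p + 1) lo' r' (Function.update al (ord p) y) := by
  set Lp := rowStart row N (row p) + lo (row p) with hLp
  have hpint := (row_eq_iff hs hp).1 rfl
  have hsum := h.sum_zero (row p)
  have hrk : r (ord p) < μ (row p) := (h.small_iff p le_rfl hp).2 hlt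
  -- otherwise all incomplete cells of the row would have residual weights below the average
  have hLend : Lp < rowStart row N (row p) + rowSize row N (row p) := by
    by_contra hcon
    have hneg : ∑ x ∈ Finset.range N,
        (if row x = row p ∧ p ≤ x then r (ord x) - μ (row p) else 0) < 0 := by
      refine Finset.sum_neg' (fun x hx => ?_) ⟨p, by simpa using hp, by simpa using hrk⟩
      split_ifs with hc
      · have hxN : x < N := by simpa using hx
        have := (row_eq_iff hs hxN).1 hc.1
        have := (h.small_iff x hc.2 hxN).2 (by rw [hc.1]; omega)
        rw [hc.1] at this
        linarith
      · exact le_rfl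
    linarith
  have hLN : Lp < N := by
    have := rowStart_add_rowSize_le row N (row p); omega
  have hLrow : row Lp = row p := (row_eq_iff hs hLN).2 ⟨by omega, hLend⟩
  have hyN : y < N := hy ▸ ho.lt Lp hLN
  have hyrow : row y = row p := by rw [hy, ho.row_eq Lp hLN, hLrow]
  have hry : μ (row p) ≤ r y := by
    have := mt (h.small_iff Lp hlt.le hLN).1 (by rw [hLrow]; omega)
    rw [hLrow, ← hy] at this
    exact not_lt.1 this
  have hordy : ∀ x < N, x ≠ Lp → ord x ≠ y := fun x hx hne he =>
    hne (ho.inj x hx Lp hLN (he.trans hy))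
  have hordp : ∀ x < N, x ≠ p → ord x ≠ ord p := fun x hx hne he => hne (ho.inj x hx p hp he)
  have hr'x : ∀ x < N, x ≠ Lp → r' (ord x) = r (ord x) := fun x hx hne => by
    rw [hr', Function.update_of_ne (hordy x hx hne)]
  have hr'y : r' y = r y - (μ (row p) - r (ord p)) := by rw [hr', Function.update_self]
  have hlo'x : ∀ i, i ≠ row p → lo' i = lo i := fun i hi => by
    rw [hlo']; split_ifs
    · rw [Function.update_of_ne hi]
    · rfl
  have hloge : lo (row p) ≤ lo' (row p) := by
    rw [hlo']; split_ifs
    · rw [Function.update_self]; omega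
    · exact le_rfl
  refine ⟨fun x hpx hx => ?_, fun i hi => ?_, fun i => ?_, fun j hj => ?_, fun x hx => ?_,
    fun x hx => ?_, fun j hj => ?_⟩
  · by_cases hrow : row x = row p
    · by_cases hxL : x = Lp
      · rw [hxL, ← hy, hLrow, hlo']
        split_ifs with hc
        · simp only [hc, Function.update_self, true_iff]; omega
        · simp only [hc, false_iff]; omega
      · rw [hr'x x hx hxL, h.small_iff x (by omega) hx, hrow, hlo']
        split_ifs with hc
        · rw [Function.update_self]; omega
        · rfl
    · have hxL : x ≠ Lp := fun he => hrow (he ▸ hLrow)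
      rw [hr'x x hx hxL, h.small_iff x (by omega) hx, hlo'x _ hrow]
  · by_cases hrow : row p = i
    · subst hrow; omega
    · rw [hlo'x i (Ne.symm hrow)]
      exact le_lo_other hs hp hrow hi
  · by_cases hrow : row p = i
    · subst hrow
      rw [sum_step hp] at hsum
      have e : ∀ x ∈ Finset.range N,
          (if row x = row p ∧ p + 1 ≤ x then r' (ord x) - μ (row p) else 0)
          = (if row x = row p ∧ p + 1 ≤ x then r (ord x) - μ (row p) else 0)
            + (if x = Lp then r (ord p) - μ (row p) else 0) := by
        intro x hx
        have hxN : x < N := by simpa using hx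
        by_cases hxL : x = Lp
        · rw [hxL, if_pos ⟨hLrow, hlt⟩, if_pos ⟨hLrow, hlt⟩, if_pos rfl, ← hy, hr'y]; ring
        · rw [hr'x x hxN hxL, if_neg hxL, add_zero]
      rw [Finset.sum_congr rfl e, Finset.sum_add_distrib]
      simp only [Finset.sum_ite_eq', Finset.mem_range, hLN, if_true]
      linarith
    · rw [sum_other hrow]
      refine (Finset.sum_congr rfl fun x hx => ?_).trans (h.sum_zero i)
      by_cases hc : row x = i ∧ p ≤ x
      · have hxN : x < N := by simpa using hx
        have hxL : x ≠ Lp := fun he => hrow (by rw [← hc.1, he, hLrow])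
        rw [if_pos hc, if_pos hc, hr'x x hxN hxL]
      · rw [if_neg hc, if_neg hc]
  · rw [Finset.sum_range_succ, Function.update_self, hr'x p hp hlt.ne, ← h.weight j hj]
    have e : ∀ x ∈ Finset.range p,
        (if Function.update al (ord p) y (ord x) = j then μ (row x) - r' (ord x) else 0)
        = (if al (ord x) = j then μ (row x) - r (ord x) else 0) := by
      intro x hx
      have hxp : x < p := by simpa using hx
      rw [Function.update_of_ne (hordp x (by omega) hxp.ne), hr'x x (by omega) (by omega)]
    rw [Finset.sum_congr rfl e]
    by_cases hyj : y = j
    · subst hyj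
      rw [hr'y, if_pos rfl]; ring
    · rw [if_neg hyj, hr', Function.update_of_ne (Ne.symm hyj)]; ring
  · rw [hr'x x (by omega) (by omega)]
    rcases Nat.lt_succ_iff_lt_or_eq.1 hx with hx | rfl
    · exact h.le_avg x hx
    · exact hrk.le
  · rcases Nat.lt_succ_iff_lt_or_eq.1 hx with hx | rfl
    · rw [Function.update_of_ne (hordp x (by omega) hx.ne)]
      exact h.al_row x hx
    · rw [Function.update_self]
      exact ⟨hyN, hyrow⟩
  · by_cases hyj : j = y
    · rw [hyj, hr'y]
      have := h.nonneg (ord p) (ho.lt p hp)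
      linarith
    · rw [hr', Function.update_of_ne hyj]
      exact h.nonneg j hj

/-- No entry below the average is left in the row: all residual weights are equal to the average. -/
lemma AliasInv.step_full (hs : SortedRows row N) {P : ℕ → Prop} {lo₀ : ℕ → ℕ}
    (ho : Partitioned row N P ord lo₀)
    (h : AliasInv row N ord μ w p lo r al) (hp : p < N)
    (hge : ¬ p < rowStart row N (row p) + lo (row p)) :
    AliasInv row N ord μ w (p + 1) (Function.update lo (row p) (lo (row p) + 1)) r
      (Function.update al (ord p) (ord p)) := by
  have hpint := (row_eq_iff hs hp).1 rfl
  have hpL : p = rowStart row N (row p) + lo (row p) := by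
    have := h.le_lo (row p) hpint.2; omega
  have hordp : ∀ x < N, x ≠ p → ord x ≠ ord p := fun x hx hne he => hne (ho.inj x hx p hp he)
  have hlarge : ∀ x, p ≤ x → x < N → row x = row p → μ (row p) ≤ r (ord x) := by
    intro x hpx hx hrow
    have := mt (h.small_iff x hpx hx).1 (by rw [hrow]; omega)
    rw [hrow] at this
    exact not_lt.1 this
  have hsum := h.sum_zero (row p)
  have hrk : r (ord p) = μ (row p) := by
    have := (Finset.sum_eq_zero_iff_of_nonneg (fun x hx => ?_)).1 hsum p (by simpa using hp)
    · simp only [le_refl, and_self, if_true] at this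
      linarith
    · split_ifs with hc
      · have := hlarge x hc.2 (by simpa using hx) hc.1
        linarith
      · exact le_rfl
  refine ⟨fun x hpx hx => ?_, fun i hi => ?_, fun i => ?_, fun j hj => ?_, fun x hx => ?_,
    fun x hx => ?_, h.nonneg⟩
  · by_cases hrow : row x = row p
    · have h1 := hlarge x (by omega) hx hrow
      rw [hrow, Function.update_self]
      constructor
      · intro h2; linarith
      · intro h2; omega
    · rw [Function.update_of_ne hrow]
      exact h.small_iff x (by omega) hx
  · by_cases hrow : row p = i
    · subst hrow; rw [Function.update_self]; omega
    · rw [Function.update_of_ne (Ne.symm hrow)]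
      exact le_lo_other hs hp hrow hi
  · by_cases hrow : row p = i
    · subst hrow
      rw [sum_step hp, hrk] at hsum
      linarith
    · rw [sum_other hrow]
      exact h.sum_zero i
  · rw [Finset.sum_range_succ, Function.update_self, hrk, ← h.weight j hj]
    have e : ∀ x ∈ Finset.range p,
        (if Function.update al (ord p) (ord p) (ord x) = j then μ (row x) - r (ord x) else 0)
        = (if al (ord x) = j then μ (row x) - r (ord x) else 0) := by
      intro x hx
      have hxp : x < p := by simpa using hx
      rw [Function.update_of_ne (hordp x (by omega) hxp.ne)]
    rw [Finset.sum_congr rfl e]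
    simp
  · rcases Nat.lt_succ_iff_lt_or_eq.1 hx with hx | rfl
    · exact h.le_avg x hx
    · exact hrk.le
  · rcases Nat.lt_succ_iff_lt_or_eq.1 hx with hx | rfl
    · rw [Function.update_of_ne (hordp x (by omega) hx.ne)]
      exact h.al_row x hx
    · rw [Function.update_self]
      exact ⟨ho.lt x hp, ho.row_eq x hp⟩

/-- An alias table for the weights `w`: the entry `j` is picked by its own cell with weight `r j`,
and by every cell `q` with partner `j` with the remaining weight `μ - r q` of that cell. -/
structure AliasTable (row : ℕ → ℕ) (N : ℕ) (μ w : ℕ → ℝ) (r : ℕ → ℝ) (al : ℕ → ℕ) : Prop where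
  weight : ∀ j < N, r j + ∑ q ∈ Finset.range N, (if al q = j then μ (row q) - r q else 0) = w j
  le_avg : ∀ q < N, r q ≤ μ (row q)
  nonneg : ∀ q < N, 0 ≤ r q
  lt : ∀ q < N, al q < N
  row_eq : ∀ q < N, row (al q) = row q

lemma Partitioned.image_range {P : ℕ → Prop} {lo₀ : ℕ → ℕ} (ho : Partitioned row N P ord lo₀) :
    (Finset.range N).image ord = Finset.range N := by
  refine Finset.eq_of_subset_of_card_le (fun q hq => ?_) ?_
  · obtain ⟨x, hx, rfl⟩ := Finset.mem_image.1 hq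
    simpa using ho.lt x (by simpa using hx)
  · rw [Finset.card_image_of_injOn]
    intro x hx y hy he
    simp only [Finset.coe_range, Set.mem_Iio] at hx hy
    exact ho.inj x hx y hy he

lemma AliasInv.table {P : ℕ → Prop} {lo₀ : ℕ → ℕ} (ho : Partitioned row N P ord lo₀)
    (h : AliasInv row N ord μ w N lo r al) : AliasTable row N μ w r al := by
  have hsurj : ∀ q < N, ∃ x < N, ord x = q := fun q hq => by
    have : q ∈ (Finset.range N).image ord := by rw [ho.image_range]; simpa using hq
    obtain ⟨x, hx, rfl⟩ := Finset.mem_image.1 this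
    exact ⟨x, by simpa using hx, rfl⟩
  refine ⟨fun j hj => ?_, fun q hq => ?_, h.nonneg, fun q hq => ?_, fun q hq => ?_⟩
  · rw [← h.weight j hj]
    congr 1
    conv_lhs => rw [← ho.image_range]
    rw [Finset.sum_image (fun x hx y hy he => ho.inj x (by simpa using hx) y (by simpa using hy) he)]
    refine Finset.sum_congr rfl fun x hx => ?_
    rw [ho.row_eq x (by simpa using hx)]
  · obtain ⟨x, hx, rfl⟩ := hsurj q hq
    rw [ho.row_eq x hx]; exact h.le_avg x hx
  · obtain ⟨x, hx, rfl⟩ := hsurj q hq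
    exact (h.al_row x hx).1
  · obtain ⟨x, hx, rfl⟩ := hsurj q hq
    rw [ho.row_eq x hx]; exact (h.al_row x hx).2

/-- The average weight of the row `i`, as computed from the memory. -/
noncomputable def rowAvg (σ : State) (i : ℕ) : ℝ := σ.rarr 2 i / (σ.narr 4 i : ℝ)

lemma alias_exec_small (ω : Tape) (τ : State) {p i k y : ℕ} {r' : ℕ → ℝ} (hp : τ.nreg 4 = p)
    (hi : τ.narr 0 p = i) (hk : τ.narr 8 p = k) (h : p < τ.narr 5 i + τ.narr 6 i)
    (hy : τ.narr 8 (τ.narr 5 i + τ.narr 6 i) = y)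
    (hr' : r' = Function.update (τ.rarr 6) y (τ.rarr 6 y - (rowAvg τ i - τ.rarr 6 k))) :
    (aliasBody.exec ω τ).narr 9 = Function.update (τ.narr 9) k y ∧
    (aliasBody.exec ω τ).rarr 6 = r' ∧
    (aliasBody.exec ω τ).narr 6
      = (if r' y < rowAvg τ i then Function.update (τ.narr 6) i (τ.narr 6 i + 1) else τ.narr 6) := by
  subst hp hi hk hy hr'
  rw [Function.update_self]
  unfold rowAvg at *
  simp only [aliasBody, block, Prog.exec, NExpr.eval, RExpr.eval, Test.Holds, rowE, avgE, h,
    Function.update_self, ne_eq, Nat.reduceEqDiff, not_false_eq_true,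
    Function.update_of_ne, if_true, apply_ite State.narr, apply_ite State.rarr]
  split_ifs <;> simp

lemma alias_exec_full (ω : Tape) (τ : State) {p i k : ℕ} (hp : τ.nreg 4 = p)
    (hi : τ.narr 0 p = i) (hk : τ.narr 8 p = k) (h : ¬ p < τ.narr 5 i + τ.narr 6 i) :
    (aliasBody.exec ω τ).narr 9 = Function.update (τ.narr 9) k k ∧
    (aliasBody.exec ω τ).rarr 6 = τ.rarr 6 ∧
    (aliasBody.exec ω τ).narr 6 = Function.update (τ.narr 6) i (τ.narr 6 i + 1) := by
  subst hp hi hk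
  simp [aliasBody, block, Prog.exec, NExpr.eval, Test.Holds, rowE, avgE, h]

/-- The alias loop builds an alias table for the weights `w`. -/
lemma run_alias (ω : Tape) {σ : State} (hN : σ.nreg 2 = N)
    (hsort : SortedRows (σ.narr 0) N)
    (h5 : ∀ q < N, σ.narr 5 (σ.narr 0 q) = rowStart (σ.narr 0) N (σ.narr 0 q))
    {P : ℕ → Prop} {lo₀ : ℕ → ℕ} (ho : Partitioned (σ.narr 0) N P (σ.narr 8) lo₀)
    (h0 : AliasInv (σ.narr 0) N (σ.narr 8) (rowAvg σ) w 0 (σ.narr 6) (σ.rarr 6) (σ.narr 9)) :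
    ∃ t τ, Run ω (forLoop aliasBody) σ t τ ∧ t ≤ (aliasBody.steps + 10) * (N + 1) ∧
      Frame (forLoop aliasBody) σ τ ∧
      AliasTable (σ.narr 0) N (rowAvg σ) w (τ.rarr 6) (τ.narr 9) := by
  have key : ∃ t τ, Run ω (forLoop aliasBody) σ t τ ∧ t ≤ (aliasBody.steps + 10) * (N + 1) ∧
      Frame (forLoop aliasBody) σ τ ∧
      AliasInv (σ.narr 0) N (σ.narr 8) (rowAvg σ) w N (τ.narr 6) (τ.rarr 6) (τ.narr 9) := by
    refine run_forLoop ω (by simp [aliasBody, block, Prog.LoopFree])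
      (by simp [aliasBody, block, Prog.KeepsNReg]) (by simp [aliasBody, block, Prog.KeepsNReg])
      (fun k τ => AliasInv (σ.narr 0) N (σ.narr 8) (rowAvg σ) w k (τ.narr 6) (τ.rarr 6) (τ.narr 9))
      hN (fun k τ x h => h) h0 ?_
    intro p hp τ hp4 hF h
    have f0 : τ.narr 0 = σ.narr 0 := hF.narr 0 (by simp [forLoop, aliasBody, block, Prog.KeepsNArr])
    have f4 : τ.narr 4 = σ.narr 4 := hF.narr 4 (by simp [forLoop, aliasBody, block, Prog.KeepsNArr])
    have f5 : τ.narr 5 = σ.narr 5 := hF.narr 5 (by simp [forLoop, aliasBody, block, Prog.KeepsNArr])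
    have f8 : τ.narr 8 = σ.narr 8 := hF.narr 8 (by simp [forLoop, aliasBody, block, Prog.KeepsNArr])
    have fr : τ.rarr 2 = σ.rarr 2 := hF.rarr 2 (by simp [forLoop, aliasBody, block, Prog.KeepsRArr])
    have favg : rowAvg τ = rowAvg σ := by funext i; simp [rowAvg, f4, fr]
    have h5p := h5 p hp
    by_cases hc : p < rowStart (σ.narr 0) N (σ.narr 0 p) + τ.narr 6 (σ.narr 0 p)
    · obtain ⟨x9, xr, x6⟩ := alias_exec_small ω τ hp4 (congrFun f0 p) (congrFun f8 p)
        (by rw [f5, h5p]; exact hc) rfl rfl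
      rw [x9, xr, x6, f5, h5p, f8, favg]
      exact h.step_small hsort ho hp hc rfl rfl rfl
    · obtain ⟨x9, xr, x6⟩ := alias_exec_full ω τ hp4 (congrFun f0 p) (congrFun f8 p)
        (by rw [f5, h5p]; exact hc)
      rw [x9, xr, x6]
      exact h.step_full hsort ho hp hc
  obtain ⟨t, τ, hrun, ht, hF, h⟩ := key
  exact ⟨t, τ, hrun, ht, hF, h.table ho⟩

end Alias
end RowSampling

/-! ### The deterministic part of the algorithm -/

namespace RowSampling

section Prepare

/-- The partition by the average establishes the invariant of the alias method. -/
lemma AliasInv.start {row : ℕ → ℕ} {N : ℕ} {ord lo : ℕ → ℕ} {μ w : ℕ → ℝ} (al : ℕ → ℕ)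
    {P : ℕ → Prop} (ho : Partitioned row N P ord lo) (hP : ∀ q < N, (P q ↔ w q < μ (row q)))
    (hμ : ∀ i, acc row w N i = rowSize row N i * μ i) {r : ℕ → ℝ} (hr : ∀ q < N, r q = w q)
    (hw : ∀ q, 0 ≤ w q) : AliasInv row N ord μ w 0 lo r al := by
  refine ⟨fun x _ hx => ?_, fun i _ => Nat.zero_le _, fun i => ?_, fun j hj => by simp [hr j hj],
    fun x hx => absurd hx (Nat.not_lt_zero x), fun x hx => absurd hx (Nat.not_lt_zero x),
    fun j hj => (hr j hj).symm ▸ hw j⟩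
  · rw [hr _ (ho.lt x hx), ← ho.row_eq x hx, ← hP _ (ho.lt x hx), ho.iff x hx, ho.row_eq x hx]
  · have e : ∑ q ∈ Finset.range N, (if row q = i then w q - μ i else 0) = 0 := by
      have h1 : ∀ q, (if row q = i then w q - μ i else 0)
          = (if row q = i then w q else 0) - (if row q = i then (1 : ℕ) else 0 : ℕ) * μ i := by
        intro q; split_ifs <;> simp
      simp_rw [h1, Finset.sum_sub_distrib, ← Finset.sum_mul, ← Nat.cast_sum]
      have h2 := acc_one row N i
      unfold acc at h2
      rw [h2]
      exact sub_eq_zero.2 (hμ i)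
    refine Eq.trans ?_ e
    conv_rhs => rw [← ho.image_range]
    rw [Finset.sum_image (fun x hx y hy he => ho.inj x (by simpa using hx) y (by simpa using hy) he)]
    refine Finset.sum_congr rfl fun x hx => ?_
    have hx : x < N := by simpa using hx
    simp only [ho.row_eq x hx, Nat.zero_le, and_true, hr _ (ho.lt x hx)]

/-- The number of samples: `N` is the number of entries, `M` the numerical sparsity, `L` stands for
the logarithm. For `ε ≥ 1` the zero matrix is a sparsifier, and no samples are needed. -/
noncomputable def sampleSize (C N : ℕ) (M : ℝ) (L : ℕ) (ε : ℝ) : ℕ :=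
  open Classical in
  min N ⌈if ε < 1 then (C : ℝ) * (M * (L : ℝ) / (ε * ε)) else 0⌉₊

/-- The memory after the deterministic part of the algorithm. -/
structure Prepared (row col : ℕ → ℕ) (v : ℕ → ℝ) (N s : ℕ) (τ : State) : Prop where
  len : τ.nreg 2 = N
  out : τ.nreg 3 = 0
  samples : τ.nreg 7 = s
  pos : τ.pos = 0
  row_arr : τ.narr 0 = row
  col_arr : τ.narr 1 = col
  val : τ.rarr 0 = v
  size : τ.narr 4 = rowSize row N
  start : ∀ q < N, τ.narr 5 (row q) = rowStart row N (row q)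
  rowL1 : τ.rarr 2 = acc row (fun q => |v q|) N
  abs : ∀ q < N, τ.rarr 7 q = |v q|
  count : τ.narr 10 = 0
  table : AliasTable row N (rowAvg τ) (fun q => |v q|) (τ.rarr 6) (τ.narr 9)

/-- A bound for the running time of the deterministic part, per entry. -/
def prepareSteps : ℕ :=
  (scanBody.steps + 10) + (maxBody.steps + 10) + (logBody.steps + 10) + (ceilBody.steps + 10)
    + (partBody.steps + 10) + (aliasBody.steps + 10) + 50

lemma prepare_noDraw (C : ℕ) : (prepare C).NoDraw := by
  simp [prepare, block, forLoop, Prog.NoDraw, scanBody, maxBody, logBody, ceilBody, partBody,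
    aliasBody]

lemma rowSize_pos {row : ℕ → ℕ} {N q : ℕ} (hq : q < N) : 0 < rowSize row N (row q) :=
  Finset.card_pos.2 ⟨q, by simp [hq]⟩

lemma acc_eq_rowSize_mul {row : ℕ → ℕ} {N : ℕ} (v : ℕ → ℝ) (i : ℕ) :
    acc row v N i = rowSize row N i * (acc row v N i / rowSize row N i) := by
  rcases Nat.eq_zero_or_pos (rowSize row N i) with h | h
  · rw [h, Nat.cast_zero, zero_mul]
    refine Finset.sum_eq_zero fun q hq => if_neg fun he => ?_
    have := rowSize_pos (row := row) (Finset.mem_range.1 hq)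
    rw [he] at this
    omega
  · field_simp

/-- The deterministic part of the algorithm. The numerical sparsity enters through `hM`, as the value
of the maximum that the program computes. -/
lemma run_prepare (C : ℕ) (ω : Tape) {σ : State} {N : ℕ} {M₀ : ℝ} (hN : σ.nreg 2 = N)
    (hsort : SortedRows (σ.narr 0) N) (hreg : ∀ r, 3 ≤ r → σ.nreg r = 0)
    (hrreg : ∀ r, 1 ≤ r → σ.rreg r = 0) (hn : ∀ a, 2 ≤ a → σ.narr a = 0)
    (hr : ∀ a, 1 ≤ a → σ.rarr a = 0) (hpos : σ.pos = 0)
    (hM : ∀ τ M, τ.narr 0 = σ.narr 0 → τ.narr 1 = σ.narr 1 →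
      Scanned (σ.narr 0) (σ.narr 1) (σ.rarr 0) N N τ → MaxRatio τ N M → M = M₀) :
    ∃ t τ, Run ω (prepare C) σ t τ ∧ t ≤ prepareSteps * (N + 1) ∧
      Prepared (σ.narr 0) (σ.narr 1) (σ.rarr 0) N
        (sampleSize C N M₀ (min N (Nat.clog 2 (σ.nreg 0 + σ.nreg 1))) (σ.rreg 0)) τ := by
  obtain ⟨t1, τ1, r1, ht1, F1, S1⟩ := run_scan ω hN hsort hn hr
  have a0 : τ1.narr 0 = σ.narr 0 := F1.narr 0 (by simp [forLoop, scanBody, block, Prog.KeepsNArr])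
  have a1 : τ1.narr 1 = σ.narr 1 := F1.narr 1 (by simp [forLoop, scanBody, block, Prog.KeepsNArr])
  have g1 : ∀ r, r ≠ 4 → τ1.nreg r = σ.nreg r := fun r h =>
    F1.nreg r (by simp [forLoop, scanBody, block, Prog.KeepsNReg, Ne.symm h])
  obtain ⟨t2, τ2, r2, ht2, F2, M2⟩ := run_max ω ((g1 2 (by decide)).trans hN)
    ((F1.rreg 1 (by simp [forLoop, scanBody, block, Prog.KeepsRReg])).trans (hrreg 1 le_rfl))
  have M2' := hM τ1 _ a0 a1 S1 M2
  have g2 : ∀ r, r ≠ 4 → τ2.nreg r = σ.nreg r := fun r h =>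
    (F2.nreg r (by simp [forLoop, maxBody, block, Prog.KeepsNReg, Ne.symm h])).trans (g1 r h)
  have r3 : Run ω (.nset 6 (.const 1)) τ2 _ _ := .nset τ2 6 (.const 1)
  obtain ⟨t4, τ4, r4, ht4, F4, L4⟩ := run_log ω (N := N) (M := σ.nreg 0 + σ.nreg 1)
    (σ := { τ2 with nreg := Function.update τ2.nreg 6 ((NExpr.const 1).eval τ2) })
    (by simp [g2, hN]) (by simp [g2, hreg]) (by simp [NExpr.eval]) (by simp [g2])
  obtain ⟨t5, ht5, r5⟩ := run_exec ω (.cond (.rlt (.reg 0) (.ofNat (.const 1)))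
    (.rset 2 (.mul (.ofNat (.const C))
      (.div (.mul (.reg 1) (.ofNat (.reg 5))) (.mul (.reg 0) (.reg 0)))))
    .skip) (by simp [Prog.LoopFree]) τ4
  have F5 := r5.frame
  have T5 := r5
  generalize hτ5 : Prog.exec ω _ τ4 = τ5 at r5 F5
  have rr4 : ∀ r, r ≠ 5 → r ≠ 4 → r ≠ 1 → τ4.rreg r = σ.rreg r := fun r h h' h1 =>
    (F4.rreg r (by simp [forLoop, logBody, Prog.KeepsRReg])).trans
      ((F2.rreg r (by simp [forLoop, maxBody, block, Prog.KeepsRReg, Ne.symm h, Ne.symm h1])).trans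
      (F1.rreg r (by simp [forLoop, scanBody, block, Prog.KeepsRReg, Ne.symm h'])))
  have rr41 : τ4.rreg 1 = M₀ := (F4.rreg 1 (by simp [forLoop, logBody, Prog.KeepsRReg])).trans M2'
  have T : τ5.rreg 2 = open Classical in
      if σ.rreg 0 < 1 then (C : ℝ) * (M₀ * (min N (Nat.clog 2 (σ.nreg 0 + σ.nreg 1)) : ℕ)
        / (σ.rreg 0 * σ.rreg 0)) else 0 := by
    rw [← hτ5]
    have e0 := rr4 0 (by decide) (by decide) (by decide)
    have e2 := (rr4 2 (by decide) (by decide) (by decide)).trans (hrreg 2 (by decide))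
    by_cases h : σ.rreg 0 < 1
    · simp [Prog.exec, NExpr.eval, RExpr.eval, Test.Holds, e0, h, L4.1, rr41]
    · simp [Prog.exec, NExpr.eval, RExpr.eval, Test.Holds, e0, e2, h]
  have g5 : ∀ r, r ≠ 4 → r ≠ 5 → r ≠ 6 → τ5.nreg r = σ.nreg r := fun r h h' h'' =>
    (F5.nreg r (by simp [Prog.KeepsNReg])).trans
      ((F4.nreg r (by simp [forLoop, logBody, Prog.KeepsNReg, Ne.symm h, Ne.symm h',
        Ne.symm h''])).trans (by simp [h'', g2 r h]))
  obtain ⟨t6, τ6, r6, ht6, F6, S6⟩ := run_ceil ω (N := N) (σ := τ5)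
    ((g5 2 (by decide) (by decide) (by decide)).trans hN)
    ((g5 7 (by decide) (by decide) (by decide)).trans (hreg 7 (by decide)))
  rw [T] at S6
  have n6 : ∀ a, τ6.narr a = τ1.narr a := fun a =>
    (F6.narr a (by simp [forLoop, ceilBody, Prog.KeepsNArr])).trans
      ((F5.narr a (by simp [Prog.KeepsNArr])).trans
      ((F4.narr a (by simp [forLoop, logBody, Prog.KeepsNArr])).trans
      (F2.narr a (by simp [forLoop, maxBody, block, Prog.KeepsNArr]))))
  have q6 : ∀ a, τ6.rarr a = τ1.rarr a := fun a =>
    (F6.rarr a (by simp [forLoop, ceilBody, Prog.KeepsRArr])).trans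
      ((F5.rarr a (by simp [Prog.KeepsRArr])).trans
      ((F4.rarr a (by simp [forLoop, logBody, Prog.KeepsRArr])).trans
      (F2.rarr a (by simp [forLoop, maxBody, block, Prog.KeepsRArr]))))
  have z1 : ∀ a, 6 ≤ a → τ1.narr a = 0 := fun a h =>
    (F1.narr a (by
      have h4 : (4 : ℕ) ≠ a := by omega
      have h5 : (5 : ℕ) ≠ a := by omega
      simp [forLoop, scanBody, block, Prog.KeepsNArr, h4, h5])).trans (hn a (by omega))
  have g6 : ∀ r, r ≠ 4 → r ≠ 5 → r ≠ 6 → r ≠ 7 → τ6.nreg r = σ.nreg r := fun r h h' h'' h3 =>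
    (F6.nreg r (by simp [forLoop, ceilBody, Prog.KeepsNReg, Ne.symm h, Ne.symm h3])).trans
      (g5 r h h' h'')
  have size1 : ∀ i, τ1.narr 4 i = rowSize (σ.narr 0) N i := fun i => by
    rw [S1.size, acc_one]
  obtain ⟨t7, τ7, r7, ht7, F7, P7⟩ := run_part ω (N := N) (σ := τ6)
    ((g6 2 (by decide) (by decide) (by decide) (by decide)).trans hN)
    (by rw [n6, a0]; exact hsort) (fun q _ => by rw [n6, n6, a0, size1])
    (fun q hq => by rw [n6, n6, a0, S1.start q hq]) (by rw [n6, z1 6 le_rfl])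
    (by rw [n6, z1 7 (by decide)])
  have n7 : ∀ a, a ≠ 6 → a ≠ 7 → a ≠ 8 → τ7.narr a = τ1.narr a := fun a h h' h'' =>
    (F7.narr a (by simp [forLoop, partBody, block, Prog.KeepsNArr, Ne.symm h, Ne.symm h',
      Ne.symm h''])).trans (n6 a)
  have q7 : ∀ a, τ7.rarr a = τ1.rarr a := fun a =>
    (F7.rarr a (by simp [forLoop, partBody, block, Prog.KeepsRArr])).trans (q6 a)
  have b0 : τ6.narr 0 = σ.narr 0 := (n6 0).trans a0
  have c0 : τ7.narr 0 = σ.narr 0 := (n7 0 (by decide) (by decide) (by decide)).trans a0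
  have avg7 : rowAvg τ7 = fun i => acc (σ.narr 0) (fun q => |σ.rarr 0 q|) N i
      / rowSize (σ.narr 0) N i := by
    funext i
    rw [rowAvg, q7, n7 4 (by decide) (by decide) (by decide), S1.rowL1, size1]
  rw [b0] at P7
  have Inv : AliasInv (τ7.narr 0) N (τ7.narr 8) (rowAvg τ7) (fun q => |σ.rarr 0 q|) 0 (τ7.narr 6)
      (τ7.rarr 6) (τ7.narr 9) := by
    rw [c0]
    refine AliasInv.start _ P7 (fun q hq => ?_) (fun i => ?_) (fun q hq => ?_)
      (fun q => abs_nonneg _)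
    · have hp : (0 : ℝ) < rowSize (σ.narr 0) N (σ.narr 0 q) := by
        exact_mod_cast rowSize_pos hq
      rw [Small, b0, n6, q6, q6, size1, S1.rowL1, S1.res q hq, avg7, lt_div_iff₀ hp]
    · rw [avg7]; exact acc_eq_rowSize_mul _ i
    · rw [q7, S1.res q hq]
  obtain ⟨t8, τ8, r8, ht8, F8, A8⟩ := run_alias ω (N := N) (σ := τ7)
    ((F7.nreg 2 (by simp [forLoop, partBody, block, Prog.KeepsNReg])).trans
      ((g6 2 (by decide) (by decide) (by decide) (by decide)).trans hN))
    (by rw [c0]; exact hsort)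
    (fun q hq => by rw [c0, n7 5 (by decide) (by decide) (by decide), S1.start q hq])
    (by rw [c0]; exact P7) Inv
  rw [c0] at A8
  have hrun : Run ω (prepare C) σ _ τ8 :=
    r1.seq (r2.seq (r3.seq (r4.seq (r5.seq (r6.seq (r7.seq (r8.seq (.skip τ8))))))))
  have n8 : ∀ a, a ≠ 6 → a ≠ 7 → a ≠ 8 → a ≠ 9 → τ8.narr a = τ1.narr a := fun a h h' h'' h3 =>
    (F8.narr a (by simp [forLoop, aliasBody, block, Prog.KeepsNArr, Ne.symm h,
      Ne.symm h3])).trans (n7 a h h' h'')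
  have q8 : ∀ a, a ≠ 6 → τ8.rarr a = τ1.rarr a := fun a h =>
    (F8.rarr a (by simp [forLoop, aliasBody, block, Prog.KeepsRArr, Ne.symm h])).trans (q7 a)
  have avg8 : rowAvg τ8 = rowAvg τ7 := by
    funext i
    rw [rowAvg, rowAvg, q8 2 (by decide), q7, n8 4 (by decide) (by decide) (by decide) (by decide),
      n7 4 (by decide) (by decide) (by decide)]
  have g8 : ∀ r, r < 4 → τ8.nreg r = σ.nreg r := fun r h => by
    rw [F8.nreg r, F7.nreg r, g6 r (by omega) (by omega) (by omega) (by omega)]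
    · have h4 : (4 : ℕ) ≠ r := by omega
      simp [forLoop, partBody, block, Prog.KeepsNReg, h4]
    · have h4 : (4 : ℕ) ≠ r := by omega
      have h8 : (8 : ℕ) ≠ r := by omega
      have h9 : (9 : ℕ) ≠ r := by omega
      simp [forLoop, aliasBody, block, Prog.KeepsNReg, h4, h8, h9]
  refine ⟨_, τ8, hrun, ?_, ⟨(g8 2 (by decide)).trans hN, (g8 3 (by decide)).trans (hreg 3 le_rfl),
    ?_, (hrun.frame.pos (prepare_noDraw C)).trans hpos,
    (n8 0 (by decide) (by decide) (by decide) (by decide)).trans a0,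
    (n8 1 (by decide) (by decide) (by decide) (by decide)).trans a1, ?_, ?_, fun q hq => ?_,
    (q8 2 (by decide)).trans S1.rowL1, fun q hq => ?_, ?_, avg8 ▸ A8⟩⟩
  · have h3 : (NExpr.const 1).cost = 1 := rfl
    have h5 : t5 ≤ 40 := ht5.trans (by simp [Prog.steps, Test.cost, RExpr.cost, NExpr.cost])
    have : t1 + (t2 + ((NExpr.const 1).cost + 1 + (t4 + (t5 + (t6 + (t7 + (t8 + 1)))))))
        ≤ prepareSteps * (N + 1) := by
      have e : prepareSteps * (N + 1) = (scanBody.steps + 10) * (N + 1)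
          + (maxBody.steps + 10) * (N + 1) + (logBody.steps + 10) * (N + 1)
          + (ceilBody.steps + 10) * (N + 1) + (partBody.steps + 10) * (N + 1)
          + (aliasBody.steps + 10) * (N + 1) + 50 * (N + 1) := by
        unfold prepareSteps; ring
      omega
    exact this
  · rw [F8.nreg 7 (by simp [forLoop, aliasBody, block, Prog.KeepsNReg]),
      F7.nreg 7 (by simp [forLoop, partBody, block, Prog.KeepsNReg]), S6, sampleSize]
  · rw [q8 0 (by decide)]
    exact F1.rarr 0 (by simp [forLoop, scanBody, block, Prog.KeepsRArr])
  · rw [n8 4 (by decide) (by decide) (by decide) (by decide)]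
    exact funext size1
  · rw [n8 5 (by decide) (by decide) (by decide) (by decide)]
    exact S1.start q hq
  · rw [q8 7 (by decide), S1.abs q hq]
  · rw [n8 10 (by decide) (by decide) (by decide) (by decide), z1 10 (by decide)]

end Prepare
end RowSampling

/-! ### The sampling and output loops -/

namespace RowSampling

section SampleAndOutput

/-- The entry of the row `i` picked by the alias method from two uniform numbers: the first one
chooses a cell of the row, the second one between the entry of the cell and its partner. -/
noncomputable def pickEntry (σ : State) (i : ℕ) (u u' : unitInterval) : ℕ :=
  open Classical in
  if (u' : ℝ) * rowAvg σ i < σ.rarr 6 (σ.narr 5 i + pickNat u (σ.narr 4 i))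
  then σ.narr 5 i + pickNat u (σ.narr 4 i)
  else σ.narr 9 (σ.narr 5 i + pickNat u (σ.narr 4 i))

/-- The position `x` contributes a sample: its row has more than `s` entries, and `x` is one of the
first `s` of them. -/
def Active (σ : State) (x : ℕ) : Prop :=
  σ.nreg 7 < σ.narr 4 (σ.narr 0 x) ∧ x - σ.narr 5 (σ.narr 0 x) < σ.nreg 7

open Classical in
lemma sample_exec (ω : Tape) (τ : State) {p k : ℕ} (hp : τ.nreg 4 = p)
    (hk : pickEntry τ (τ.narr 0 p) (ω τ.pos) (ω (τ.pos + 1)) = k) :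
    (sampleBody.exec ω τ).narr 10
      = Function.update (τ.narr 10) k (τ.narr 10 k + if Active τ p then 1 else 0) ∧
    (sampleBody.exec ω τ).pos = τ.pos + 2 := by
  subst hp hk
  by_cases h : Active τ (τ.nreg 4)
  · have h' := h
    unfold Active at h'
    by_cases h2 : ((ω (τ.pos + 1) : unitInterval) : ℝ) * rowAvg τ (τ.narr 0 (τ.nreg 4))
      < τ.rarr 6 (τ.narr 5 (τ.narr 0 (τ.nreg 4))
        + pickNat (ω τ.pos) (τ.narr 4 (τ.narr 0 (τ.nreg 4))))
    · have h3 := h2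
      unfold rowAvg at h3
      simp [pickEntry, sampleBody, block, Prog.exec, NExpr.eval, RExpr.eval, Test.Holds, rowE, avgE,
        h, h', h2, h3]
    · have h3 := h2
      unfold rowAvg at h3
      simp [pickEntry, sampleBody, block, Prog.exec, NExpr.eval, RExpr.eval, Test.Holds, rowE, avgE,
        h, h', h2, h3]
  · have h' := h
    unfold Active at h'
    simp [sampleBody, block, Prog.exec, NExpr.eval, Test.Holds, rowE, avgE, h, h']

open Classical in
/-- The sampling loop counts, for every entry, the samples that pick it. -/
lemma run_sample (ω : Tape) {σ : State} {N : ℕ} (hN : σ.nreg 2 = N) (hpos : σ.pos = 0)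
    (h10 : σ.narr 10 = 0) :
    ∃ t τ, Run ω (forLoop sampleBody) σ t τ ∧ t ≤ (sampleBody.steps + 10) * (N + 1) ∧
      Frame (forLoop sampleBody) σ τ ∧ (τ.narr 10
        = acc (fun x => pickEntry σ (σ.narr 0 x) (ω (2 * x)) (ω (2 * x + 1)))
          (fun x => if Active σ x then 1 else 0) N ∧ τ.pos = 2 * N) := by
  refine run_forLoop ω (by simp [sampleBody, block, Prog.LoopFree])
    (by simp [sampleBody, block, Prog.KeepsNReg]) (by simp [sampleBody, block, Prog.KeepsNReg])
    (fun k τ => τ.narr 10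
        = acc (fun x => pickEntry σ (σ.narr 0 x) (ω (2 * x)) (ω (2 * x + 1)))
          (fun x => if Active σ x then 1 else 0) k ∧ τ.pos = 2 * k) hN (fun k τ x h => h)
    ⟨by rw [h10, acc_zero], by rw [hpos]⟩ ?_
  intro k hk τ h4 hF h
  have f : ∀ a, a ≠ 10 → τ.narr a = σ.narr a := fun a ha =>
    hF.narr a (by simp [forLoop, sampleBody, block, Prog.KeepsNArr, Ne.symm ha])
  have fr : ∀ a, τ.rarr a = σ.rarr a := fun a =>
    hF.rarr a (by simp [forLoop, sampleBody, block, Prog.KeepsRArr])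
  have f7 : τ.nreg 7 = σ.nreg 7 := hF.nreg 7 (by simp [forLoop, sampleBody, block, Prog.KeepsNReg])
  have e1 : ∀ i u u', pickEntry τ i u u' = pickEntry σ i u u' := fun i u u' => by
    unfold pickEntry rowAvg
    rw [fr, fr, f 4 (by decide), f 5 (by decide), f 9 (by decide)]
  have e2 : Active τ k ↔ Active σ k := by simp [Active, f, f7]
  obtain ⟨x1, x2⟩ := sample_exec ω τ h4 rfl
  refine ⟨?_, by rw [x2, h.2]; ring⟩
  rw [x1, acc_succ, h.1]
  simp only [e1, e2, f 0 (by decide), h.2]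

/-- The position `q` is output: its row is kept, or the entry was picked at least once. -/
def Emitted (σ : State) (q : ℕ) : Prop :=
  σ.nreg 7 < σ.narr 4 (σ.narr 0 q) → 0 < σ.narr 10 q

/-- The value that is output at the position `q`. -/
noncomputable def outValue (σ : State) (q : ℕ) : ℝ :=
  open Classical in
  if σ.nreg 7 < σ.narr 4 (σ.narr 0 q) then
    1 / (σ.nreg 7 : ℝ) * (σ.narr 10 q * (σ.rarr 0 q / (σ.rarr 7 q / σ.rarr 2 (σ.narr 0 q))))
  else σ.rarr 0 q

lemma output_exec_pos (ω : Tape) (τ : State) {k z : ℕ} (hk : τ.nreg 4 = k) (hz : τ.nreg 3 = z)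
    (h : Emitted τ k) :
    (outputBody.exec ω τ).nreg 3 = z + 1 ∧
    (outputBody.exec ω τ).narr 2 = Function.update (τ.narr 2) z (τ.narr 0 k) ∧
    (outputBody.exec ω τ).narr 3 = Function.update (τ.narr 3) z (τ.narr 1 k) ∧
    (outputBody.exec ω τ).rarr 1 = Function.update (τ.rarr 1) z (outValue τ k) := by
  subst hk hz
  unfold Emitted at h
  by_cases h2 : τ.nreg 7 < τ.narr 4 (τ.narr 0 (τ.nreg 4))
  · have h3 := h h2
    simp [outputBody, emit, outValue, block, Prog.exec, NExpr.eval, RExpr.eval, Test.Holds, rowE,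
      colE, h2, h3]
  · simp [outputBody, emit, outValue, block, Prog.exec, NExpr.eval, RExpr.eval, Test.Holds, rowE,
      colE, h2]

lemma output_exec_neg (ω : Tape) (τ : State) {k : ℕ} (hk : τ.nreg 4 = k) (h : ¬ Emitted τ k) :
    outputBody.exec ω τ = τ := by
  subst hk
  unfold Emitted at h
  push Not at h
  simp [outputBody, Prog.exec, NExpr.eval, Test.Holds, rowE, h.1, not_lt.2 h.2]

open Classical in
/-- The output loop lists the emitted positions. Here `l` is the list of the input positions, and the
predicate `e` describes the emitted ones. -/
lemma run_output (ω : Tape) {α : Type*} (l : List α) {σ : State} (hN : σ.nreg 2 = l.length)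
    (h3 : σ.nreg 3 = 0) (R C : α → ℕ) (V : α → ℝ) (e : α → Prop)
    (hR : ∀ k (h : k < l.length), σ.narr 0 k = R l[k])
    (hC : ∀ k (h : k < l.length), σ.narr 1 k = C l[k])
    (he : ∀ k (h : k < l.length), e l[k] ↔ Emitted σ k)
    (hV : ∀ k (h : k < l.length), V l[k] = outValue σ k) :
    ∃ t τ, Run ω (forLoop outputBody) σ t τ ∧ t ≤ (outputBody.steps + 10) * (l.length + 1) ∧
      Frame (forLoop outputBody) σ τ ∧ (τ.nreg 3 = (l.filter e).length ∧
        ∀ z (h : z < (l.filter e).length), τ.narr 2 z = R (l.filter e)[z] ∧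
          τ.narr 3 z = C (l.filter e)[z] ∧ τ.rarr 1 z = V (l.filter e)[z]) := by
  have key := run_forLoop ω (body := outputBody) (by simp [outputBody, emit, block, Prog.LoopFree])
    (by simp [outputBody, emit, block, Prog.KeepsNReg])
    (by simp [outputBody, emit, block, Prog.KeepsNReg])
    (fun k τ => τ.nreg 3 = ((l.take k).filter e).length ∧
        ∀ z (h : z < ((l.take k).filter e).length), τ.narr 2 z = R ((l.take k).filter e)[z] ∧
          τ.narr 3 z = C ((l.take k).filter e)[z] ∧ τ.rarr 1 z = V ((l.take k).filter e)[z])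
    hN (fun k τ x h => ⟨by simpa using h.1, h.2⟩) (by simp [h3]) ?_
  · simpa using key
  intro k hk τ h4 hF h
  have f : ∀ a, a ≠ 2 → a ≠ 3 → τ.narr a = σ.narr a := fun a ha ha' =>
    hF.narr a (by simp [forLoop, outputBody, emit, block, Prog.KeepsNArr, Ne.symm ha, Ne.symm ha'])
  have fr : ∀ a, a ≠ 1 → τ.rarr a = σ.rarr a := fun a ha =>
    hF.rarr a (by simp [forLoop, outputBody, emit, block, Prog.KeepsRArr, Ne.symm ha])
  have f7 : τ.nreg 7 = σ.nreg 7 :=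
    hF.nreg 7 (by simp [forLoop, outputBody, emit, block, Prog.KeepsNReg])
  have e1 : outValue τ k = outValue σ k := by simp [outValue, f, fr, f7]
  have e2 : Emitted τ k ↔ Emitted σ k := by simp [Emitted, f, f7]
  have htake : l.take (k + 1) = l.take k ++ [l[k]] := by simp
  by_cases hE : Emitted τ k
  · obtain ⟨x1, x2, x3, x4⟩ := output_exec_pos ω τ h4 h.1 hE
    have hl : (l.take (k + 1)).filter e = (l.take k).filter e ++ [l[k]] := by
      rw [htake, List.filter_append]
      simp [(he k hk).2 (e2.1 hE)]
    rw [x1, x2, x3, x4, hl]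
    refine ⟨by simp, fun z hz => ?_⟩
    rw [List.length_append, List.length_singleton] at hz
    rcases Nat.lt_succ_iff_lt_or_eq.1 hz with hz | hz
    · rw [Function.update_of_ne hz.ne, Function.update_of_ne hz.ne, Function.update_of_ne hz.ne,
        List.getElem_append_left hz]
      exact h.2 z hz
    · subst hz
      rw [Function.update_self, Function.update_self, Function.update_self]
      simp [f, e1, hR k hk, hC k hk, hV k hk]
  · have hl : (l.take (k + 1)).filter e = (l.take k).filter e := by
      rw [htake, List.filter_append]
      simp [mt (he k hk).1 (mt e2.2 hE)]
    rw [output_exec_neg ω τ h4 hE, hl]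
    exact h

end SampleAndOutput
end RowSampling

/-! ### Listings in memory -/

namespace RowSampling

section Listing

variable {m n : ℕ} {A : Matrix (Fin m) (Fin n) ℝ} {l : List (Fin m × Fin n)} {ε : ℝ}

lemma inputState_row (k : ℕ) (h : k < l.length) : (inputState A l ε).narr 0 k = l[k].1 := by
  simp [inputState, h]

lemma inputState_col (k : ℕ) (h : k < l.length) : (inputState A l ε).narr 1 k = l[k].2 := by
  simp [inputState, h]

lemma inputState_val (k : ℕ) (h : k < l.length) :
    (inputState A l ε).rarr 0 k = A l[k].1 l[k].2 := by
  simp [inputState, h]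

lemma IsListing.val_ne_zero (hl : IsListing A l) (k : ℕ) (h : k < l.length) :
    A l[k].1 l[k].2 ≠ 0 := (hl.2.1 _).1 (List.getElem_mem h)

lemma IsListing.exists_getElem (hl : IsListing A l) {i : Fin m} {j : Fin n} (h : A i j ≠ 0) :
    ∃ k, ∃ hk : k < l.length, l[k] = (i, j) :=
  List.getElem_of_mem ((hl.2.1 (i, j)).2 h)

lemma IsListing.sorted (hl : IsListing A l) :
    SortedRows ((inputState A l ε).narr 0) l.length := by
  intro p q hpq hq
  rw [inputState_row p (hpq.trans_lt hq), inputState_row q hq]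
  rcases hpq.eq_or_lt with rfl | hlt
  · exact le_rfl
  · exact List.pairwise_iff_getElem.1 hl.2.2 p q _ hq hlt

/-- A sum over the listed positions is a sum over all entries. -/
lemma IsListing.sum_eq (hl : IsListing A l) {M : Type*} [AddCommMonoid M] {g : ℕ → M}
    {f : Fin m × Fin n → M} (hg : ∀ k (hk : k < l.length), g k = f l[k])
    (hf : ∀ p, A p.1 p.2 = 0 → f p = 0) : ∑ q ∈ Finset.range l.length, g q = ∑ p, f p := by
  rw [Finset.sum_range]
  calc ∑ k : Fin l.length, g k = ∑ k : Fin l.length, f l[k] :=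
        Finset.sum_congr rfl fun k _ => hg k k.2
    _ = (l.map f).sum := Fin.sum_univ_fun_getElem l f
    _ = ∑ p ∈ l.toFinset, f p := (List.sum_toFinset f hl.1).symm
    _ = ∑ p, f p := Finset.sum_subset (Finset.subset_univ _) fun p _ hp =>
        hf p (not_not.1 fun h => hp (by rwa [List.mem_toFinset, hl.2.1]))

/-- The row sums over the list are row sums of the matrix. -/
lemma IsListing.acc_row (hl : IsListing A l) {M : Type*} [AddCommMonoid M] {g : ℝ → M}
    (hg : g 0 = 0) (i : Fin m) :
    acc ((inputState A l ε).narr 0) (fun q => g ((inputState A l ε).rarr 0 q)) l.length i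
      = ∑ j, g (A i j) := by
  rw [acc, hl.sum_eq (f := fun p => if p.1 = i then g (A p.1 p.2) else 0), Fintype.sum_prod_type,
    Finset.sum_eq_single i]
  · simp
  · intro i' _ h; simp [h]
  · simp
  · intro k hk
    simp only [inputState_row k hk, inputState_val k hk, Fin.val_inj]
  · intro p hp
    simp [hp, hg]

/-- The column sums over the list are column sums of the matrix. -/
lemma IsListing.acc_col (hl : IsListing A l) {M : Type*} [AddCommMonoid M] {g : ℝ → M}
    (hg : g 0 = 0) (j : Fin n) :
    acc ((inputState A l ε).narr 1) (fun q => g ((inputState A l ε).rarr 0 q)) l.length j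
      = ∑ i, g (A i j) := by
  rw [acc, hl.sum_eq (f := fun p => if p.2 = j then g (A p.1 p.2) else 0), Fintype.sum_prod_type]
  · simp
  · intro k hk
    simp only [inputState_col k hk, inputState_val k hk, Fin.val_inj]
  · intro p hp
    simp [hp, hg]

lemma IsListing.rowSize_eq (hl : IsListing A l) (i : Fin m) :
    rowSize ((inputState A l ε).narr 0) l.length i = rowNnz A i := by
  classical
  have h := hl.acc_row (ε := ε) (g := fun x : ℝ => if x = 0 then (0 : ℕ) else 1) (by simp) i
  rw [← acc_one]
  have e : acc ((inputState A l ε).narr 0) (fun _ => 1) l.length i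
      = acc ((inputState A l ε).narr 0)
        (fun q => if (inputState A l ε).rarr 0 q = 0 then (0 : ℕ) else 1) l.length i := by
    refine Finset.sum_congr rfl fun q hq => ?_
    have hq := Finset.mem_range.1 hq
    simp only [inputState_val q hq, hl.val_ne_zero q hq, if_false]
  rw [e, h, rowNnz, Set.ncard_eq_toFinset_card', Set.toFinset_ofPred, Finset.card_filter]
  refine Finset.sum_congr rfl fun j _ => ?_
  by_cases h : A i j = 0 <;> simp [h]

lemma IsListing.length_eq (hl : IsListing A l) : l.length = nnz A := by
  classical
  rw [nnz, ← List.toFinset_card_of_nodup hl.1, ← Set.ncard_coe_finset]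
  congr 1
  ext p
  simp [hl.2.1 p]

lemma rowNnz_le_nnz (A : Matrix (Fin m) (Fin n) ℝ) (i : Fin m) : rowNnz A i ≤ nnz A := by
  refine Set.ncard_le_ncard_of_injOn (fun j => (i, j)) (fun j hj => hj) (fun j _ j' _ h => ?_)
    (Set.toFinite _)
  exact (Prod.ext_iff.1 h).2

/-- The computed maximum is the numerical sparsity of the matrix. -/
lemma IsListing.maxRatio_eq (hl : IsListing A l) {τ : State} {M : ℝ}
    (h0 : τ.narr 0 = (inputState A l ε).narr 0) (h1 : τ.narr 1 = (inputState A l ε).narr 1)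
    (hS : Scanned ((inputState A l ε).narr 0) ((inputState A l ε).narr 1)
      ((inputState A l ε).rarr 0) l.length l.length τ) (hM : MaxRatio τ l.length M) : M = ns A := by
  have hrow : ∀ i : Fin m, rowRatio τ i = vecNs (fun j => A i j) := fun i => by
    rw [rowRatio, hS.rowL1, hS.rowL2, hl.acc_row (g := fun x => |x|) abs_zero,
      hl.acc_row (g := fun x => |x| * |x|) (by simp), vecNs_eq]
    simp [pow_two]
  have hcol : ∀ j : Fin n, colRatio τ j = vecNs (fun i => A i j) := fun j => by
    rw [colRatio, hS.colL1, hS.colL2, hl.acc_col (g := fun x => |x|) abs_zero,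
      hl.acc_col (g := fun x => |x| * |x|) (by simp), vecNs_eq]
    simp [pow_two]
  have hzero : ∀ {ι : Type} [Fintype ι] (a : ι → ℝ), (∀ x, a x = 0) → vecNs a = 0 :=
    fun a ha => by rw [vecNs_eq]; simp [ha]
  refine le_antisymm (hM.le _ (ns_nonneg A) (fun q hq => ?_) (fun q hq => ?_))
    (ns_le A hM.nonneg (fun i => ?_) (fun j => ?_))
  · rw [h0, inputState_row q hq, hrow]; exact vecNs_row_le A _
  · rw [h1, inputState_col q hq, hcol]; exact vecNs_col_le A _
  · by_cases h : ∀ j, A i j = 0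
    · rw [hzero _ h]; exact hM.nonneg
    · push Not at h
      obtain ⟨j, hj⟩ := h
      obtain ⟨k, hk, hkl⟩ := hl.exists_getElem hj
      have := hM.row_le k hk
      rwa [h0, inputState_row k hk, hkl, hrow] at this
  · by_cases h : ∀ i, A i j = 0
    · rw [hzero _ h]; exact hM.nonneg
    · push Not at h
      obtain ⟨i, hi⟩ := h
      obtain ⟨k, hk, hkl⟩ := hl.exists_getElem hi
      have := hM.col_le k hk
      rwa [h1, inputState_col k hk, hkl, hcol] at this

end Listing
end RowSampling

/-! ### The law of the picked entries -/

namespace RowSampling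

section Law
open ProbabilityTheory

lemma pickNat_lt {k : ℕ} (hk : 0 < k) (u : ℝ) : pickNat u k < k := by
  unfold pickNat; omega

lemma measurable_pickNat (k : ℕ) : Measurable fun u : unitInterval => pickNat u k := by
  unfold pickNat
  exact (Nat.measurable_floor.comp (measurable_subtype_coe.mul_const _)).min measurable_const

lemma volume_pickNat_lt {k y : ℕ} (hk : 0 < k) (hy : y ≤ k) :
    volume {u : unitInterval | pickNat u k < y} = ENNReal.ofReal (y / k) := by
  have hk' : (0 : ℝ) < k := by exact_mod_cast hk
  rcases hy.lt_or_eq with h | rfl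
  · have hyk : (y : ℝ) / k ∈ unitInterval :=
      ⟨by positivity, (div_le_one hk').2 (by exact_mod_cast hy)⟩
    have : {u : unitInterval | pickNat u k < y} = Set.Iio ⟨(y : ℝ) / k, hyk⟩ := by
      ext u
      have h1 : pickNat u k < y ↔ ⌊(u : ℝ) * k⌋₊ < y := by unfold pickNat; omega
      rw [Set.mem_ofPred_eq, h1, Nat.floor_lt (mul_nonneg u.2.1 hk'.le), Set.mem_Iio,
        ← Subtype.coe_lt_coe, lt_div_iff₀ hk']
    rw [this, unitInterval.volume_Iio]
  · rw [div_self hk'.ne', ENNReal.ofReal_one]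
    simp [pickNat_lt hk]

lemma volume_pickNat_eq {k y : ℕ} (hy : y < k) :
    volume {u : unitInterval | pickNat u k = y} = ENNReal.ofReal (1 / k) := by
  have hk : 0 < k := by omega
  have hm : MeasurableSet {u : unitInterval | pickNat u k < y} :=
    measurable_pickNat k measurableSet_Iio
  have : {u : unitInterval | pickNat u k = y}
      = {u : unitInterval | pickNat u k < y + 1} \ {u : unitInterval | pickNat u k < y} := by
    ext u
    simp only [Set.mem_ofPred_eq, Set.mem_sdiff]
    omega
  have hsub : {u : unitInterval | pickNat u k < y} ⊆ {u : unitInterval | pickNat u k < y + 1} :=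
    fun u hu => Nat.lt_succ_of_lt hu
  have h1 := volume_pickNat_lt hk (Nat.succ_le_of_lt hy)
  rw [Nat.succ_eq_add_one] at h1
  rw [this, measure_sdiff hsub
    hm.nullMeasurableSet (measure_ne_top _ _), volume_pickNat_lt hk hy.le,
    h1, ← ENNReal.ofReal_sub _ (by positivity)]
  congr 1
  push_cast
  ring

/-- `pickNat` turns a uniform real number into a uniform natural number. -/
lemma lintegral_pickNat {k : ℕ} (hk : 0 < k) (f : ℕ → ENNReal) :
    ∫⁻ u : unitInterval, f (pickNat u k) = ∑ y ∈ Finset.range k, ENNReal.ofReal (1 / k) * f y := by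
  rw [← lintegral_map (g := fun u : unitInterval => pickNat u k) measurable_from_nat
    (measurable_pickNat k)]
  have : (volume : Measure unitInterval).map (fun u : unitInterval => pickNat u k)
      = ∑ y ∈ Finset.range k, ENNReal.ofReal (1 / k) • Measure.dirac y := by
    refine Measure.ext_of_singleton fun y => ?_
    rw [Measure.map_apply (measurable_pickNat k) (measurableSet_singleton y)]
    simp only [Measure.coe_finsetSum, Finset.sum_apply, Measure.smul_apply, smul_eq_mul,
      Measure.dirac_apply, Set.indicator_apply, Set.mem_singleton_iff, Pi.one_apply, mul_ite,
      mul_one, mul_zero, Finset.sum_ite_eq', Finset.mem_range]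
    split_ifs with h
    · exact volume_pickNat_eq h
    · have : (fun u : unitInterval => pickNat u k) ⁻¹' {y} = ∅ := by
        ext u
        have := pickNat_lt hk u
        simp only [Set.mem_preimage, Set.mem_singleton_iff, Set.mem_empty_iff_false, iff_false]
        omega
      rw [this, measure_empty]
  rw [this, lintegral_finsetSum_measure]
  simp

lemma volume_mul_lt {x μ : ℝ} (hx : 0 ≤ x) (hμ : 0 < μ) (hxμ : x ≤ μ) :
    volume {u : unitInterval | (u : ℝ) * μ < x} = ENNReal.ofReal (x / μ) := by
  have : {u : unitInterval | (u : ℝ) * μ < x}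
      = Set.Iio ⟨x / μ, div_nonneg hx hμ.le, (div_le_one hμ).2 hxμ⟩ := by
    ext u
    rw [Set.mem_ofPred_eq, Set.mem_Iio, ← Subtype.coe_lt_coe, lt_div_iff₀ hμ]
  rw [this, unitInterval.volume_Iio]

open Classical in
/-- The law of the choice within one cell of an alias table. -/
lemma volume_choice {x μ : ℝ} (hx : 0 ≤ x) (hμ : 0 < μ) (hxμ : x ≤ μ) (k k' q : ℕ) :
    volume {u : unitInterval | (if (u : ℝ) * μ < x then k else k') = q}
      = ENNReal.ofReal ((if k = q then x / μ else 0) + (if k' = q then 1 - x / μ else 0)) := by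
  have h1 : x / μ ≤ 1 := (div_le_one hμ).2 hxμ
  have hm : MeasurableSet {u : unitInterval | (u : ℝ) * μ < x} :=
    measurableSet_lt (measurable_subtype_coe.mul_const _) measurable_const
  by_cases hk : k = q <;> by_cases hk' : k' = q
  · simp [hk, hk']
  · have : ∀ u : unitInterval, (if (u : ℝ) * μ < x then k else k') = q ↔ (u : ℝ) * μ < x := by
      intro u; split_ifs with h <;> simp [h, hk, hk']
    simp only [this]
    rw [if_pos hk, if_neg hk', add_zero]
    exact volume_mul_lt hx hμ hxμ
  · have : {u : unitInterval | (if (u : ℝ) * μ < x then k else k') = q}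
        = {u : unitInterval | (u : ℝ) * μ < x}ᶜ := by
      ext u
      simp only [Set.mem_ofPred_eq, Set.mem_compl_iff]
      split_ifs with h <;> simp [h, hk, hk']
    rw [this, prob_compl_eq_one_sub hm, volume_mul_lt hx hμ hxμ, if_neg hk, if_pos hk', zero_add,
      ENNReal.ofReal_sub _ (div_nonneg hx hμ.le), ENNReal.ofReal_one]
  · have : ∀ u : unitInterval, ¬ (if (u : ℝ) * μ < x then k else k') = q := by
      intro u; split_ifs <;> assumption
    simp [this, hk, hk']

section Pick
variable {row col : ℕ → ℕ} {v : ℕ → ℝ} {N s : ℕ} {τ : State}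

lemma measurable_pickEntry (σ : State) (i : ℕ) :
    Measurable fun u : unitInterval × unitInterval => pickEntry σ i u.1 u.2 := by
  have h1 : Measurable fun u : unitInterval × unitInterval =>
      σ.narr 5 i + pickNat u.1 (σ.narr 4 i) :=
    measurable_const.add ((measurable_pickNat _).comp measurable_fst)
  unfold pickEntry
  refine Measurable.ite (measurableSet_lt ?_ ?_) h1 (measurable_from_nat.comp h1)
  · exact (measurable_subtype_coe.comp measurable_snd).mul_const _
  · exact measurable_from_nat.comp h1

lemma SortedRows.cell (hs : SortedRows row N) {q : ℕ} {y : ℕ}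
    (hy : y < rowSize row N (row q)) :
    rowStart row N (row q) + y < N ∧ row (rowStart row N (row q) + y) = row q := by
  have h1 := rowStart_add_rowSize_le row N (row q)
  have h2 : rowStart row N (row q) + y < N := by omega
  exact ⟨h2, (row_eq_iff hs h2).2 ⟨by omega, by omega⟩⟩

/-- A picked entry lies in the row from which it is picked. -/
lemma Prepared.pickEntry_mem (hτ : Prepared row col v N s τ) (hs : SortedRows row N) {q : ℕ} (hq : q < N) (u u' : unitInterval) :
    pickEntry τ (row q) u u' < N ∧ row (pickEntry τ (row q) u u') = row q := by
  obtain ⟨h1, h2⟩ := hs.cell (pickNat_lt (rowSize_pos hq) u)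
  unfold pickEntry
  rw [hτ.start q hq, hτ.size]
  split_ifs
  · exact ⟨h1, h2⟩
  · exact ⟨hτ.table.lt _ h1, (hτ.table.row_eq _ h1).trans h2⟩

/-- An entry is picked with probability proportional to its absolute value. -/
lemma Prepared.volume_pickEntry (hτ : Prepared row col v N s τ) (hs : SortedRows row N) {q : ℕ}
    (hq : q < N) (hv : v q ≠ 0) :
    (volume.prod volume) {u : unitInterval × unitInterval | pickEntry τ (row q) u.1 u.2 = q}
      = ENNReal.ofReal (|v q| / acc row (fun q => |v q|) N (row q)) := by
  classical
  set i := row q with hi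
  set S := rowSize row N i with hS
  set W := acc row (fun q => |v q|) N i with hW
  set r := τ.rarr 6 with hr
  set al := τ.narr 9 with hal
  have hSpos : 0 < S := rowSize_pos hq
  have hSr : (0 : ℝ) < S := by exact_mod_cast hSpos
  have hWpos : 0 < W := by
    refine Finset.sum_pos' (fun x _ => ?_) ⟨q, by simpa using hq, by simpa [hi] using hv⟩
    split_ifs
    · exact abs_nonneg _
    · exact le_rfl
  have hμ : rowAvg τ i = W / S := by rw [rowAvg, hτ.rowL1, hτ.size]
  have hμpos : 0 < rowAvg τ i := by rw [hμ]; positivity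
  have hcell : ∀ y < S, rowStart row N i + y < N ∧ row (rowStart row N i + y) = i :=
    fun y hy => hs.cell hy
  set g : ℕ → ℝ := fun k => (if k = q then r k / rowAvg τ i else 0)
    + (if al k = q then 1 - r k / rowAvg τ i else 0) with hg
  have hle : ∀ y < S, r (rowStart row N i + y) ≤ rowAvg τ i := fun y hy => by
    have := hτ.table.le_avg _ (hcell y hy).1
    rwa [(hcell y hy).2] at this
  have h0 : ∀ y < S, 0 ≤ r (rowStart row N i + y) := fun y hy =>
    hτ.table.nonneg _ (hcell y hy).1
  have hg0 : ∀ y < S, 0 ≤ g (rowStart row N i + y) := fun y hy => by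
    have h1 := hle y hy
    have h2 := h0 y hy
    have h3 := (div_le_one hμpos).2 h1
    have h4 := div_nonneg h2 hμpos.le
    simp only [hg]
    split_ifs <;> linarith
  have hmeas : MeasurableSet {u : unitInterval × unitInterval | pickEntry τ i u.1 u.2 = q} :=
    measurable_pickEntry τ i (measurableSet_singleton q)
  rw [Measure.prod_apply hmeas]
  have e1 : ∀ u : unitInterval,
      volume (Prod.mk u ⁻¹' {u : unitInterval × unitInterval | pickEntry τ i u.1 u.2 = q})
      = ENNReal.ofReal (g (rowStart row N i + pickNat u S)) := by
    intro u
    have hy := pickNat_lt hSpos u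
    have hset : Prod.mk u ⁻¹' {u : unitInterval × unitInterval | pickEntry τ i u.1 u.2 = q}
        = {u' : unitInterval | (if (u' : ℝ) * rowAvg τ i < r (rowStart row N i + pickNat u S)
          then rowStart row N i + pickNat u S else al (rowStart row N i + pickNat u S)) = q} := by
      ext u'
      simp only [Set.mem_preimage, Set.mem_ofPred_eq]
      unfold pickEntry
      rw [hτ.start q hq, hτ.size]
    rw [hset]
    exact volume_choice (h0 _ hy) hμpos (hle _ hy) _ _ _
  simp_rw [e1]
  rw [lintegral_pickNat hSpos (fun y => ENNReal.ofReal (g (rowStart row N i + y)))]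
  have e2 : ∀ y ∈ Finset.range S, ENNReal.ofReal (1 / S) * ENNReal.ofReal (g (rowStart row N i + y))
      = ENNReal.ofReal (1 / S * g (rowStart row N i + y)) := fun y _ =>
    (ENNReal.ofReal_mul (by positivity)).symm
  rw [Finset.sum_congr rfl e2, ← ENNReal.ofReal_sum_of_nonneg fun y hy =>
    mul_nonneg (by positivity) (hg0 y (Finset.mem_range.1 hy)), ← Finset.mul_sum]
  congr 1
  -- the cells of the row are the positions of its entries
  have e3 : ∑ y ∈ Finset.range S, g (rowStart row N i + y)
      = ∑ k ∈ Finset.range N, if row k = i then g k else 0 := by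
    rw [← Finset.sum_filter]
    refine Finset.sum_bij (fun y _ => rowStart row N i + y) (fun y hy => ?_)
      (fun y _ y' _ h => by simpa using h) (fun k hk => ?_) (fun _ _ => rfl)
    · have := hcell y (Finset.mem_range.1 hy)
      simp [this.1, this.2]
    · obtain ⟨hkN, hk⟩ := Finset.mem_filter.1 hk
      have := (row_eq_iff hs (Finset.mem_range.1 hkN)).1 hk
      exact ⟨k - rowStart row N i, by rw [Finset.mem_range]; omega, by omega⟩
  have e4 : ∑ k ∈ Finset.range N, (if row k = i then g k else 0) = |v q| / rowAvg τ i := by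
    rw [← hτ.table.weight q hq, add_div, Finset.sum_div]
    have : ∀ k ∈ Finset.range N, (if row k = i then g k else 0)
        = (if k = q then r k / rowAvg τ i else 0)
          + (if al k = q then rowAvg τ (row k) - r k else 0) / rowAvg τ i := by
      intro k hk
      have hk := Finset.mem_range.1 hk
      by_cases hki : row k = i
      · rw [if_pos hki, hki, hg]
        simp only
        congr 1
        split_ifs
        · rw [sub_div, div_self hμpos.ne']
        · simp
      · have h1 : k ≠ q := fun h => hki (by rw [h])
        have h2 : al k ≠ q := fun h => hki (by rw [← hτ.table.row_eq k hk, ← hal, h])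
        simp [hki, h1, h2]
    rw [Finset.sum_congr rfl this, Finset.sum_add_distrib]
    congr 1
    simp [hq, hr]
  rw [e3, e4, hμ]
  field_simp

end Pick

/-- Disjoint pairs of tape entries are independent pairs of independent uniform numbers. -/
lemma map_tapeMeasure {ι : Type*} [Fintype ι] {β : Type*} [MeasurableSpace β]
    {x : ι → ℕ} (hx : Function.Injective x) {G : ι → unitInterval × unitInterval → β}
    (hG : ∀ i, Measurable (G i)) :
    tapeMeasure.map (fun ω i => G i (ω (2 * x i), ω (2 * x i + 1)))
      = Measure.pi fun i => (volume.prod volume).map (G i) := by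
  have hinj : Function.Injective fun p : ι × Fin 2 => 2 * x p.1 + p.2 := by
    rintro ⟨i, a⟩ ⟨j, b⟩ h
    have ha : (a : ℕ) < 2 := a.2
    have hb : (b : ℕ) < 2 := b.2
    change 2 * x i + (a : ℕ) = 2 * x j + (b : ℕ) at h
    have h1 : x i = x j := by omega
    exact Prod.ext (hx h1) (Fin.ext (show (a : ℕ) = b by omega))
  have hcurry : tapeMeasure.map (fun ω (i : ι) (a : Fin 2) => ω (2 * x i + a))
      = Measure.infinitePi fun _ : ι => Measure.infinitePi fun _ : Fin 2 =>
        (volume : Measure unitInterval) := by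
    rw [← Measure.infinitePi_map_curry (fun (_ : ι) (_ : Fin 2) => (volume : Measure unitInterval)),
      ← Measure.map_infinitePi_infinitePi_of_inj (P := fun _ : ℕ => (volume : Measure unitInterval))
        hinj, Measure.map_map (by fun_prop) (by fun_prop)]
    rfl
  have hmap : tapeMeasure.map (fun ω i => G i (ω (2 * x i), ω (2 * x i + 1)))
      = (tapeMeasure.map (fun ω (i : ι) (a : Fin 2) => ω (2 * x i + a))).map
        (fun f i => G i (f i 0, f i 1)) := by
    rw [Measure.map_map (by fun_prop) (by fun_prop)]
    rfl
  have hpair : (Measure.infinitePi fun _ : Fin 2 => (volume : Measure unitInterval)).map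
      (fun f => (f 0, f 1)) = volume.prod volume :=
    Measure.infinitePi_map_eval_prod (by decide)
  have hpi := Measure.pi_map_pi
    (μ := fun _ : ι => Measure.infinitePi fun _ : Fin 2 => (volume : Measure unitInterval))
    (f := fun i f => G i (f 0, f 1)) (fun i => by fun_prop)
  rw [hmap, hcurry, Measure.infinitePi_eq_pi, hpi]
  congr 1
  funext i
  rw [← hpair, Measure.map_map (hG i) (by fun_prop)]
  rfl

end Law
end RowSampling

/-! ### The output matrix -/

namespace RowSampling

section Output

variable {m n : ℕ} {A : Matrix (Fin m) (Fin n) ℝ} {l : List (Fin m × Fin n)} {ε : ℝ} {s : ℕ}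
  {τ : State}

/-- The sample of the row `i` that picks the entry with position `q` in the list. For the zero row this
is `0` for every `q`, since the coefficients are `0`. -/
noncomputable def sampleValue (A : Matrix (Fin m) (Fin n) ℝ) (l : List (Fin m × Fin n)) (i : Fin m)
    (q : ℕ) : Fin n → ℝ :=
  open Classical in
  fun j => if ∃ h : q < l.length, l[q].2 = j then drawCoeff (A i) j else 0

lemma sampleValue_eq {q : ℕ} (hq : q < l.length) (i : Fin m) :
    sampleValue A l i q = drawValue (A i) l[q].2 := by
  funext j
  by_cases h : l[q].2 = j
  · subst h
    simp [sampleValue, drawValue, hq]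
  · simp [sampleValue, drawValue, hq, h, Ne.symm h]

/-- The alias method draws the samples of a row with the right law. -/
lemma map_sampleValue (hl : IsListing A l)
    (hτ : Prepared ((inputState A l ε).narr 0) ((inputState A l ε).narr 1)
      ((inputState A l ε).rarr 0) l.length s τ) (i : Fin m) :
    (volume.prod volume).map (fun u : unitInterval × unitInterval =>
      sampleValue A l i (pickEntry τ i u.1 u.2)) = rowDraw (A i) := by
  classical
  by_cases hA : A i = 0
  · have : ∀ q, sampleValue A l i q = 0 := fun q => by
      funext j; simp [sampleValue, drawCoeff, hA]
    simp [this, rowDraw, hA, Measure.map_const]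
  have hs := hl.sorted (ε := ε)
  have hW : acc ((inputState A l ε).narr 0) (fun q => |(inputState A l ε).rarr 0 q|) l.length i
      = ∑ j, |A i j| := hl.acc_row (g := fun x => |x|) abs_zero i
  obtain ⟨j₀, hj₀⟩ := Function.ne_iff.1 hA
  obtain ⟨q₀, hq₀, hl₀⟩ := hl.exists_getElem hj₀
  have hrow₀ : (inputState A l ε).narr 0 q₀ = i := by rw [inputState_row q₀ hq₀, hl₀]
  have hJ := measurable_pickEntry τ (i : ℕ)
  have hv : Measurable (sampleValue A l i) := measurable_from_nat
  set w : ℕ → ENNReal := fun q => ENNReal.ofReal (if (inputState A l ε).narr 0 q = i then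
    |(inputState A l ε).rarr 0 q| / ∑ j, |A i j| else 0) with hw
  have hlaw : (volume.prod volume).map (fun u : unitInterval × unitInterval =>
      pickEntry τ i u.1 u.2) = ∑ q ∈ Finset.range l.length, w q • Measure.dirac q := by
    refine Measure.ext_of_singleton fun z => ?_
    rw [Measure.map_apply hJ (measurableSet_singleton z)]
    simp only [Measure.coe_finsetSum, Finset.sum_apply, Measure.smul_apply, smul_eq_mul,
      Measure.dirac_apply, Set.indicator_apply, Set.mem_singleton_iff, Pi.one_apply, mul_ite,
      mul_one, mul_zero, Finset.sum_ite_eq', Finset.mem_range]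
    by_cases hz : z < l.length ∧ (inputState A l ε).narr 0 z = i
    · have hne : (inputState A l ε).rarr 0 z ≠ 0 := by
        rw [inputState_val z hz.1]; exact hl.val_ne_zero z hz.1
      have := hτ.volume_pickEntry hs hz.1 hne
      rw [hz.2, hW] at this
      rw [if_pos hz.1, hw]
      simp only [if_pos hz.2]
      exact this
    · have hempty : (fun u : unitInterval × unitInterval => pickEntry τ i u.1 u.2) ⁻¹' {z} = ∅ := by
        refine Set.eq_empty_of_forall_notMem fun u hu => hz ?_
        have := hτ.pickEntry_mem hs hq₀ u.1 u.2
        rw [hrow₀] at this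
        rwa [show pickEntry τ i u.1 u.2 = z from hu] at this
      rw [hempty, measure_empty]
      split_ifs with h
      · simp only [hw, if_neg fun h' => hz ⟨h, h'⟩, ENNReal.ofReal_zero]
      · rfl
  have hcomp : (volume.prod volume).map (fun u : unitInterval × unitInterval =>
      sampleValue A l i (pickEntry τ i u.1 u.2))
      = ((volume.prod volume).map (fun u : unitInterval × unitInterval =>
        pickEntry τ i u.1 u.2)).map (sampleValue A l i) := (Measure.map_map hv hJ).symm
  rw [hcomp, hlaw, Measure.map_finset_sum hv.aemeasurable]
  simp_rw [Measure.map_smul, Measure.map_dirac' hv]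
  rw [hl.sum_eq (f := fun p => ENNReal.ofReal (if p.1 = i then l1Prob (A i) p.2 else 0)
    • Measure.dirac (drawValue (A i) p.2)), Fintype.sum_prod_type, Finset.sum_eq_single i]
  · simp [rowDraw, hA, drawValue, drawCoeff]
  · intro i' _ h
    simp [h]
  · simp
  · intro k hk
    rw [sampleValue_eq hk, hw]
    congr 2
    simp only [inputState_row k hk, inputState_val k hk, Fin.val_inj]
    by_cases h : l[k].1 = i
    · simp [h, l1Prob]
    · simp [h]
  · intro p hp
    by_cases h : p.1 = i
    · rw [h] at hp
      simp [l1Prob, hp]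
    · simp [h]

/-- The tape position of the `t`-th sample of the row `i`. Rows with at most `s` entries are not
sampled by the algorithm, and are assigned positions which it does not use. -/
noncomputable def samplePos (A : Matrix (Fin m) (Fin n) ℝ) (row : ℕ → ℕ) (N s : ℕ)
    (it : Fin m × Fin s) : ℕ :=
  open Classical in
  if rowNnz A it.1 ≤ s then N + (it.1 * s + it.2) else rowStart row N it.1 + it.2

lemma samplePos_injective (hl : IsListing A l) :
    Function.Injective (samplePos A ((inputState A l ε).narr 0) l.length s) := by
  have hs := hl.sorted (ε := ε)
  have hcell : ∀ it : Fin m × Fin s, ¬ rowNnz A it.1 ≤ s →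
      rowStart ((inputState A l ε).narr 0) l.length it.1 + it.2 < l.length ∧
      (inputState A l ε).narr 0
        (rowStart ((inputState A l ε).narr 0) l.length it.1 + it.2) = it.1 := by
    intro it h
    have h1 := it.2.2
    have h2 := rowStart_add_rowSize_le ((inputState A l ε).narr 0) l.length it.1
    have h3 := hl.rowSize_eq (ε := ε) it.1
    have h4 : rowStart ((inputState A l ε).narr 0) l.length it.1 + it.2 < l.length := by omega
    exact ⟨h4, (row_eq_iff hs h4).2 ⟨by omega, by omega⟩⟩
  rintro it it' h
  by_cases h1 : rowNnz A it.1 ≤ s <;> by_cases h2 : rowNnz A it'.1 ≤ s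
  · simp only [samplePos, h1, h2, if_true] at h
    have h3 : it.1.1 * s + it.2.1 = it'.1.1 * s + it'.2.1 := by omega
    have hpos : 0 < s := (Nat.zero_le _).trans_lt it.2.2
    have e1 : it.1.1 = it'.1.1 := by
      have := congrArg (· / s) h3
      simpa [Nat.mul_comm _ s, Nat.mul_add_div hpos, Nat.div_eq_of_lt it.2.2,
        Nat.div_eq_of_lt it'.2.2] using this
    have e2 : it.2.1 = it'.2.1 := by rw [e1] at h3; omega
    exact Prod.ext (Fin.ext e1) (Fin.ext e2)
  · have := (hcell it' h2).1
    simp only [samplePos, h1, h2, if_true, if_false] at h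
    omega
  · have := (hcell it h1).1
    simp only [samplePos, h1, h2, if_true, if_false] at h
    omega
  · have c1 := (hcell it h1).2
    have c2 := (hcell it' h2).2
    simp only [samplePos, h1, h2, if_false] at h
    have e1 : it.1.1 = it'.1.1 := by rw [← c1, h, c2]
    have e2 : it.2.1 = it'.2.1 := by rw [e1] at h; omega
    exact Prod.ext (Fin.ext e1) (Fin.ext e2)

/-- The samples as functions of the tape, where `τ` is the memory with the alias tables. -/
noncomputable def tapeSamples (A : Matrix (Fin m) (Fin n) ℝ) (l : List (Fin m × Fin n)) (s : ℕ)
    (τ : State) (row : ℕ → ℕ) (ω : Tape) (it : Fin m × Fin s) : Fin n → ℝ :=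
  sampleValue A l it.1 (pickEntry τ it.1 (ω (2 * samplePos A row l.length s it))
    (ω (2 * samplePos A row l.length s it + 1)))

/-- The output matrix as a function of the tape. -/
noncomputable def outMatrix (A : Matrix (Fin m) (Fin n) ℝ) (l : List (Fin m × Fin n)) (s : ℕ)
    (τ : State) (row : ℕ → ℕ) (ω : Tape) : Fin m → Fin n → ℝ :=
  assemble A s {i | rowNnz A i ≤ s} (tapeSamples A l s τ row ω)

lemma measurable_tapeSamples (row : ℕ → ℕ) : Measurable (tapeSamples A l s τ row) := by
  refine measurable_pi_iff.2 fun it => ?_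
  have h1 : Measurable (sampleValue A l it.1) := measurable_from_nat
  have h2 : Measurable fun ω : Tape => (ω (2 * samplePos A row l.length s it),
    ω (2 * samplePos A row l.length s it + 1)) := by fun_prop
  exact h1.comp ((measurable_pickEntry τ it.1).comp h2)

lemma measurable_outMatrix (row : ℕ → ℕ) : Measurable (outMatrix A l s τ row) :=
  (measurable_assemble A s _).comp (measurable_tapeSamples row)

/-- The output has the law of row sampling. -/
lemma map_outMatrix (hl : IsListing A l)
    (hτ : Prepared ((inputState A l ε).narr 0) ((inputState A l ε).narr 1)
      ((inputState A l ε).rarr 0) l.length s τ) :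
    tapeMeasure.map (outMatrix A l s τ ((inputState A l ε).narr 0))
      = rowSampling A s {i | rowNnz A i ≤ s} := by
  have h1 : tapeMeasure.map (tapeSamples A l s τ ((inputState A l ε).narr 0))
      = Measure.pi fun it : Fin m × Fin s => rowDraw (A it.1) := by
    have h2 : ∀ it : Fin m × Fin s, Measurable fun u : unitInterval × unitInterval =>
        sampleValue A l it.1 (pickEntry τ it.1 u.1 u.2) := fun it => by
      have h1 : Measurable (sampleValue A l it.1) := measurable_from_nat
      exact h1.comp (measurable_pickEntry τ it.1)
    have := map_tapeMeasure (samplePos_injective (s := s) (ε := ε) hl) h2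
    simp_rw [map_sampleValue hl hτ] at this
    exact this
  rw [rowSampling, ← h1, Measure.map_map (measurable_assemble A s _) (measurable_tapeSamples _)]
  rfl

/-- The samples of a row with more than `s` entries pick entries of this row. -/
lemma sampled_mem (hl : IsListing A l)
    (hτ : Prepared ((inputState A l ε).narr 0) ((inputState A l ε).narr 1)
      ((inputState A l ε).rarr 0) l.length s τ) {i : Fin m} (hi : ¬ rowNnz A i ≤ s)
    (u u' : unitInterval) :
    ∃ h : pickEntry τ i u u' < l.length, (l[pickEntry τ i u u']).1 = i := by
  have h1 : 0 < rowSize ((inputState A l ε).narr 0) l.length i := by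
    rw [hl.rowSize_eq]; omega
  obtain ⟨q, hq⟩ := Finset.card_pos.1 h1
  obtain ⟨hqN, hq⟩ := Finset.mem_filter.1 hq
  have := hτ.pickEntry_mem (hl.sorted (ε := ε)) (Finset.mem_range.1 hqN) u u'
  rw [hq] at this
  refine ⟨this.1, Fin.ext ?_⟩
  exact (inputState_row _ this.1).symm.trans this.2

lemma rowNnz_outMatrix_le (hl : IsListing A l)
    (hτ : Prepared ((inputState A l ε).narr 0) ((inputState A l ε).narr 1)
      ((inputState A l ε).rarr 0) l.length s τ) (ω : Tape) (i : Fin m) :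
    rowNnz (outMatrix A l s τ ((inputState A l ε).narr 0) ω) i ≤ s := by
  classical
  by_cases hi : rowNnz A i ≤ s
  · have : rowNnz (outMatrix A l s τ ((inputState A l ε).narr 0) ω) i = rowNnz A i := by
      simp [rowNnz, outMatrix, assemble, show {j | A i j ≠ 0}.ncard ≤ s from hi]
    rwa [this]
  rcases Nat.eq_zero_or_pos n with rfl | hn
  · simp [rowNnz, Set.eq_empty_of_isEmpty]
  have : NeZero n := ⟨hn.ne'⟩
  set f : Fin m × Fin s → Fin n := fun it =>
    if h : pickEntry τ it.1 (ω (2 * samplePos A ((inputState A l ε).narr 0) l.length s it))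
      (ω (2 * samplePos A ((inputState A l ε).narr 0) l.length s it + 1)) < l.length
    then (l[pickEntry τ it.1 (ω (2 * samplePos A ((inputState A l ε).narr 0) l.length s it))
      (ω (2 * samplePos A ((inputState A l ε).narr 0) l.length s it + 1))]).2 else 0 with hf
  have hrow : outMatrix A l s τ ((inputState A l ε).narr 0) ω i
      = assembleIndex A s {i | rowNnz A i ≤ s} f i := by
    funext j
    simp only [outMatrix, assembleIndex, assemble, Set.mem_ofPred_eq, hi, if_false]
    congr 1
    refine Finset.sum_congr rfl fun t _ => ?_
    obtain ⟨h, -⟩ := sampled_mem hl hτ hi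
      (ω (2 * samplePos A ((inputState A l ε).narr 0) l.length s (i, t)))
      (ω (2 * samplePos A ((inputState A l ε).narr 0) l.length s (i, t) + 1))
    rw [tapeSamples, sampleValue_eq h, hf]
    simp only [h, dif_pos]
  have := rowNnz_assembleIndex_le A s {i | rowNnz A i ≤ s} f (i := i) hi
  unfold rowNnz at this ⊢
  rwa [hrow]

end Output
end RowSampling

/-! ### Correctness and running time -/

namespace RowSampling

section Run

variable {m n : ℕ} {A : Matrix (Fin m) (Fin n) ℝ} {l : List (Fin m × Fin n)} {ε : ℝ} {s : ℕ}
  {τ : State}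

/-- A sum of terms that vanish outside of the window `[a, a + b)`. -/
lemma sum_range_of_window {N a b : ℕ} (hab : a + b ≤ N) (F : ℕ → ℕ)
    (hF : ∀ x < N, F x ≠ 0 → a ≤ x ∧ x < a + b) :
    ∑ x ∈ Finset.range N, F x = ∑ t : Fin b, F (a + t) := by
  rw [← Fin.sum_univ_eq_sum_range, Fin.sum_univ_eq_sum_range, ← Finset.sum_range fun t => F (a + t)]
  have h : ∑ x ∈ Finset.Ico a (a + b), F x = ∑ t ∈ Finset.range b, F (a + t) := by
    rw [Finset.sum_Ico_eq_sum_range]; simp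
  rw [← h]
  refine (Finset.sum_subset (fun x hx => ?_) fun x hx hx' => ?_).symm
  · rw [Finset.mem_Ico] at hx; rw [Finset.mem_range]; omega
  · by_contra h0
    exact hx' (Finset.mem_Ico.2 (hF x (Finset.mem_range.1 hx) h0))

open Classical in
/-- The number of times that the entry `k` is picked. -/
lemma count_eq (hl : IsListing A l)
    (hτ : Prepared ((inputState A l ε).narr 0) ((inputState A l ε).narr 1)
      ((inputState A l ε).rarr 0) l.length s τ) (ω : Tape) {k : ℕ} (hk : k < l.length)
    (hi : ¬ rowNnz A l[k].1 ≤ s) :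
    acc (fun x => pickEntry τ (τ.narr 0 x) (ω (2 * x)) (ω (2 * x + 1)))
        (fun x => if Active τ x then 1 else 0) l.length k
      = ∑ t : Fin s, if pickEntry τ l[k].1
        (ω (2 * samplePos A ((inputState A l ε).narr 0) l.length s (l[k].1, t)))
        (ω (2 * samplePos A ((inputState A l ε).narr 0) l.length s (l[k].1, t) + 1)) = k
        then 1 else 0 := by
  have hs := hl.sorted (ε := ε)
  set row := (inputState A l ε).narr 0 with hrow
  have hrowk : row k = l[k].1 := inputState_row k hk
  have hsize : rowSize row l.length l[k].1 = rowNnz A l[k].1 := hl.rowSize_eq (ε := ε) l[k].1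
  have hle := rowStart_add_rowSize_le row l.length l[k].1
  rw [acc, sum_range_of_window (a := rowStart row l.length l[k].1) (b := s) (by omega)]
  · refine Finset.sum_congr rfl fun t _ => ?_
    have ht := t.2
    have hx : rowStart row l.length l[k].1 + t < l.length := by omega
    have hrx : row (rowStart row l.length l[k].1 + t) = l[k].1 :=
      (row_eq_iff hs hx).2 ⟨by omega, by omega⟩
    have hst := hτ.start _ hk
    rw [hrowk] at hst
    have hact : Active τ (rowStart row l.length l[k].1 + t) := by
      unfold Active
      rw [hτ.row_arr, hrx, hτ.samples, hτ.size, hst]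
      omega
    have hpos : samplePos A row l.length s (l[k].1, t) = rowStart row l.length l[k].1 + t := by
      simp [samplePos, hi]
    rw [hpos]
    simp only [hact, if_true, hτ.row_arr, hrx]
  · intro x hx hne
    have h1 : pickEntry τ (τ.narr 0 x) (ω (2 * x)) (ω (2 * x + 1)) = k := by
      by_contra h; exact hne (if_neg h)
    have h2 : Active τ x := by
      by_contra h; exact hne (by simp [h])
    rw [hτ.row_arr] at h1
    have h3 : row x = l[k].1 := by
      rw [← (hτ.pickEntry_mem hs hx _ _).2, h1, hrowk]
    have h4 := (row_eq_iff hs hx).1 h3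
    unfold Active at h2
    have hst := hτ.start _ hx
    rw [h3] at hst
    rw [hτ.row_arr, h3, hτ.samples, hτ.size, hst] at h2
    omega

lemma outMatrix_kept {row : ℕ → ℕ} {ω : Tape} {i : Fin m} (hi : rowNnz A i ≤ s) (j : Fin n) :
    outMatrix A l s τ row ω i j = A i j := by
  simp [outMatrix, assemble, hi]

open Classical in
/-- An entry of a sampled row is proportional to the number of times that it is picked. -/
lemma outMatrix_sampled (hl : IsListing A l)
    (hτ : Prepared ((inputState A l ε).narr 0) ((inputState A l ε).narr 1)
      ((inputState A l ε).rarr 0) l.length s τ) (ω : Tape) {k : ℕ} (hk : k < l.length)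
    (hi : ¬ rowNnz A l[k].1 ≤ s) :
    outMatrix A l s τ ((inputState A l ε).narr 0) ω l[k].1 l[k].2
      = 1 / (s : ℝ) * ((∑ t : Fin s, if pickEntry τ l[k].1
        (ω (2 * samplePos A ((inputState A l ε).narr 0) l.length s (l[k].1, t)))
        (ω (2 * samplePos A ((inputState A l ε).narr 0) l.length s (l[k].1, t) + 1)) = k
        then 1 else 0 : ℕ) * drawCoeff (A l[k].1) l[k].2) := by
  simp only [outMatrix, assemble, Set.mem_ofPred_eq, hi, if_false]
  congr 1
  rw [Nat.cast_sum, Finset.sum_mul]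
  refine Finset.sum_congr rfl fun t _ => ?_
  rw [tapeSamples]
  simp only
  generalize ω (2 * samplePos A ((inputState A l ε).narr 0) l.length s (l[k].1, t)) = u
  generalize ω (2 * samplePos A ((inputState A l ε).narr 0) l.length s (l[k].1, t) + 1) = u'
  obtain ⟨h, hrow⟩ := sampled_mem hl hτ hi u u'
  have hiff : (∃ h : pickEntry τ l[k].1 u u' < l.length, l[pickEntry τ l[k].1 u u'].2 = l[k].2)
      ↔ pickEntry τ l[k].1 u u' = k := by
    constructor
    · rintro ⟨_, h2⟩
      exact (List.Nodup.getElem_inj_iff hl.1).1 (Prod.ext hrow h2)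
    · intro h3
      refine ⟨h, ?_⟩
      simp only [h3]
  unfold sampleValue
  simp only [hiff]
  split_ifs <;> simp

lemma outMatrix_eq_zero {row : ℕ → ℕ} {ω : Tape} {i : Fin m} {j : Fin n} (h : A i j = 0) :
    outMatrix A l s τ row ω i j = 0 := by
  by_cases hi : rowNnz A i ≤ s
  · rw [outMatrix_kept hi, h]
  · simp [outMatrix, assemble, hi, tapeSamples, sampleValue, drawCoeff_zero h]

/-- A bound for the running time, per entry. -/
def sparsifySteps : ℕ := prepareSteps + (sampleBody.steps + 10) + (outputBody.steps + 10)

/-- The algorithm halts in linear time with a random matrix as output: it samples the rows with more than `s` entries, where `s` is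
`sampleSize`, and keeps the other rows. -/
theorem run_sparsify (C : ℕ) (A : Matrix (Fin m) (Fin n) ℝ) (ε : ℝ) (hl : IsListing A l)
    (hs : s = sampleSize C (nnz A) (ns A) (min (nnz A) (Nat.clog 2 (m + n))) ε) :
    ∃ X : Tape → Fin m → Fin n → ℝ,
      (∀ ω, ∃ (t : ℕ) (σ : State), Run ω (sparsify C) (inputState A l ε) t σ ∧
        t ≤ sparsifySteps * (nnz A + 1) ∧ IsOutput σ (X ω)) ∧
      Measurable X ∧
      tapeMeasure.map X = rowSampling A s {i | rowNnz A i ≤ s} ∧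
      (∀ ω i, rowNnz (X ω) i ≤ s) := by
  classical
  obtain ⟨t1, τ, r1, ht1, hτ⟩ := run_prepare C (fun _ => 0) (σ := inputState A l ε)
    (N := l.length) (M₀ := ns A) (by simp [inputState]) hl.sorted
    (fun r hr => by
      have h0 : r ≠ 0 := by omega
      have h1 : r ≠ 1 := by omega
      have h2 : r ≠ 2 := by omega
      simp [inputState, h0, h1, h2])
    (fun r hr => by
      have h0 : r ≠ 0 := by omega
      simp [inputState, h0])
    (fun a ha => by
      have h0 : a ≠ 0 := by omega
      have h1 : a ≠ 1 := by omega
      funext k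
      simp [inputState, h0, h1])
    (fun a ha => by
      have h0 : a ≠ 0 := by omega
      funext k
      simp [inputState, h0]) rfl
    (fun τ M h0 h1 hS hM => hl.maxRatio_eq h0 h1 hS hM)
  have hs' : sampleSize C l.length (ns A) (min l.length (Nat.clog 2
      ((inputState A l ε).nreg 0 + (inputState A l ε).nreg 1))) ((inputState A l ε).rreg 0) = s := by
    rw [hs, hl.length_eq]; rfl
  rw [hs'] at hτ
  refine ⟨outMatrix A l s τ ((inputState A l ε).narr 0), fun ω => ?_, measurable_outMatrix _,
    map_outMatrix hl hτ, rowNnz_outMatrix_le hl hτ⟩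
  obtain ⟨t2, τ2, r2, ht2, F2, hcount, -⟩ := run_sample ω hτ.len hτ.pos hτ.count
  have f : ∀ a, a ≠ 10 → τ2.narr a = τ.narr a := fun a ha =>
    F2.narr a (by simp [forLoop, sampleBody, block, Prog.KeepsNArr, Ne.symm ha])
  have fr : ∀ a, τ2.rarr a = τ.rarr a := fun a =>
    F2.rarr a (by simp [forLoop, sampleBody, block, Prog.KeepsRArr])
  have fn : ∀ r, r ≠ 4 → r ≠ 8 → τ2.nreg r = τ.nreg r := fun r h h' =>
    F2.nreg r (by simp [forLoop, sampleBody, block, Prog.KeepsNReg, Ne.symm h, Ne.symm h'])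
  have hrow : ∀ k (h : k < l.length), τ2.narr 0 k = l[k].1 := fun k h => by
    rw [f 0 (by decide), hτ.row_arr, inputState_row k h]
  have h7 : τ2.nreg 7 = s := (fn 7 (by decide) (by decide)).trans hτ.samples
  have hsize : ∀ k (h : k < l.length), τ2.narr 4 (τ2.narr 0 k) = rowNnz A l[k].1 := fun k h => by
    rw [hrow k h, f 4 (by decide), hτ.size, hl.rowSize_eq]
  have hval : ∀ k (h : k < l.length), τ2.rarr 0 k = A l[k].1 l[k].2 := fun k h => by
    rw [fr, hτ.val, inputState_val k h]
  have hcoeff : ∀ k (h : k < l.length), τ2.rarr 0 k / (τ2.rarr 7 k / τ2.rarr 2 (τ2.narr 0 k))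
      = drawCoeff (A l[k].1) l[k].2 := fun k h => by
    rw [hval k h, fr, fr, hτ.abs k h, hτ.rowL1, hrow k h,
      hl.acc_row (g := fun x => |x|) abs_zero, inputState_val k h]
    rfl
  have hV : ∀ k (h : k < l.length),
      outMatrix A l s τ ((inputState A l ε).narr 0) ω l[k].1 l[k].2 = outValue τ2 k := by
    intro k h
    unfold outValue
    rw [h7, hsize k h]
    split_ifs with hi
    · rw [outMatrix_sampled hl hτ ω h (not_le.2 hi), hcoeff k h, hcount,
        count_eq hl hτ ω h (not_le.2 hi)]
    · rw [outMatrix_kept (not_lt.1 hi), hval k h]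
  have hne : ∀ k (h : k < l.length), drawCoeff (A l[k].1) l[k].2 ≠ 0 := fun k h h0 => by
    have h1 := drawWeight_mul_coeff (A l[k].1) l[k].2
    rw [h0, mul_zero] at h1
    exact hl.val_ne_zero k h h1.symm
  have he : ∀ k (h : k < l.length),
      outMatrix A l s τ ((inputState A l ε).narr 0) ω l[k].1 l[k].2 ≠ 0 ↔ Emitted τ2 k := by
    intro k h
    rw [hV k h]
    unfold Emitted outValue
    rw [hcoeff k h, h7, hsize k h]
    split_ifs with hi
    · simp only [hi, true_imp_iff]
      constructor
      · intro h0
        by_contra hz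
        rw [Nat.eq_zero_of_not_pos hz] at h0
        simp at h0
      · intro hpos
        have hspos : s ≠ 0 := by
          rintro rfl
          rw [hcount, count_eq hl hτ ω h (not_le.2 hi)] at hpos
          simp at hpos
        have h1 : (s : ℝ) ≠ 0 := Nat.cast_ne_zero.2 hspos
        have h2 : (τ2.narr 10 k : ℝ) ≠ 0 := Nat.cast_ne_zero.2 hpos.ne'
        exact mul_ne_zero (one_div_ne_zero h1) (mul_ne_zero h2 (hne k h))
    · simp only [hi, false_imp_iff, iff_true]
      rw [hval k h]; exact hl.val_ne_zero k h
  obtain ⟨t3, τ3, r3, ht3, F3, hlen, hout⟩ := run_output ω l (σ := τ2)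
    ((fn 2 (by decide) (by decide)).trans hτ.len) ((fn 3 (by decide) (by decide)).trans hτ.out)
    (fun p => p.1) (fun p => p.2)
    (fun p => outMatrix A l s τ ((inputState A l ε).narr 0) ω p.1 p.2)
    (fun p => outMatrix A l s τ ((inputState A l ε).narr 0) ω p.1 p.2 ≠ 0) hrow
    (fun k h => by rw [f 1 (by decide), hτ.col_arr, inputState_col k h]) he hV
  refine ⟨_, τ3, (r1.congr_tape (prepare_noDraw C) ω).seq (r2.seq r3), ?_,
    _, ⟨hl.1.filter _, fun p => ?_, hl.2.2.filter _⟩, hlen, hout⟩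
  · rw [← hl.length_eq]
    have : sparsifySteps * (l.length + 1) = prepareSteps * (l.length + 1)
        + (sampleBody.steps + 10) * (l.length + 1) + (outputBody.steps + 10) * (l.length + 1) := by
      unfold sparsifySteps; ring
    omega
  · rw [List.mem_filter, hl.2.1 p]
    exact ⟨fun h => by simpa using h.2,
      fun h => ⟨fun h0 => h (outMatrix_eq_zero h0), by simpa using h⟩⟩

end Run
end RowSampling

/-! ### The guarantees of the algorithm -/

namespace RowSampling

section Guarantee

variable {m n : ℕ} (A : Matrix (Fin m) (Fin n) ℝ)

/-- The number of samples that the algorithm uses, with the constant `(c + 20)²`. The logarithm is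
represented by `⌈log₂ (m + n)⌉`, cut off at the number of entries. -/
noncomputable def algSampleSize (c : ℕ) (ε : ℝ) : ℕ :=
  sampleSize ((c + 20) ^ 2) (nnz A) (ns A) (min (nnz A) (Nat.clog 2 (m + n))) ε

lemma bound_nonneg (ε : ℝ) : 0 ≤ ε⁻¹ ^ 2 * ns A * Real.log ((m : ℝ) + n) := by
  have h1 : 0 ≤ Real.log ((m : ℝ) + n) := by
    have := Real.log_natCast_nonneg (m + n)
    push_cast at this
    exact this
  have := ns_nonneg A
  positivity

variable {A}

lemma nnz_eq_zero_iff : nnz A = 0 ↔ A = 0 := by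
  rw [nnz, Set.ncard_eq_zero (Set.toFinite _), Set.eq_empty_iff_forall_notMem]
  constructor
  · intro h
    ext i j
    by_contra h0
    exact h (i, j) h0
  · rintro rfl p hp
    exact hp rfl

lemma log_le_clog [NeZero m] [NeZero n] :
    Real.log ((m : ℝ) + n) ≤ (Nat.clog 2 (m + n) : ℝ) ∧
      (Nat.clog 2 (m + n) : ℝ) ≤ 3 * Real.log ((m : ℝ) + n) := by
  have h2 := two_le_add (m := m) (n := n)
  have h2' : 2 ≤ m + n := by exact_mod_cast h2
  have hl2 := Real.log_two_gt_d9
  have hl2' := Real.log_two_lt_d9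
  have hL : Real.log 2 ≤ Real.log ((m : ℝ) + n) := Real.log_le_log (by norm_num) h2
  constructor
  · have h : ((m : ℝ) + n) ≤ 2 ^ Nat.clog 2 (m + n) := by
      exact_mod_cast Nat.le_pow_clog (by norm_num : 1 < 2) (m + n)
    have h3 := Real.log_le_log (by linarith) h
    rw [Real.log_pow] at h3
    have h4 : (0 : ℝ) ≤ Nat.clog 2 (m + n) := Nat.cast_nonneg _
    nlinarith
  · have h : (2 : ℝ) ^ (Nat.clog 2 (m + n) - 1) < (m : ℝ) + n := by
      exact_mod_cast Nat.pow_pred_clog_lt_self (by norm_num : 1 < 2) h2'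
    have h3 := Real.log_lt_log (by positivity) h
    have hpos : 1 ≤ Nat.clog 2 (m + n) := Nat.clog_pos (by norm_num) h2'
    rw [Real.log_pow, Nat.cast_sub hpos, Nat.cast_one] at h3
    nlinarith

/-- Without samples the result is `0`, since only rows without entries are kept. -/
lemma assembleIndex_samples_zero (f : Fin m × Fin 0 → Fin n) :
    assembleIndex A 0 {i | rowNnz A i ≤ 0} f = 0 := by
  funext i j
  by_cases hi : rowNnz A i = 0
  · have := (Set.ncard_eq_zero (Set.toFinite _)).1 hi
    have hj : ¬ A i j ≠ 0 := fun h => (this ▸ h : j ∈ (∅ : Set (Fin n)))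
    simp [assembleIndex, assemble, hi, not_not.1 hj]
  · simp [assembleIndex, assemble, hi]

lemma isSparsifier_self {ε : ℝ} (hε : 0 < ε) : IsSparsifier ε A A := by
  refine ⟨⟨fun _ _ => 1, by simp⟩, ?_⟩
  rw [sub_self, specNorm_zero]
  exact mul_nonneg hε.le (specNorm_nonneg A)

lemma rowSampling_failure_zero_of_forall [NeZero n] {s : ℕ} {keep : Set (Fin m)} {ε : ℝ}
    (h : ∀ f, IsSparsifier ε A (assembleIndex A s keep f)) :
    rowSampling A s keep {B | ¬ IsSparsifier ε A B} = 0 :=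
  ae_iff.1 (rowSampling_ae_of_forall A s keep h)

lemma one_le_min_clog [NeZero m] [NeZero n] (hA : A ≠ 0) :
    1 ≤ min (nnz A) (Nat.clog 2 (m + n)) := by
  have h2' : 2 ≤ m + n := by exact_mod_cast two_le_add (m := m) (n := n)
  exact le_min (Nat.one_le_iff_ne_zero.2 (mt nnz_eq_zero_iff.1 hA))
    (Nat.clog_pos (by norm_num) h2')

/-- A lower bound for the number of samples before rounding, for `ε < 1`. -/
lemma le_target [NeZero m] [NeZero n] (hA : A ≠ 0) (c : ℕ) {ε : ℝ} (hε : 0 < ε) (hε1 : ε < 1)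
    {L : ℕ} : 400 * (L : ℝ) ≤ (((c + 20) ^ 2 : ℕ) : ℝ) * (ns A * L / (ε * ε)) := by
  have h1 : (400 : ℝ) ≤ (((c + 20) ^ 2 : ℕ) : ℝ) := by
    push_cast
    have : (0 : ℝ) ≤ c := Nat.cast_nonneg c
    nlinarith
  have h2 : (L : ℝ) ≤ ns A * L / (ε * ε) := by
    rw [le_div_iff₀ (by positivity)]
    have hL : (0 : ℝ) ≤ L := Nat.cast_nonneg L
    have h3 := one_le_ns hA
    have h4 : ε * ε ≤ 1 := by nlinarith
    nlinarith [mul_le_mul_of_nonneg_left h4 hL, mul_le_mul_of_nonneg_right h3 hL]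
  exact mul_le_mul h1 h2 (Nat.cast_nonneg L) (by positivity)

/-- Rounding up at most doubles the number of samples, and `⌈log₂ x⌉ ≤ 3 log x` for `x ≥ 2`; this is
where the factor `6` comes from. -/
lemma algSampleSize_le (c : ℕ) {ε : ℝ} (hε : 0 < ε) :
    (algSampleSize A c ε : ℝ)
      ≤ 6 * ((c : ℝ) + 20) ^ 2 * (ε⁻¹ ^ 2 * ns A * Real.log ((m : ℝ) + n)) := by
  have hb := mul_nonneg (by positivity : (0 : ℝ) ≤ 6 * ((c : ℝ) + 20) ^ 2) (bound_nonneg A ε)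
  by_cases hA : A = 0
  · have : algSampleSize A c ε = 0 := by
      unfold algSampleSize sampleSize
      rw [nnz_eq_zero_iff.2 hA, Nat.zero_min]
    rw [this]; exact_mod_cast hb
  by_cases hε1 : ε < 1
  swap
  · have : algSampleSize A c ε = 0 := by simp [algSampleSize, sampleSize, hε1]
    rw [this]; exact_mod_cast hb
  have hm : NeZero m := ⟨by rintro rfl; exact hA (Matrix.ext fun i => i.elim0)⟩
  have hn : NeZero n := ⟨by rintro rfl; exact hA (Matrix.ext fun _ j => j.elim0)⟩
  set L := min (nnz A) (Nat.clog 2 (m + n)) with hLdef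
  have hL1 : (1 : ℝ) ≤ L := by exact_mod_cast one_le_min_clog hA
  have hT := le_target hA c hε hε1 (L := L)
  set T := (((c + 20) ^ 2 : ℕ) : ℝ) * (ns A * L / (ε * ε)) with hTdef
  have hs : (algSampleSize A c ε : ℝ) ≤ ⌈T⌉₊ := by
    have : algSampleSize A c ε ≤ ⌈T⌉₊ := by
      simp only [algSampleSize, sampleSize, hε1, if_true]
      exact min_le_right _ _
    exact_mod_cast this
  have hceil := Nat.ceil_lt_add_one (show (0 : ℝ) ≤ T by linarith)
  have hLlog : (L : ℝ) ≤ 3 * Real.log ((m : ℝ) + n) :=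
    (Nat.cast_le.2 (min_le_right _ _)).trans log_le_clog.2
  have hTle : T ≤ 3 * (((c : ℝ) + 20) ^ 2 * (ε⁻¹ ^ 2 * ns A * Real.log ((m : ℝ) + n))) := by
    have e : T = ((c : ℝ) + 20) ^ 2 * (ε⁻¹ ^ 2 * ns A) * L := by
      rw [hTdef]; push_cast; field_simp
    have h0 : 0 ≤ ((c : ℝ) + 20) ^ 2 * (ε⁻¹ ^ 2 * ns A) := by
      have := ns_nonneg A
      positivity
    rw [e]
    calc _ ≤ ((c : ℝ) + 20) ^ 2 * (ε⁻¹ ^ 2 * ns A) * (3 * Real.log ((m : ℝ) + n)) :=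
          mul_le_mul_of_nonneg_left hLlog h0
      _ = _ := by ring
  linarith

/-- The matrix Bernstein inequality applies to the algorithm's number of samples. The few-sample
regime, in which the rows that are kept would be a problem, does not occur for `ε < 1`. -/
theorem algSampleSize_failure_le (c : ℕ) {ε : ℝ} (hε : 0 < ε) :
    rowSampling A (algSampleSize A c ε) {i | rowNnz A i ≤ algSampleSize A c ε}
      {B | ¬ IsSparsifier ε A B} ≤ ENNReal.ofReal (1 / ((m : ℝ) + n) ^ c) := by
  by_cases hmn : m = 0 ∨ n = 0
  · rw [not_isSparsifier_eq_empty hmn, measure_empty]; exact zero_le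
  push Not at hmn
  have : NeZero m := ⟨hmn.1⟩
  have : NeZero n := ⟨hmn.2⟩
  by_cases hA : A = 0
  · subst hA
    rw [rowSampling_zero_failure]; exact zero_le
  by_cases hε1 : ε < 1
  swap
  · have hs : algSampleSize A c ε = 0 := by simp [algSampleSize, sampleSize, hε1]
    rw [hs, rowSampling_failure_zero_of_forall fun f => ?_]
    · exact zero_le
    · rw [assembleIndex_samples_zero]
      refine ⟨⟨0, by simp⟩, ?_⟩
      change specNorm ((0 : Matrix (Fin m) (Fin n) ℝ) - A) ≤ _
      rw [zero_sub, specNorm_neg]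
      nlinarith [specNorm_nonneg A]
  set s := algSampleSize A c ε with hs
  by_cases hsN : nnz A ≤ s
  · -- all rows are kept
    rw [rowSampling_failure_zero_of_forall fun f => ?_]
    · exact zero_le
    · have : assembleIndex A s {i | rowNnz A i ≤ s} f = A := by
        funext i j
        simp [assembleIndex, assemble, (rowNnz_le_nnz A i).trans hsN]
      rw [this]
      exact isSparsifier_self hε
  set L := min (nnz A) (Nat.clog 2 (m + n)) with hLdef
  have hT := le_target hA c hε hε1 (L := L)
  set T := (((c + 20) ^ 2 : ℕ) : ℝ) * (ns A * L / (ε * ε)) with hTdef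
  have hsT : s = ⌈T⌉₊ := by
    have h1 : s = min (nnz A) ⌈T⌉₊ := by
      simp only [hs, algSampleSize, sampleSize, hε1, if_true, hTdef, hLdef]
    omega
  have hTs : T ≤ s := hsT ▸ Nat.le_ceil T
  have hLs : L ≤ s := by
    have h0 : (0 : ℝ) ≤ L := Nat.cast_nonneg L
    exact_mod_cast (by linarith : (L : ℝ) ≤ s)
  -- the bound by the number of entries in `L` is not active, since otherwise all rows are kept
  have hLc : L = Nat.clog 2 (m + n) := by omega
  have hlog : Real.log ((m : ℝ) + n) ≤ L := hLc ▸ log_le_clog.1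
  have hlogpos := log_add_pos (m := m) (n := n)
  refine rowSampling_failure_le_of_many hA hε c s _ (by linarith) ?_
  have e : T = ((c : ℝ) + 20) ^ 2 * (ε⁻¹ ^ 2 * ns A * L) := by
    rw [hTdef]; push_cast; field_simp
  refine le_trans ?_ (e ▸ hTs)
  have := ns_nonneg A
  gcongr

end Guarantee
end RowSampling

open RowSampling
theorem mainTheorem3 (c : ℕ) :
    ∃ (P : Prog) (C : ℝ) (K : ℕ), 0 < C ∧
      ∀ (m n : ℕ) (A : Matrix (Fin m) (Fin n) ℝ) (ε : ℝ), 0 < ε →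
        -- sampling every row
        (∀ s : ℕ, C * (ε⁻¹ ^ 2 * ns A * Real.log ((m : ℝ) + n)) ≤ s →
          (∀ᵐ B ∂(rowSampling A s ∅), ∀ i, rowNnz B i ≤ s) ∧
          rowSampling A s ∅ {B | ¬ IsSparsifier ε A B}
            ≤ ENNReal.ofReal (1 / ((m : ℝ) + n) ^ c)) ∧
        -- the algorithm
        ∃ s : ℕ, (s : ℝ) ≤ C * (ε⁻¹ ^ 2 * ns A * Real.log ((m : ℝ) + n)) ∧
          ∀ l : List (Fin m × Fin n), IsListing A l →
            ∃ X : Tape → Fin m → Fin n → ℝ,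
              (∀ ω, ∃ (t : ℕ) (σ : State),
                Run ω P (inputState A l ε) t σ ∧ t ≤ K * (nnz A + 1) ∧ IsOutput σ (X ω)) ∧
              tapeMeasure.map X = rowSampling A s {i | rowNnz A i ≤ s} ∧
              (∀ ω i, rowNnz (X ω) i ≤ s) ∧
              tapeMeasure {ω | ¬ IsSparsifier ε A (X ω)}
                ≤ ENNReal.ofReal (1 / ((m : ℝ) + n) ^ c) := by
  refine ⟨sparsify ((c + 20) ^ 2), 6 * ((c : ℝ) + 20) ^ 2, sparsifySteps, by positivity,
    fun m n A ε hε => ⟨fun s hs => rowSampling_all c A hε s (le_trans ?_ hs),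
      algSampleSize A c ε, algSampleSize_le c hε, fun l hl => ?_⟩⟩
  · have := mul_nonneg (sq_nonneg ((c : ℝ) + 20)) (bound_nonneg A ε)
    linarith
  · obtain ⟨X, hrun, hX, hmap, hnnz⟩ := run_sparsify ((c + 20) ^ 2) A ε hl rfl
    refine ⟨X, hrun, hmap, hnnz, (Measure.le_map_apply hX.aemeasurable {B | ¬ IsSparsifier ε A B}).trans ?_⟩
    rw [hmap]
    exact algSampleSize_failure_le c hε
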